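/- Let $n\ge 1$ and let $\Omega\subset\mathbb C^n$ be a bounded strongly convex domain, that is, a nonempty bounded open convex set with a $\mathcal C^2$ defining function near $b\Omega$ (with nonvanishing differential on $b\Omega$) whose real Hessian is positive definite on the real tangent spaces of $b\Omega$. Write $\langle\zeta,z\rangle=\sum_j\zeta_jz_j$, let $\sigma_\Omega$ be the surface area measure on $b\Omega$, let $H_\Omega(z)=\sup_{\zeta\in\Omega}\operatorname{Re}\langle\zeta,z\rangle$ be the support function of $\Omega$, and let $(dd^cH_\Omega)^n$ be its Monge--Ampère measure on $\mathbb C^n$, where $d^c=\frac{i}{4\pi}(\overline\partial-\partial)$; this measure exists as the vague limit of the smooth Monge--Ampère measures of the standard regularizations of $H_\Omega$. For a measure $\omega$ on $\mathbb C^n$ let $A^2(\mathbb C^n,\omega)$ be the space of entire functions $F$ with $\|F\|_\omega^2=\int_{\mathbb C^n}|F|^2\,d\omega<\infty$, with norm $\|\cdot\|_\omega$. (i) There are constants $c,C>0$, depending only on $\Omega$, such that for all $z\in\mathbb C^n$ with $\|z\|\ge 1$, $$c\,\frac{e^{2H_\Omega(z)}}{\|z\|^{n-\frac12}}\le \int_{b\Omega}\bigl|e^{\langle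 z,\zeta\rangle}\bigr|^2d\sigma_\Omega(\zeta)\le C\,\frac{e^{2H_\Omega(z)}}{\|z\|^{n-\frac12}}.$$ (ii) Let $$\omega_\Omega=\|e^{\langle z,\cdot\rangle}\|_{L^2(\sigma_\Omega)}^{-2}\,(dd^cH_\Omega)^n,\qquad \nu_\Omega=e^{-2H_\Omega(z)}\|z\|^{n-\frac12}\,(dd^cH_\Omega)^n .$$ Then the identity map is an isomorphism of normed spaces between $A^2(\mathbb C^n,\omega_\Omega)$ and $A^2(\mathbb C^n,\nu_\Omega)$: $\|\cdot\|_{\omega_\Omega}$ and $\|\cdot\|_{\nu_\Omega}$ are norms on these spaces, the two spaces consist of the same entire functions, and there are constants $c',C'>0$ with $c'\|F\|_{\nu_\Omega}\le\|F\|_{\omega_\Omega}\le C'\|F\|_{\nu_\Omega}$ for all $F$ in them. (iii) If $0\in\Omega$, then (ii) also holds when $\sigma_\Omega$ is replaced in the definition of $\omega_\Omega$ by the boundary Monge--Ampère measure $\mu_\Omega=j^*\bigl(d^cm_\Omega\wedge(dd^cm_\Omega)^{n-1}\bigr)$, where $j:b\Omega\to\mathbb C^n$ is the inclusion and $m_\Omega(z)=\inf\{t>0: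 z/t\in\Omega\}$ is the Minkowski functional of $\Omega$. -/

import Mathlib

open MeasureTheory Filter Topology Set
open scoped ENNReal

noncomputable section

namespace LaplaceBergman

/-- `ℂⁿ` with its Euclidean norm and Lebesgue measure. -/
abbrev Cn (n : ℕ) : Type := EuclideanSpace ℂ (Fin n)

variable {n : ℕ}

/-- The bilinear pairing `⟨ζ, z⟩ = ζ₁ z₁ + ⋯ + ζₙ zₙ` (no conjugation). -/
def pairing (ζ z : Cn n) : ℂ := ∑ j, ζ j * z j

/-- The support function `H_Ω(z) = sup_{ζ ∈ Ω} Re ⟨ζ, z⟩`. -/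
def supportFun (Ω : Set (Cn n)) (z : Cn n) : ℝ :=
  sSup ((fun ζ => (pairing ζ z).re) '' Ω)

/-- A bounded strongly convex domain: a nonempty bounded open convex set with a `C²` defining
function near its boundary (with nonvanishing differential on the boundary) whose real Hessian is
positive definite on every real tangent space of the boundary. -/
structure IsBoundedStronglyConvexDomain (Ω : Set (Cn n)) : Prop where
  nonempty : Ω.Nonempty
  isOpen : IsOpen Ω
  convex : Convex ℝ Ω
  isBounded : Bornology.IsBounded Ω
  exists_defining : ∃ (U : Set (Cn n)) (ρ : Cn n → ℝ),
    IsOpen U ∧ frontier Ω ⊆ U ∧ ContDiffOn ℝ 2 ρ U ∧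
    (∀ z ∈ U, z ∈ Ω ↔ ρ z < 0) ∧
    (∀ p ∈ frontier Ω, fderiv ℝ ρ p ≠ 0) ∧
    (∀ p ∈ frontier Ω, ∀ v : Cn n, v ≠ 0 → fderiv ℝ ρ p v = 0 →
      0 < fderiv ℝ (fderiv ℝ ρ) p v v)

/-- The real coordinate vector `∂/∂x_j`. -/
def ex (j : Fin n) : Cn n := EuclideanSpace.single j 1

/-- The real coordinate vector `∂/∂y_j`. -/
def ey (j : Fin n) : Cn n := EuclideanSpace.single j Complex.I

/-- `∂u/∂z_j = (u_{x_j} - i u_{y_j}) / 2`. -/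
def dz (u : Cn n → ℝ) (p : Cn n) (j : Fin n) : ℂ :=
  ((fderiv ℝ u p (ex j) : ℂ) - Complex.I * (fderiv ℝ u p (ey j) : ℂ)) / 2

/-- `∂u/∂z̄_j = (u_{x_j} + i u_{y_j}) / 2`. -/
def dzbar (u : Cn n → ℝ) (p : Cn n) (j : Fin n) : ℂ :=
  ((fderiv ℝ u p (ex j) : ℂ) + Complex.I * (fderiv ℝ u p (ey j) : ℂ)) / 2

/-- The complex Hessian `(∂²u / ∂z_j ∂z̄_k)_{j,k}`. -/
def complexHessian (u : Cn n → ℝ) (p : Cn n) : Matrix (Fin n) (Fin n) ℂ :=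
  fun j k =>
    (((fderiv ℝ (fderiv ℝ u) p (ex j) (ex k) + fderiv ℝ (fderiv ℝ u) p (ey j) (ey k) : ℝ) : ℂ) +
      Complex.I * ((fderiv ℝ (fderiv ℝ u) p (ex j) (ey k) -
        fderiv ℝ (fderiv ℝ u) p (ey j) (ex k) : ℝ) : ℂ)) / 4

/-- The Lebesgue density of `(dd^c u)^n` for a `C²` function `u`. Since `d^c = (i/4π)(∂̄ - ∂)`, one
has `dd^c = (i/2π) ∂∂̄` and `(dd^c u)^n = (n!/πⁿ) det (∂²u/∂z_j∂z̄_k) dV`. -/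
def smoothMongeAmpereDensity (u : Cn n → ℝ) (p : Cn n) : ℝ :=
  (n.factorial : ℝ) / Real.pi ^ n * (complexHessian u p).det.re

/-- A smoothing kernel: smooth, nonnegative, compactly supported, with integral one. -/
structure IsMollifier (χ : Cn n → ℝ) : Prop where
  contDiff : ContDiff ℝ (⊤ : ℕ∞) χ
  nonneg : ∀ w, 0 ≤ χ w
  hasCompactSupport : HasCompactSupport χ
  integral_eq_one : ∫ w, χ w = 1

/-- The regularization `u_ε(z) = ∫ χ(w) u(z - ε w) dw`. -/
def mollify (χ u : Cn n → ℝ) (ε : ℝ) (z : Cn n) : ℝ :=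
  ∫ w, χ w * u (z - ε • w)

/-- `M` is the Bedford--Taylor Monge--Ampère measure `(dd^c u)^n` of a continuous
plurisubharmonic (e.g. convex) function `u`: it is a Radon measure, and it is the vague limit of
the measures `(dd^c u_ε)^n` of the regularizations of `u`, for each choice of smoothing kernel. -/
structure IsMongeAmpereMeasure (u : Cn n → ℝ) (M : Measure (Cn n)) : Prop where
  isFiniteMeasureOnCompacts : IsFiniteMeasureOnCompacts M
  tendsto : ∀ χ : Cn n → ℝ, IsMollifier χ →
    ∀ ψ : Cn n → ℝ, Continuous ψ → HasCompactSupport ψ →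
      Tendsto (fun ε : ℝ => ∫ z, ψ z * smoothMongeAmpereDensity (mollify χ u ε) z)
        (𝓝[>] 0) (𝓝 (∫ z, ψ z ∂M))

theorem exists_isMollifier : ∃ χ : Cn n → ℝ, IsMollifier χ := by
  let f : ContDiffBump (0 : Cn n) := ⟨1, 2, one_pos, one_lt_two⟩
  exact ⟨f.normed volume, f.contDiff_normed, fun w => f.nonneg_normed w,
    f.hasCompactSupport_normed, f.integral_normed⟩

/-- The Monge--Ampère measure is unique when it exists. -/
theorem IsMongeAmpereMeasure.unique {u : Cn n → ℝ} {M M' : Measure (Cn n)}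
    (h : IsMongeAmpereMeasure u M) (h' : IsMongeAmpereMeasure u M') : M = M' := by
  obtain ⟨χ, hχ⟩ := exists_isMollifier (n := n)
  have := h.isFiniteMeasureOnCompacts
  have := h'.isFiniteMeasureOnCompacts
  refine Measure.ext_of_integral_eq_on_compactlySupported fun f => ?_
  exact tendsto_nhds_unique (h.tendsto χ hχ f f.continuous f.hasCompactSupport)
    (h'.tendsto χ hχ f f.continuous f.hasCompactSupport)

open Classical in
/-- The Monge--Ampère measure `(dd^c u)^n` (zero if it does not exist). -/
def mongeAmpere (u : Cn n → ℝ) : Measure (Cn n) :=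
  if h : ∃ M, IsMongeAmpereMeasure u M then h.choose else 0

/-- The Euclidean surface area measure `σ_Ω` on the boundary of `Ω`, regarded as a measure
on `ℂⁿ`. -/
def surfaceMeasure (Ω : Set (Cn n)) : Measure (Cn n) :=
  (Measure.euclideanHausdorffMeasure (2 * n - 1) : Measure (Cn n)).restrict (frontier Ω)

/-- The density with respect to surface area of the pullback of `d^cρ ∧ (dd^cρ)^{n-1}` to a level
set of the `C²` function `ρ`:
`- ((n-1)!/πⁿ) det [[0, ∂ρ/∂z̄_k], [∂ρ/∂z_j, ∂²ρ/∂z_j∂z̄_k]] / ‖∇ρ‖`. -/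
def lerayLeviDensity (ρ : Cn n → ℝ) (p : Cn n) : ℝ :=
  -((n - 1).factorial : ℝ) *
      (Matrix.fromBlocks (0 : Matrix Unit Unit ℂ) (Matrix.replicateRow Unit (dzbar ρ p))
        (Matrix.replicateCol Unit (dz ρ p)) (complexHessian ρ p)).det.re /
    (Real.pi ^ n * ‖fderiv ℝ ρ p‖)

/-- The boundary Monge--Ampère measure `μ_Ω = j^*(d^c m_Ω ∧ (dd^c m_Ω)^{n-1})` of a `C²` convex
domain `Ω` containing the origin, where `m_Ω` is the Minkowski functional of `Ω`. -/
def boundaryMongeAmpere (Ω : Set (Cn n)) : Measure (Cn n) :=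
  (surfaceMeasure Ω).withDensity fun ζ => ENNReal.ofReal (lerayLeviDensity (gauge Ω) ζ)

/-- `‖e^{⟨z, ·⟩}‖²_{L²(τ)}`. -/
def expNormSq (τ : Measure (Cn n)) (z : Cn n) : ℝ≥0∞ :=
  ∫⁻ ζ, ‖Complex.exp (pairing z ζ)‖ₑ ^ 2 ∂τ

/-- `‖e^{⟨z, ·⟩}‖^{-2}_{L²(τ)} (dd^c H_Ω)^n`; this is `ω_Ω` for the boundary measure `τ`. -/
def omegaMeasure (Ω : Set (Cn n)) (τ : Measure (Cn n)) : Measure (Cn n) :=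
  (mongeAmpere (supportFun Ω)).withDensity fun z => (expNormSq τ z)⁻¹

/-- `ν_Ω = e^{-2 H_Ω(z)} ‖z‖^{n - 1/2} (dd^c H_Ω)^n`. -/
def nuMeasure (Ω : Set (Cn n)) : Measure (Cn n) :=
  (mongeAmpere (supportFun Ω)).withDensity fun z =>
    ENNReal.ofReal (Real.exp (-2 * supportFun Ω z) * ‖z‖ ^ ((n : ℝ) - 1 / 2))

/-- The weighted Bergman space `A²(ℂⁿ, ω)` of entire functions that are square-integrable for
`ω`. -/
def bergmanSpace (ω : Measure (Cn n)) : Submodule ℂ (Cn n → ℂ) where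
  carrier := {F | Differentiable ℂ F ∧ MemLp F 2 ω}
  zero_mem' := ⟨differentiable_const 0, MemLp.zero⟩
  add_mem' := fun hF hG => ⟨hF.1.add hG.1, hF.2.add hG.2⟩
  smul_mem' := fun c _ hF => ⟨hF.1.const_smul c, hF.2.const_smul c⟩

/-- The norm `‖F‖_ω = (∫ |F|² dω)^{1/2}` of `A²(ℂⁿ, ω)`. -/
def bergmanNorm (ω : Measure (Cn n)) (F : Cn n → ℂ) : ℝ := (eLpNorm F 2 ω).toReal

/-- The identity map is an isomorphism of the normed spaces `A²(ℂⁿ, ω)` and `A²(ℂⁿ, ν)`: `‖·‖_ω`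
and `‖·‖_ν` are norms (not just seminorms) on them, the two spaces consist of the same functions,
and the two norms are equivalent. -/
def IdIsNormedSpaceIso (ω ν : Measure (Cn n)) : Prop :=
  (∀ F ∈ bergmanSpace ω, bergmanNorm ω F = 0 → F = 0) ∧
  (∀ F ∈ bergmanSpace ν, bergmanNorm ν F = 0 → F = 0) ∧
  bergmanSpace ω = bergmanSpace ν ∧
  ∃ c C : ℝ, 0 < c ∧ 0 < C ∧ ∀ F ∈ bergmanSpace ω,
    c * bergmanNorm ν F ≤ bergmanNorm ω F ∧ bergmanNorm ω F ≤ C * bergmanNorm ν F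

end LaplaceBergman

end

/-! Everything rests on two-sided quadratic control of the boundary. Adding a large multiple of ρ²
to the defining function makes its Hessian positive definite near the boundary, so that c‖ζ - p‖² ≤
-⟨u, ζ - p⟩ on the closure of Ω for each boundary point p with outward unit normal u
(`exists_quadratic_separation`). In the other direction, an upper bound on the Hessian of ρ yields a
tangent interior ball of fixed radius at each boundary point (`exists_interior_ball`).

For (i), the exponent 2 Re⟨z, ζ⟩ attains its maximum 2H(z) at the boundary point p whose normal is
the conjugate of z/‖z‖, and along the boundary it drops from there like ‖z‖‖ζ - p‖². The integral
therefore lives on a cap of radius ‖z‖^(-1/2), whose area is of order ‖z‖^(-(2n-1)/2); this is the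
claimed power.

For (ii), the Monge–Ampère measure has to be identified first. The gradient of the real support
function is the support point, a C¹ inverse of the Gauss map, so H is C² off the origin. Its Hessian
degenerates only radially, and the Levi form, which averages over v and iv, is therefore positive
definite. Since H is homogeneous of degree one, its Monge–Ampère density is comparable to ‖z‖^(-n).
The same scaling bounds the densities of the regularizations by C‖z‖^(-n) uniformly in ε; this is
locally integrable, so dominated convergence gives the limit measure, which has no atom at the
origin (`isMongeAmpereMeasure_supportMongeAmpere`).

By (i) the two weights are comparable for ‖z‖ ≥ 1. Near the origin the weight of ν vanishes and that
of ω does not, so one of the two norm inequalities must use holomorphy: averaging F(wz)² over the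
circle |w - 1| = 3 bounds the mass of |F|² on the unit ball by its mass on the annulus 1 ≤ ‖z‖ < 4
(`setLIntegral_ball_le_setLIntegral_annulus`).

For (iii), the gauge is C² at the boundary points, with Hessian positive off the radial direction.
The bordered determinant then has a strict sign, so the boundary Monge–Ampère measure is comparable
to surface area, and comparability is all that the argument for (ii) uses. -/

noncomputable section

namespace LaplaceBergman

/-! ### Defining functions and supporting hyperplanes -/

section RealGeometry

variable {E : Type*} [NormedAddCommGroup E] [InnerProductSpace ℝ E]

/-- A bounded convex domain `Ω` together with a `C²` defining function `ρ` on a neighbourhood `U`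
of the boundary, whose Hessian is positive definite on the tangent spaces of the boundary. -/
structure DefiningData (Ω U : Set E) (ρ : E → ℝ) : Prop where
  nonempty : Ω.Nonempty
  isOpen : IsOpen Ω
  convex : Convex ℝ Ω
  isBounded : Bornology.IsBounded Ω
  isOpen_nhd : IsOpen U
  frontier_subset : frontier Ω ⊆ U
  contDiffOn : ContDiffOn ℝ 2 ρ U
  mem_iff : ∀ z ∈ U, z ∈ Ω ↔ ρ z < 0
  fderiv_ne_zero : ∀ p ∈ frontier Ω, fderiv ℝ ρ p ≠ 0
  hessian_pos : ∀ p ∈ frontier Ω, ∀ v : E, v ≠ 0 → fderiv ℝ ρ p v = 0 →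
    0 < fderiv ℝ (fderiv ℝ ρ) p v v

/-- `u` is an outward unit normal of a supporting hyperplane of `Ω` at the boundary point `p`. -/
structure IsUnitNormal (Ω : Set E) (p u : E) : Prop where
  mem_frontier : p ∈ frontier Ω
  norm_eq : ‖u‖ = 1
  inner_le : ∀ ζ ∈ Ω, inner ℝ u (ζ - p) ≤ 0

theorem IsUnitNormal.inner_le_of_mem_closure {Ω : Set E} {p u ζ : E} (h : IsUnitNormal Ω p u)
    (hζ : ζ ∈ closure Ω) : inner ℝ u (ζ - p) ≤ 0 := by
  have hc : IsClosed {ζ : E | inner ℝ u (ζ - p) ≤ 0} :=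
    isClosed_le (by fun_prop) continuous_const
  exact closure_minimal (fun ζ hζ => h.inner_le ζ hζ) hc hζ

/-- A function on `[0, 1]` with second derivative at least `m` lies above its second order Taylor
polynomial. -/
theorem taylor_lower_bound_unit {g g' g'' : ℝ → ℝ} {m : ℝ}
    (hg : ∀ t ∈ Icc (0 : ℝ) 1, HasDerivAt g (g' t) t)
    (hg' : ∀ t ∈ Icc (0 : ℝ) 1, HasDerivAt g' (g'' t) t)
    (hm : ∀ t ∈ Icc (0 : ℝ) 1, m ≤ g'' t) : g 0 + g' 0 + m / 2 ≤ g 1 := by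
  have h1 : ∀ t ∈ Icc (0 : ℝ) 1, g' 0 + m * t ≤ g' t := by
    have hmono : MonotoneOn (fun t => g' t - m * t) (Icc (0 : ℝ) 1) := by
      refine monotoneOn_of_hasDerivWithinAt_nonneg (f' := fun t => g'' t - m) (convex_Icc 0 1)
        (fun t ht => ((hg' t ht).continuousAt.sub (by fun_prop)).continuousWithinAt) ?_ ?_
      · intro t ht
        have := (hg' t (interior_subset ht)).sub ((hasDerivAt_id t).const_mul m)
        exact (this.congr_deriv (by simp)).hasDerivWithinAt
      · intro t ht
        have := hm t (interior_subset ht)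
        linarith
    intro t ht
    have := hmono (left_mem_Icc.2 zero_le_one) ht ht.1
    simp only [mul_zero, sub_zero] at this
    linarith
  have hmono : MonotoneOn (fun t => g t - g' 0 * t - m / 2 * t ^ 2) (Icc (0 : ℝ) 1) := by
    refine monotoneOn_of_hasDerivWithinAt_nonneg (f' := fun t => g' t - g' 0 - m * t)
      (convex_Icc 0 1)
      (fun t ht => (((hg t ht).continuousAt.sub (by fun_prop)).sub
        (by fun_prop)).continuousWithinAt) ?_ ?_
    · intro t ht
      have := ((hg t (interior_subset ht)).sub ((hasDerivAt_id t).const_mul (g' 0))).sub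
        ((hasDerivAt_pow 2 t).const_mul (m / 2))
      refine (this.congr_deriv ?_).hasDerivWithinAt
      norm_num
      ring
    · intro t ht
      have := h1 t (interior_subset ht)
      linarith
  have := hmono (left_mem_Icc.2 zero_le_one) (right_mem_Icc.2 zero_le_one) zero_le_one
  simp at this
  linarith

namespace DefiningData

variable {Ω U : Set E} {ρ : E → ℝ}

theorem contDiffAt (h : DefiningData Ω U ρ) {x : E} (hx : x ∈ U) : ContDiffAt ℝ 2 ρ x :=
  h.contDiffOn.contDiffAt (h.isOpen_nhd.mem_nhds hx)

theorem hasFDerivAt (h : DefiningData Ω U ρ) {x : E} (hx : x ∈ U) :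
    HasFDerivAt ρ (fderiv ℝ ρ x) x :=
  ((h.contDiffAt hx).differentiableAt (by norm_num)).hasFDerivAt

theorem contDiffOn_fderiv (h : DefiningData Ω U ρ) : ContDiffOn ℝ 1 (fderiv ℝ ρ) U :=
  h.contDiffOn.fderiv_of_isOpen h.isOpen_nhd (by norm_num)

theorem hasFDerivAt_fderiv (h : DefiningData Ω U ρ) {x : E} (hx : x ∈ U) :
    HasFDerivAt (fderiv ℝ ρ) (fderiv ℝ (fderiv ℝ ρ) x) x :=
  ((h.contDiffOn_fderiv.contDiffAt (h.isOpen_nhd.mem_nhds hx)).differentiableAt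
    (by norm_num)).hasFDerivAt

theorem continuousOn (h : DefiningData Ω U ρ) : ContinuousOn ρ U := h.contDiffOn.continuousOn

theorem continuousOn_fderiv (h : DefiningData Ω U ρ) : ContinuousOn (fderiv ℝ ρ) U :=
  h.contDiffOn_fderiv.continuousOn

theorem continuousOn_hessian (h : DefiningData Ω U ρ) :
    ContinuousOn (fderiv ℝ (fderiv ℝ ρ)) U :=
  (h.contDiffOn_fderiv.fderiv_of_isOpen (m := 0) h.isOpen_nhd (by norm_num)).continuousOn

theorem notMem_of_mem_frontier (h : DefiningData Ω U ρ) {p : E} (hp : p ∈ frontier Ω) : p ∉ Ω := by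
  rw [h.isOpen.frontier_eq] at hp
  exact hp.2

theorem eq_zero_of_mem_frontier (h : DefiningData Ω U ρ) {p : E} (hp : p ∈ frontier Ω) :
    ρ p = 0 := by
  have hpU := h.frontier_subset hp
  refine le_antisymm ?_ ?_
  · have hcl : p ∈ closure Ω := frontier_subset_closure hp
    have := mem_closure_iff_frequently.1 hcl
    have hc : Tendsto ρ (𝓝 p) (𝓝 (ρ p)) := h.continuousOn.continuousAt (h.isOpen_nhd.mem_nhds hpU)
    refine le_of_tendsto_of_frequently hc ?_
    refine (this.and_eventually (h.isOpen_nhd.mem_nhds hpU)).mono fun x hx => ?_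
    exact ((h.mem_iff x hx.2).1 hx.1).le
  · by_contra! hlt
    exact h.notMem_of_mem_frontier hp ((h.mem_iff p hpU).2 hlt)

/-- Directions of strict descent of ρ at p enter Ω, hence lie in the half-space ⟨u, v⟩ ≤ 0. An open
half-space contained in another half-space with boundary through the same point has the same normal,
so u is the normalized gradient. -/
theorem fderiv_apply_eq_norm_mul_inner [CompleteSpace E] (h : DefiningData Ω U ρ) {p u : E}
    (hu : IsUnitNormal Ω p u) (v : E) : fderiv ℝ ρ p v = ‖fderiv ℝ ρ p‖ * inner ℝ u v := by
  have hpU := h.frontier_subset hu.mem_frontier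
  have key : ∀ v, fderiv ℝ ρ p v < 0 → inner ℝ u v ≤ 0 := by
    intro v hv
    have hd : HasDerivAt (fun t : ℝ => ρ (p + t • v)) (fderiv ℝ ρ p v) 0 := by
      have h1 : HasDerivAt (fun t : ℝ => p + t • v) v 0 := by
        simpa using ((hasDerivAt_id (0 : ℝ)).smul_const v).const_add p
      have h2 : HasFDerivAt ρ (fderiv ℝ ρ p) (p + (0 : ℝ) • v) := by
        simpa using h.hasFDerivAt hpU
      exact h2.comp_hasDerivAt 0 h1
    have hlt : ∀ᶠ t in 𝓝[>] (0 : ℝ), ρ (p + t • v) < 0 := by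
      have h1 := (hasDerivAt_iff_tendsto_slope.1 hd)
      have h2 := h1.mono_left (nhdsWithin_mono 0 (fun t (ht : 0 < t) => ht.ne'))
      filter_upwards [h2.eventually (gt_mem_nhds hv), self_mem_nhdsWithin] with t ht ht0
      have ht0 : 0 < t := ht0
      simp only [slope_def_field, zero_smul, add_zero, h.eq_zero_of_mem_frontier hu.mem_frontier,
        sub_zero] at ht
      rcases div_neg_iff.1 ht with h3 | h3 <;> linarith [h3.1, h3.2]
    have hU : ∀ᶠ t in 𝓝[>] (0 : ℝ), p + t • v ∈ U := by
      have hc : Tendsto (fun t : ℝ => p + t • v) (𝓝 0) (𝓝 p) := by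
        have : Continuous (fun t : ℝ => p + t • v) := by fun_prop
        simpa using this.tendsto 0
      exact (hc.mono_left nhdsWithin_le_nhds).eventually (h.isOpen_nhd.mem_nhds hpU)
    obtain ⟨t, ⟨h1, h2⟩, h3⟩ := ((hlt.and hU).and self_mem_nhdsWithin).exists
    have h3 : 0 < t := h3
    have := hu.inner_le _ ((h.mem_iff _ h2).2 h1)
    rw [add_sub_cancel_left, inner_smul_right] at this
    exact nonpos_of_mul_nonpos_right this h3
  set g := (InnerProductSpace.toDual ℝ E).symm (fderiv ℝ ρ p) with hg
  have hgv : ∀ v, fderiv ℝ ρ p v = inner ℝ g v := fun v => by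
    rw [hg, InnerProductSpace.toDual_symm_apply]
  have hnorm : ‖fderiv ℝ ρ p‖ = ‖g‖ := by rw [hg, LinearIsometryEquiv.norm_map]
  have hg0 : 0 < ‖g‖ := by
    rw [← hnorm]
    exact norm_pos_iff.2 (h.fderiv_ne_zero p hu.mem_frontier)
  have hgg : inner ℝ g g = ‖g‖ ^ 2 := real_inner_self_eq_norm_sq g
  set a := inner ℝ u g / ‖g‖ ^ 2 with ha
  have hag : a * ‖g‖ ^ 2 = inner ℝ u g := by rw [ha]; field_simp
  have h0 : 0 ≤ inner ℝ u g := by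
    have := key (-g) (by rw [hgv, inner_neg_right, hgg]; nlinarith)
    rw [inner_neg_right] at this
    linarith
  have hgw : inner ℝ g (u - a • g) = 0 := by
    rw [inner_sub_right, inner_smul_right, hgg, hag, real_inner_comm, sub_self]
  -- The component of u orthogonal to g is only a direction of zero descent. Subtracting a small
  -- multiple of g makes the descent strict; the +1 in the denominator avoids division by zero.
  have huw : inner ℝ u (u - a • g) ≤ 0 := by
    refine le_of_forall_pos_le_add fun ε hε => ?_
    have hε' : 0 < ε / (inner ℝ u g + 1) := by positivity
    have := key (u - a • g - (ε / (inner ℝ u g + 1)) • g) (by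
      rw [hgv, inner_sub_right, hgw, inner_smul_right, hgg, zero_sub]
      exact neg_neg_of_pos (by positivity))
    rw [inner_sub_right u (u - a • g), inner_smul_right] at this
    have h3 : ε / (inner ℝ u g + 1) * inner ℝ u g ≤ ε := by
      rw [div_mul_eq_mul_div, div_le_iff₀ (by positivity)]
      nlinarith
    linarith
  have hw : u - a • g = 0 := by
    have h4 : inner ℝ (u - a • g) (u - a • g) ≤ 0 := by
      rw [inner_sub_left, inner_smul_left, hgw]
      simpa using huw
    exact real_inner_self_nonpos.1 h4
  have hua : u = a • g := sub_eq_zero.1 hw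
  have ha0 : 0 ≤ a := by rw [ha]; positivity
  have h1 : a * ‖g‖ = 1 := by
    have := hu.norm_eq
    rwa [hua, norm_smul, Real.norm_eq_abs, abs_of_nonneg ha0] at this
  rw [hgv, hnorm, hua, inner_smul_left]
  simp only [conj_trivial]
  rw [← mul_assoc, mul_comm ‖g‖, h1, one_mul]

end DefiningData

end RealGeometry

end LaplaceBergman
end

noncomputable section

namespace LaplaceBergman

/-! ### Interior balls and quantitative strict convexity -/

section RealGeometry

variable {E : Type*} [NormedAddCommGroup E] [InnerProductSpace ℝ E]

namespace DefiningData

variable {Ω U : Set E} {ρ : E → ℝ}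

theorem isCompact_frontier [FiniteDimensional ℝ E] (h : DefiningData Ω U ρ) :
    IsCompact (frontier Ω) := by
  have := FiniteDimensional.proper ℝ E
  exact Metric.isCompact_of_isClosed_isBounded isClosed_frontier
    (h.isBounded.closure.subset frontier_subset_closure)

theorem isCompact_closure [FiniteDimensional ℝ E] (h : DefiningData Ω U ρ) :
    IsCompact (closure Ω) := by
  have := FiniteDimensional.proper ℝ E
  exact h.isBounded.isCompact_closure

/-- The Hessian of `ρ + C ρ² / 2` as a function of the point and of the direction. -/
def convexifiedHessian (ρ : E → ℝ) (C : ℝ) (z : E × E) : ℝ :=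
  (1 + C * ρ z.1) * fderiv ℝ (fderiv ℝ ρ) z.1 z.2 z.2 + C * (fderiv ℝ ρ z.1 z.2) ^ 2

theorem continuousOn_convexifiedHessian (h : DefiningData Ω U ρ) (C : ℝ) :
    ContinuousOn (convexifiedHessian ρ C) (U ×ˢ (univ : Set E)) := by
  have hfst : MapsTo (Prod.fst : E × E → E) (U ×ˢ univ) U := fun z hz => hz.1
  have h1 : ContinuousOn (fun z : E × E => ρ z.1) (U ×ˢ univ) :=
    h.continuousOn.comp continuousOn_fst hfst
  have h2 : ContinuousOn (fun z : E × E => fderiv ℝ ρ z.1 z.2) (U ×ˢ univ) :=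
    (h.continuousOn_fderiv.comp continuousOn_fst hfst).clm_apply continuousOn_snd
  have h3 : ContinuousOn (fun z : E × E => fderiv ℝ (fderiv ℝ ρ) z.1 z.2 z.2) (U ×ˢ univ) :=
    ((h.continuousOn_hessian.comp continuousOn_fst hfst).clm_apply
      continuousOn_snd).clm_apply continuousOn_snd
  exact ((continuousOn_const.add (continuousOn_const.mul h1)).mul h3).add
    (continuousOn_const.mul (h2.pow 2))

theorem convexifiedHessian_of_mem_frontier (h : DefiningData Ω U ρ) (C : ℝ) {z : E × E}
    (hz : z.1 ∈ frontier Ω) : convexifiedHessian ρ C z =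
      fderiv ℝ (fderiv ℝ ρ) z.1 z.2 z.2 + C * (fderiv ℝ ρ z.1 z.2) ^ 2 := by
  simp only [convexifiedHessian, h.eq_zero_of_mem_frontier hz, mul_zero, add_zero, one_mul]

/-- On the boundary ρ = 0, so the form is D²ρ + C(dρ)². It is positive on tangent vectors by strong
convexity and on the other vectors once C is large. Compactness makes C uniform and the minimum
positive. -/
theorem exists_convexifiedHessian_lower_bound [FiniteDimensional ℝ E]
    (h : DefiningData Ω U ρ) : ∃ k : ℕ, ∃ c > 0,
      ∀ z ∈ frontier Ω ×ˢ Metric.sphere (0 : E) 1, c < convexifiedHessian ρ k z := by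
  have hprop := FiniteDimensional.proper ℝ E
  set K := frontier Ω with hK
  set S := Metric.sphere (0 : E) 1 with hS
  have hKc : IsCompact K := h.isCompact_frontier
  have hSc : IsCompact S := isCompact_sphere 0 1
  have hUo : IsOpen (U ×ˢ (univ : Set E)) := h.isOpen_nhd.prod isOpen_univ
  have hsub : K ×ˢ S ⊆ U ×ˢ (univ : Set E) := prod_mono h.frontier_subset (subset_univ _)
  obtain ⟨k, hk⟩ : ∃ k : ℕ, ∀ z ∈ K ×ˢ S, 0 < convexifiedHessian ρ k z := by
    have hcov : K ×ˢ S ⊆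
        ⋃ k : ℕ, (U ×ˢ (univ : Set E)) ∩ (convexifiedHessian ρ k) ⁻¹' Ioi 0 := by
      intro z hz
      have hz0 : z.2 ≠ 0 := by
        intro h0
        have := hz.2
        rw [h0] at this
        simp [hS] at this
      rw [mem_iUnion]
      by_cases hd : fderiv ℝ ρ z.1 z.2 = 0
      · refine ⟨0, hsub hz, ?_⟩
        rw [mem_preimage, mem_Ioi, h.convexifiedHessian_of_mem_frontier _ hz.1]
        have := h.hessian_pos z.1 hz.1 z.2 hz0 hd
        simpa using this
      · have hpos : 0 < (fderiv ℝ ρ z.1 z.2) ^ 2 := by positivity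
        obtain ⟨k, hk⟩ := exists_nat_gt
          (-(fderiv ℝ (fderiv ℝ ρ) z.1 z.2 z.2) / (fderiv ℝ ρ z.1 z.2) ^ 2)
        refine ⟨k, hsub hz, ?_⟩
        rw [mem_preimage, mem_Ioi, h.convexifiedHessian_of_mem_frontier _ hz.1]
        rw [div_lt_iff₀ hpos] at hk
        linarith
    obtain ⟨t, ht⟩ := (hKc.prod hSc).elim_finite_subcover _
      (fun k : ℕ => (h.continuousOn_convexifiedHessian k).isOpen_inter_preimage hUo isOpen_Ioi)
      hcov
    -- The largest of the finitely many constants serves everywhere, because over the boundary the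
    -- form is nondecreasing in C.
    refine ⟨t.sup id, fun z hz => ?_⟩
    obtain ⟨i, hi, hzi⟩ := mem_iUnion₂.1 (ht hz)
    have h2 : 0 < convexifiedHessian ρ i z := hzi.2
    rw [h.convexifiedHessian_of_mem_frontier _ hz.1] at h2 ⊢
    have : (i : ℝ) ≤ (t.sup id : ℕ) := by exact_mod_cast Finset.le_sup (f := id) hi
    nlinarith [mul_le_mul_of_nonneg_right this (sq_nonneg (fderiv ℝ ρ z.1 z.2))]
  rcases (K ×ˢ S).eq_empty_or_nonempty with he | hne
  · exact ⟨k, 1, one_pos, fun z hz => by simp [he] at hz⟩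
  · obtain ⟨z0, hz0, hmin⟩ := (hKc.prod hSc).exists_isMinOn hne
      ((h.continuousOn_convexifiedHessian k).mono hsub)
    refine ⟨k, convexifiedHessian ρ k z0 / 2, half_pos (hk z0 hz0), fun z hz => ?_⟩
    have h1 := hk z0 hz0
    have h2 : convexifiedHessian ρ k z0 ≤ convexifiedHessian ρ k z := hmin hz
    linarith

theorem sq_norm_mul_le_convexifiedHessian {C c : ℝ} {x : E}
    (hx : ∀ v ∈ Metric.sphere (0 : E) 1, c < convexifiedHessian ρ C (x, v)) (v : E) :
    c * ‖v‖ ^ 2 ≤ convexifiedHessian ρ C (x, v) := by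
  rcases eq_or_ne v 0 with rfl | hv
  · simp [convexifiedHessian]
  · have hvn : 0 < ‖v‖ := norm_pos_iff.2 hv
    have h8 := hx (‖v‖⁻¹ • v) (by simp [norm_smul, hvn.ne'])
    have h9 : convexifiedHessian ρ C (x, v) =
        ‖v‖ ^ 2 * convexifiedHessian ρ C (x, ‖v‖⁻¹ • v) := by
      simp only [convexifiedHessian, map_smul, smul_eq_mul, _root_.smul_apply]
      field_simp
    rw [h9, mul_comm]
    gcongr

theorem continuousOn_norm_hessian (h : DefiningData Ω U ρ) :
    ContinuousOn (fun x => ‖fderiv ℝ (fderiv ℝ ρ) x‖) U :=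
  (continuous_norm (E := E →L[ℝ] E →L[ℝ] ℝ)).comp_continuousOn h.continuousOn_hessian

/-- Uniform estimates for `ρ`, and for the Hessian of `ρ + C ρ² / 2`, near the boundary. -/
theorem exists_uniform_convexity [FiniteDimensional ℝ E] (h : DefiningData Ω U ρ) :
    ∃ δ > 0, ∃ c > 0, ∃ C ≥ 0, ∃ M > 0, ∀ p ∈ frontier Ω, ∀ x ∈ Metric.ball p δ,
      x ∈ U ∧ ‖fderiv ℝ (fderiv ℝ ρ) x‖ ≤ M ∧ ‖fderiv ℝ ρ x‖ ≤ M ∧ C * |ρ x| ≤ 1 ∧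
      ∀ v, c * ‖v‖ ^ 2 ≤ convexifiedHessian ρ C (x, v) := by
  have hprop := FiniteDimensional.proper ℝ E
  have hKc : IsCompact (frontier Ω) := h.isCompact_frontier
  obtain ⟨k, c, hc, hcQ⟩ := h.exists_convexifiedHessian_lower_bound
  -- The tube lemma extends the bound to a neighbourhood of the boundary that does not depend on the
  -- direction.
  obtain ⟨V, V', hV, hV', hKV, hSV, hVW⟩ := generalized_tube_lemma hKc
    (isCompact_sphere (0 : E) 1)
    ((h.continuousOn_convexifiedHessian k).isOpen_inter_preimage
      (h.isOpen_nhd.prod isOpen_univ) (isOpen_Ioi (a := c)))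
    (fun z hz => ⟨⟨h.frontier_subset hz.1, mem_univ _⟩, hcQ z hz⟩)
  obtain ⟨M₁, hM₁⟩ := hKc.exists_bound_of_continuousOn (f := fderiv ℝ (fderiv ℝ ρ))
    (h.continuousOn_hessian.mono h.frontier_subset)
  obtain ⟨M₂, hM₂⟩ := hKc.exists_bound_of_continuousOn (f := fderiv ℝ ρ)
    (h.continuousOn_fderiv.mono h.frontier_subset)
  obtain ⟨M, hMpos, hM1, hM2⟩ : ∃ M : ℝ, 0 < M ∧ M₁ < M ∧ M₂ < M :=
    ⟨max (max M₁ M₂) 0 + 1, by positivity,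
      ((le_max_left _ _).trans (le_max_left _ _)).trans_lt (lt_add_one _),
      ((le_max_right _ _).trans (le_max_left _ _)).trans_lt (lt_add_one _)⟩
  obtain ⟨W, hWo, hKW, hW⟩ : ∃ W : Set E, IsOpen W ∧ frontier Ω ⊆ W ∧ ∀ x ∈ W,
      x ∈ V ∧ x ∈ U ∧ ‖fderiv ℝ (fderiv ℝ ρ) x‖ < M ∧ ‖fderiv ℝ ρ x‖ < M ∧ k * |ρ x| < 1 := by
    refine ⟨_, ((hV.inter (h.continuousOn_norm_hessian.isOpen_inter_preimage h.isOpen_nhd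
      (isOpen_Iio (a := M)))).inter (h.continuousOn_fderiv.norm.isOpen_inter_preimage h.isOpen_nhd
      (isOpen_Iio (a := M)))).inter ((continuousOn_const.mul
      h.continuousOn.abs).isOpen_inter_preimage (f := fun x => k * |ρ x|) h.isOpen_nhd
      (isOpen_Iio (a := 1))), ?_, ?_⟩
    · intro x hx
      have hxU := h.frontier_subset hx
      refine ⟨⟨⟨hKV hx, hxU, (hM₁ x hx).trans_lt hM1⟩, hxU, (hM₂ x hx).trans_lt hM2⟩, hxU, ?_⟩
      simp [h.eq_zero_of_mem_frontier hx]
    · rintro x ⟨⟨⟨h1, h2, h3⟩, h4, h5⟩, h6, h7⟩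
      exact ⟨h1, h2, h3, h5, h7⟩
  obtain ⟨δ, hδ, hδW⟩ := hKc.exists_thickening_subset_open hWo hKW
  refine ⟨δ, hδ, c, hc, k, k.cast_nonneg, M, hMpos, fun p hp x hx => ?_⟩
  obtain ⟨h1, h2, h3, h4, h5⟩ := hW x (hδW (Metric.mem_thickening_iff.2 ⟨p, hp, hx⟩))
  exact ⟨h2, h3.le, h4.le, h5.le,
    sq_norm_mul_le_convexifiedHessian fun v hv => (hVW ⟨h1, hSV hv⟩).2⟩

theorem segment_hasDerivAt (h : DefiningData Ω U ρ) {p v : E} {t : ℝ} (ht : p + t • v ∈ U) :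
    HasDerivAt (fun t : ℝ => ρ (p + t • v)) (fderiv ℝ ρ (p + t • v) v) t ∧
      HasDerivAt (fun t : ℝ => fderiv ℝ ρ (p + t • v) v)
        (fderiv ℝ (fderiv ℝ ρ) (p + t • v) v v) t := by
  have h1 : HasDerivAt (fun t : ℝ => p + t • v) v t := by
    simpa using ((hasDerivAt_id t).smul_const v).const_add p
  refine ⟨(h.hasFDerivAt ht).comp_hasDerivAt t h1, ?_⟩
  have h2 := (h.hasFDerivAt_fderiv ht).comp_hasDerivAt t h1
  simpa using h2.clm_apply (hasDerivAt_const t v)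

theorem exists_fderiv_lower_bound [FiniteDimensional ℝ E] (h : DefiningData Ω U ρ) :
    ∃ m > 0, ∀ p ∈ frontier Ω, m ≤ ‖fderiv ℝ ρ p‖ := by
  rcases (frontier Ω).eq_empty_or_nonempty with he | hne
  · exact ⟨1, one_pos, fun z hz => by simp [he] at hz⟩
  · obtain ⟨z0, hz0, hmin⟩ := h.isCompact_frontier.exists_isMinOn hne
      (h.continuousOn_fderiv.mono h.frontier_subset).norm
    exact ⟨_, norm_pos_iff.2 (h.fderiv_ne_zero z0 hz0), fun z hz => hmin hz⟩

/-- Rolling ball: the domain contains a ball of a fixed radius tangent at each boundary point. -/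
theorem exists_interior_ball [FiniteDimensional ℝ E] (h : DefiningData Ω U ρ) :
    ∃ R > 0, ∀ p u, IsUnitNormal Ω p u → Metric.ball (p - R • u) R ⊆ Ω := by
  obtain ⟨δ, hδ, c, hc, C, hC, M, hM, hunif⟩ := h.exists_uniform_convexity
  obtain ⟨m, hm, hmle⟩ := h.exists_fderiv_lower_bound
  -- The bound δ / 2 keeps the ball where the Taylor estimate holds; m / M makes the linear term, of
  -- slope at least m, beat the quadratic term, of size at most M.
  set R := min (δ / 2) (m / M) with hR
  have hRpos : 0 < R := lt_min (by positivity) (by positivity)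
  refine ⟨R, hRpos, fun p u hu x hx => ?_⟩
  set v := x - p with hv
  have hvn : ‖v + R • u‖ < R := by
    rw [Metric.mem_ball, dist_eq_norm] at hx
    rwa [hv, show x - p + R • u = x - (p - R • u) by abel]
  have hRu : ‖R • u‖ = R := by rw [norm_smul, hu.norm_eq, Real.norm_eq_abs, abs_of_pos hRpos, mul_one]
  have hvδ : ‖v‖ < δ := by
    have : ‖v‖ ≤ ‖v + R • u‖ + ‖R • u‖ := by
      simpa using norm_sub_le (v + R • u) (R • u)
    have := min_le_left (δ / 2) (m / M)
    linarith
  have hinner : ‖v‖ ^ 2 + 2 * R * inner ℝ u v < 0 := by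
    have h1 : ‖v + R • u‖ ^ 2 < R ^ 2 := by gcongr
    rw [norm_add_sq_real, hRu, inner_smul_right, real_inner_comm] at h1
    linarith
  have hball : ∀ t ∈ Icc (0 : ℝ) 1, p + t • v ∈ Metric.ball p δ := by
    intro t ht
    rw [Metric.mem_ball, dist_eq_norm, add_sub_cancel_left, norm_smul, Real.norm_eq_abs,
      abs_of_nonneg ht.1]
    exact (mul_le_of_le_one_left (norm_nonneg v) ht.2).trans_lt hvδ
  have hp := hu.mem_frontier
  -- Applied to -ρ, since an upper bound for ρ is wanted: ρ(x) ≤ ‖dρ‖⟨u, v⟩ + M‖v‖²/2.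
  have htay := taylor_lower_bound_unit (g := fun t => -ρ (p + t • v))
    (g' := fun t => -fderiv ℝ ρ (p + t • v) v)
    (g'' := fun t => -fderiv ℝ (fderiv ℝ ρ) (p + t • v) v v) (m := -(M * ‖v‖ ^ 2))
    (fun t ht => (h.segment_hasDerivAt (hunif p hp _ (hball t ht)).1).1.neg)
    (fun t ht => (h.segment_hasDerivAt (hunif p hp _ (hball t ht)).1).2.neg)
    (fun t ht => by
      have h1 := (fderiv ℝ (fderiv ℝ ρ) (p + t • v)).le_opNorm₂ v v
      have h2 := (hunif p hp _ (hball t ht)).2.1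
      have h3 := le_abs_self (fderiv ℝ (fderiv ℝ ρ) (p + t • v) v v)
      rw [Real.norm_eq_abs] at h1
      have h4 := mul_le_mul_of_nonneg_right h2 (sq_nonneg ‖v‖)
      nlinarith)
  simp only [zero_smul, add_zero, one_smul, h.eq_zero_of_mem_frontier hp,
    h.fderiv_apply_eq_norm_mul_inner hu] at htay
  have hx' : p + v = x := by rw [hv]; abel
  rw [hx'] at htay
  have hxU : x ∈ U := by
    have := (hunif p hp _ (hball 1 (by simp))).1
    rwa [one_smul, hx'] at this
  rw [h.mem_iff x hxU]
  have h5 : m ≤ ‖fderiv ℝ ρ p‖ := hmle p hp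
  have hMR : M * R ≤ m := by
    have := min_le_right (δ / 2) (m / M)
    calc M * R ≤ M * (m / M) := by gcongr
      _ = m := by field_simp
  have h6 : M * R * ‖v‖ ^ 2 ≤ ‖fderiv ℝ ρ p‖ * ‖v‖ ^ 2 := by gcongr; linarith
  have h7 : ‖fderiv ℝ ρ p‖ * (‖v‖ ^ 2 + 2 * R * inner ℝ u v) < 0 :=
    mul_neg_of_pos_of_neg (by linarith) hinner
  by_contra! hge
  nlinarith

/-- Enclosing ball: quantitative strict convexity at the boundary points. -/
theorem exists_quadratic_separation [FiniteDimensional ℝ E] (h : DefiningData Ω U ρ) :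
    ∃ c > 0, ∀ p u, IsUnitNormal Ω p u → ∀ ζ ∈ closure Ω,
      c * ‖ζ - p‖ ^ 2 ≤ -inner ℝ u (ζ - p) := by
  obtain ⟨δ, hδ, c, hc, C, hC, M, hM, hunif⟩ := h.exists_uniform_convexity
  obtain ⟨D, hD⟩ := h.isBounded.closure.exists_norm_le
  set D' := 2 * |D| + δ with hD'
  have hD'pos : 0 < D' := by positivity
  have hdiam : ∀ x ∈ closure Ω, ∀ y ∈ closure Ω, ‖x - y‖ ≤ D' := by
    intro x hx y hy
    have := norm_sub_le x y
    have := hD x hx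
    have := hD y hy
    have := le_abs_self D
    linarith
  set c₀ := c / (2 * M) with hc₀
  have hc₀pos : 0 < c₀ := by positivity
  -- Near p, the function ρ + Cρ²/2 is uniformly convex along the segment from p to ζ, vanishes at p
  -- with the same derivative as ρ, and is nonpositive at ζ.
  have hlocal : ∀ p u, IsUnitNormal Ω p u → ∀ ζ ∈ Ω, ‖ζ - p‖ < δ →
      c₀ * ‖ζ - p‖ ^ 2 ≤ -inner ℝ u (ζ - p) := by
    intro p u hu ζ hζ hlt
    set v := ζ - p with hv
    have hp := hu.mem_frontier
    have hball : ∀ t ∈ Icc (0 : ℝ) 1, p + t • v ∈ Metric.ball p δ := by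
      intro t ht
      rw [Metric.mem_ball, dist_eq_norm, add_sub_cancel_left, norm_smul, Real.norm_eq_abs,
        abs_of_nonneg ht.1]
      exact (mul_le_of_le_one_left (norm_nonneg v) ht.2).trans_lt hlt
    have htay := taylor_lower_bound_unit (g := fun t => ρ (p + t • v) + C / 2 * ρ (p + t • v) ^ 2)
      (g' := fun t => (1 + C * ρ (p + t • v)) * fderiv ℝ ρ (p + t • v) v)
      (g'' := fun t => (1 + C * ρ (p + t • v)) * fderiv ℝ (fderiv ℝ ρ) (p + t • v) v v +
        C * (fderiv ℝ ρ (p + t • v) v) ^ 2) (m := c * ‖v‖ ^ 2)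
      (fun t ht => by
        have h1 := (h.segment_hasDerivAt (hunif p hp _ (hball t ht)).1).1
        refine (h1.add ((h1.pow 2).const_mul (C / 2))).congr_deriv ?_
        norm_num
        ring)
      (fun t ht => by
        have h1 := (h.segment_hasDerivAt (hunif p hp _ (hball t ht)).1)
        refine (((h1.1.const_mul C).const_add 1).mul h1.2).congr_deriv ?_
        ring)
      (fun t ht => (hunif p hp _ (hball t ht)).2.2.2.2 v)
    have hx' : p + v = ζ := by rw [hv]; abel
    simp only [zero_smul, add_zero, one_smul, h.eq_zero_of_mem_frontier hp, hx',
      h.fderiv_apply_eq_norm_mul_inner hu] at htay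
    have hζu := hunif p hp _ (hball 1 (by simp))
    rw [one_smul, hx'] at hζu
    have hneg : ρ ζ < 0 := (h.mem_iff ζ hζu.1).1 hζ
    -- The correction term cannot change the sign, because C|ρ| ≤ 1 near the boundary.
    have h2 : ρ ζ + C / 2 * ρ ζ ^ 2 ≤ 0 := by
      have := hζu.2.2.2.1
      rw [abs_of_neg hneg] at this
      nlinarith
    have h3 : ‖fderiv ℝ ρ p‖ ≤ M := (hunif p hp p (Metric.mem_ball_self hδ)).2.2.1
    have h4 : inner ℝ u v ≤ 0 := hu.inner_le ζ hζ
    have h5 : c / 2 * ‖v‖ ^ 2 ≤ M * -inner ℝ u v := by nlinarith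
    rw [hc₀, div_mul_eq_mul_div, div_le_iff₀ (by positivity)]
    linarith
  refine ⟨c₀ * (δ / (2 * D')), by positivity, fun p u hu => ?_⟩
  have hp := hu.mem_frontier
  have hopen : ∀ ζ ∈ Ω, c₀ * (δ / (2 * D')) * ‖ζ - p‖ ^ 2 ≤ -inner ℝ u (ζ - p) := by
    intro ζ hζ
    set v := ζ - p with hv
    have hvD : ‖v‖ ≤ D' := hdiam ζ (subset_closure hζ) p (frontier_subset_closure hp)
    have hv0 : 0 < ‖v‖ := by
      rw [norm_pos_iff, hv, sub_ne_zero]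
      rintro rfl
      exact h.notMem_of_mem_frontier hp hζ
    -- Contracting ζ towards p by s brings it within δ of p. The two sides of the inequality scale
    -- by s² and s, so passing from the local to the global estimate costs one factor s.
    set s := δ / (2 * D') with hs
    have hs0 : 0 < s := by positivity
    have hs1 : s < 1 := by
      rw [hs, div_lt_one (by positivity)]
      have := abs_nonneg D
      linarith
    have hmem : p + s • v ∈ Ω := by
      have := h.convex.combo_closure_interior_mem_interior (frontier_subset_closure hp)
        (h.isOpen.interior_eq.symm ▸ hζ) (sub_nonneg.2 hs1.le) hs0 (sub_add_cancel 1 s)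
      rw [h.isOpen.interior_eq] at this
      convert this using 1
      rw [hv]
      module
    have hlt : ‖p + s • v - p‖ < δ := by
      rw [add_sub_cancel_left, norm_smul, Real.norm_eq_abs, abs_of_pos hs0]
      calc s * ‖v‖ ≤ s * D' := by gcongr
        _ = δ / 2 := by rw [hs]; field_simp
        _ < δ := half_lt_self hδ
    have := hlocal p u hu _ hmem hlt
    rw [add_sub_cancel_left, inner_smul_right, norm_smul, Real.norm_eq_abs, abs_of_pos hs0] at this
    have h8 : s * (c₀ * s * ‖v‖ ^ 2) ≤ s * -inner ℝ u v := by
      calc _ = c₀ * (s * ‖v‖) ^ 2 := by ring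
        _ ≤ _ := this
        _ = _ := by ring
    exact le_of_mul_le_mul_left h8 hs0
  intro ζ hζ
  have hcl : IsClosed {ζ : E | c₀ * (δ / (2 * D')) * ‖ζ - p‖ ^ 2 ≤ -inner ℝ u (ζ - p)} :=
    isClosed_le (by fun_prop) (by fun_prop)
  exact closure_minimal hopen hcl hζ

/-- A boundary point lies outside the tangent interior balls. -/
theorem neg_inner_le_of_interior_ball (h : DefiningData Ω U ρ) {R : ℝ} (hR : 0 < R) {p u ζ : E}
    (hu : IsUnitNormal Ω p u) (hball : Metric.ball (p - R • u) R ⊆ Ω) (hζ : ζ ∈ frontier Ω) :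
    -inner ℝ u (ζ - p) ≤ ‖ζ - p‖ ^ 2 / (2 * R) := by
  have h1 : R ≤ ‖ζ - p + R • u‖ := by
    by_contra! hlt
    refine h.notMem_of_mem_frontier hζ (hball ?_)
    rw [Metric.mem_ball, dist_eq_norm]
    rwa [show ζ - (p - R • u) = ζ - p + R • u by abel]
  have h2 : R ^ 2 ≤ ‖ζ - p + R • u‖ ^ 2 := by gcongr
  have hRu : ‖R • u‖ = R := by rw [norm_smul, hu.norm_eq, Real.norm_eq_abs, abs_of_pos hR, mul_one]
  rw [norm_add_sq_real, hRu, inner_smul_right, real_inner_comm] at h2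
  rw [le_div_iff₀ (by positivity)]
  linarith

/-- The Gauss map is Hölder continuous. -/
theorem _root_.LaplaceBergman.IsUnitNormal.norm_sub_sq_le {R : ℝ} (hR : 0 < R) {p u q w : E}
    (hu : IsUnitNormal Ω p u) (hw : IsUnitNormal Ω q w)
    (hball : Metric.ball (p - R • u) R ⊆ Ω) :
    ‖u - w‖ ^ 2 ≤ 2 / R * ‖q - p‖ := by
  -- This is the point of the closed interior ball at p that is farthest in the direction w; it must
  -- stay behind the supporting hyperplane at q.
  have hmem : p - R • u + R • w ∈ closure Ω := by
    have h1 : Metric.closedBall (p - R • u) R ⊆ closure Ω := by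
      rw [← closure_ball _ hR.ne']
      exact closure_mono hball
    refine h1 ?_
    rw [Metric.mem_closedBall, dist_eq_norm, add_sub_cancel_left, norm_smul, hw.norm_eq,
      Real.norm_eq_abs, abs_of_pos hR, mul_one]
  have h2 := hw.inner_le_of_mem_closure hmem
  have h3 : p - R • u + R • w - q = R • w - R • u - (q - p) := by abel
  have hww : inner ℝ w w = 1 := by rw [real_inner_self_eq_norm_sq, hw.norm_eq, one_pow]
  rw [h3, inner_sub_right, inner_sub_right, inner_smul_right, inner_smul_right, hww] at h2
  have h4 : inner ℝ w (q - p) ≤ ‖q - p‖ := by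
    simpa [hw.norm_eq] using real_inner_le_norm w (q - p)
  rw [norm_sub_sq_real, hu.norm_eq, hw.norm_eq, real_inner_comm, div_mul_eq_mul_div,
    le_div_iff₀ hR]
  linarith

end DefiningData

end RealGeometry

end LaplaceBergman
end

noncomputable section

namespace LaplaceBergman

/-! ### Surface area of boundary caps -/

section BoundaryMeasure

open scoped NNReal

theorem _root_.LipschitzOnWith.euclideanHausdorffMeasure_image_le {X Y : Type*} [EMetricSpace X]
    [MeasurableSpace X] [BorelSpace X] [EMetricSpace Y] [MeasurableSpace Y] [BorelSpace Y]
    {K : ℝ≥0} {f : X → Y} {s : Set X} (h : LipschitzOnWith K f s) (d : ℕ) :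
    (Measure.euclideanHausdorffMeasure d : Measure Y) (f '' s) ≤
      (K : ℝ≥0∞) ^ d * (Measure.euclideanHausdorffMeasure d : Measure X) s := by
  have h1 := h.hausdorffMeasure_image_le (d := d) (Nat.cast_nonneg d)
  rw [ENNReal.rpow_natCast] at h1
  simp only [Measure.euclideanHausdorffMeasure_def, Measure.smul_apply, ENNReal.smul_def,
    smul_eq_mul]
  rw [← mul_assoc, mul_comm _ (Measure.addHaarScalarFactor _ _ : ℝ≥0∞), mul_assoc]
  gcongr

variable {E : Type*} [NormedAddCommGroup E] [InnerProductSpace ℝ E] [FiniteDimensional ℝ E]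

/-- Orthogonal projection along a unit vector, in Euclidean coordinates. -/
theorem exists_hyperplane_projection {d : ℕ} (hd : Module.finrank ℝ E = d + 1) {u : E}
    (hu : ‖u‖ = 1) : ∃ P : E →L[ℝ] EuclideanSpace ℝ (Fin d),
      (∀ x, ‖x‖ ^ 2 = ‖P x‖ ^ 2 + (inner ℝ u x) ^ 2) ∧
      ∀ y, ∃ x, P x = y ∧ inner ℝ u x = 0 := by
  have hfr : Fact (Module.finrank ℝ E = d + 1) := ⟨hd⟩
  have hu0 : u ≠ 0 := by
    rintro rfl
    simp at hu
  have hfin : Module.finrank ℝ (ℝ ∙ u)ᗮ = d := Submodule.finrank_orthogonal_span_singleton hu0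
  let J : (ℝ ∙ u)ᗮ ≃ₗᵢ[ℝ] EuclideanSpace ℝ (Fin d) :=
    ((stdOrthonormalBasis ℝ (ℝ ∙ u)ᗮ).reindex (finCongr hfin)).repr
  refine ⟨J.toContinuousLinearEquiv.toContinuousLinearMap ∘L (ℝ ∙ u)ᗮ.orthogonalProjectionOnto,
    fun x => ?_, fun y => ⟨(J.symm y : E), ?_, ?_⟩⟩
  · have h1 := Submodule.norm_sq_eq_add_norm_sq_projection x (ℝ ∙ u)
    have h2 : ‖(ℝ ∙ u).orthogonalProjectionOnto x‖ ^ 2 = (inner ℝ u x) ^ 2 := by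
      rw [Submodule.coe_norm, Submodule.coe_orthogonalProjectionOnto_apply,
        Submodule.starProjection_unit_singleton ℝ hu, norm_smul, hu, mul_one, Real.norm_eq_abs,
        sq_abs]
    rw [h1, h2, add_comm]
    congr 2
    exact (J.norm_map _).symm
  · have : (ℝ ∙ u)ᗮ.orthogonalProjectionOnto (J.symm y : E) = J.symm y :=
      Submodule.orthogonalProjectionOnto_mem_subspace_eq_self _
    change J ((ℝ ∙ u)ᗮ.orthogonalProjectionOnto (J.symm y : E)) = y
    rw [this, J.apply_symm_apply]
  · exact Submodule.mem_orthogonal_singleton_iff_inner_right.1 (J.symm y).2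

theorem exists_isUnitNormal {Ω : Set E} (ho : IsOpen Ω) (hc : Convex ℝ Ω) (hne : Ω.Nonempty)
    {p : E} (hp : p ∈ frontier Ω) : ∃ u, IsUnitNormal Ω p u := by
  have hpΩ : p ∉ Ω := by
    rw [ho.frontier_eq] at hp
    exact hp.2
  obtain ⟨f, hf⟩ := geometric_hahn_banach_open_point hc ho hpΩ
  set g := (InnerProductSpace.toDual ℝ E).symm f with hg
  have hgv : ∀ v, f v = inner ℝ g v := fun v => by
    rw [hg, InnerProductSpace.toDual_symm_apply]
  have hg0 : g ≠ 0 := by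
    obtain ⟨a, ha⟩ := hne
    intro h0
    have := hf a ha
    simp [hgv, h0] at this
  refine ⟨‖g‖⁻¹ • g, hp, by simp [norm_smul, norm_ne_zero_iff.2 hg0], fun ζ hζ => ?_⟩
  have := hf ζ hζ
  rw [hgv, hgv] at this
  rw [inner_smul_left, inner_sub_right]
  exact mul_nonpos_of_nonneg_of_nonpos (by simp) (by linarith)

omit [FiniteDimensional ℝ E] in
theorem IsUnitNormal.inner_lt {Ω : Set E} (ho : IsOpen Ω) {p u ζ : E} (h : IsUnitNormal Ω p u)
    (hζ : ζ ∈ Ω) : inner ℝ u (ζ - p) < 0 := by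
  have hc : Tendsto (fun t : ℝ => ζ + t • u) (𝓝[>] 0) (𝓝 ζ) := by
    have : Continuous (fun t : ℝ => ζ + t • u) := by fun_prop
    have := this.tendsto 0
    rw [zero_smul, add_zero] at this
    exact this.mono_left nhdsWithin_le_nhds
  obtain ⟨t, ht, ht0⟩ := ((hc.eventually (ho.mem_nhds hζ)).and self_mem_nhdsWithin).exists
  have ht0 : 0 < t := ht0
  have := h.inner_le _ ht
  rw [show ζ + t • u - p = (ζ - p) + t • u by abel, inner_add_right, inner_smul_right,
    real_inner_self_eq_norm_sq, h.norm_eq] at this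
  linarith

theorem _root_.IsPreconnected.inter_frontier_nonempty_of_mem_of_notMem {X : Type*}
    [TopologicalSpace X] {s t : Set X} (hs : IsPreconnected s) {a b : X} (ha : a ∈ s)
    (hat : a ∈ t) (hb : b ∈ s) (hbt : b ∉ t) : (s ∩ frontier t).Nonempty := by
  by_contra hne
  rw [not_nonempty_iff_eq_empty] at hne
  have hcl : ∀ x ∈ s, x ∈ closure t → x ∈ interior t := fun x hx hxt => by
    by_contra hi
    exact (hne ▸ ⟨hx, hxt, hi⟩ : x ∈ (∅ : Set X))
  have := hs.subset_left_of_subset_union (u := interior t) (v := (closure t)ᶜ) isOpen_interior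
    isClosed_closure.isOpen_compl
    (disjoint_left.2 fun x h1 h2 => h2 (subset_closure (interior_subset h1)))
    (fun x hx => by
      by_cases hxt : x ∈ closure t
      · exact Or.inl (hcl x hx hxt)
      · exact Or.inr hxt) ⟨a, ha, hcl a ha (subset_closure hat)⟩
  exact hbt (interior_subset (this hb))

namespace DefiningData

variable {Ω U : Set E} {ρ : E → ℝ} [MeasurableSpace E] [BorelSpace E]

/-- On a small cap the normals are close to u and chords are nearly orthogonal to them, so the
projection onto the tangent hyperplane has a 2-Lipschitz inverse. The cap then has at most 2^d times
the area of its projection, which lies in a d-dimensional ball of radius r. -/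
theorem measure_frontier_inter_closedBall_le_of_le (h : DefiningData Ω U ρ) {d : ℕ}
    (hd : Module.finrank ℝ E = d + 1) {R : ℝ} (hR : 0 < R)
    (hball : ∀ p u, IsUnitNormal Ω p u → Metric.ball (p - R • u) R ⊆ Ω)
    {p : E} (hp : p ∈ frontier Ω) {r : ℝ} (hr : 0 ≤ r) (hrR : r ≤ R / 32) :
    (Measure.euclideanHausdorffMeasure d : Measure E) (frontier Ω ∩ Metric.closedBall p r) ≤
      ENNReal.ofReal (r ^ d) *
        (2 ^ d * volume (Metric.closedBall (0 : EuclideanSpace ℝ (Fin d)) 1)) := by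
  obtain ⟨u, hu⟩ := exists_isUnitNormal h.isOpen h.convex h.nonempty hp
  obtain ⟨P, hP, -⟩ := exists_hyperplane_projection hd hu.norm_eq
  set K := frontier Ω ∩ Metric.closedBall p r with hK
  have hPle : ∀ x, ‖P x‖ ≤ ‖x‖ := fun x => by
    have h1 := hP x
    have : ‖P x‖ ^ 2 ≤ ‖x‖ ^ 2 := by nlinarith [sq_nonneg (inner ℝ u x)]
    exact (sq_le_sq₀ (norm_nonneg _) (norm_nonneg _)).1 this
  have hanti : ∀ q ∈ K, ∀ q' ∈ K, ‖q' - q‖ ≤ 2 * ‖P q' - P q‖ := by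
    intro q hq q' hq'
    obtain ⟨w, hw⟩ := exists_isUnitNormal h.isOpen h.convex h.nonempty hq.1
    have hqp : ‖q - p‖ ≤ r := by simpa [dist_eq_norm] using hq.2
    have hqp' : ‖q' - p‖ ≤ r := by simpa [dist_eq_norm] using hq'.2
    -- The radius R / 32 is chosen so that Hölder continuity of the Gauss map gives ‖u - w‖² ≤ 2/R ·
    -- R/32 = 1/16.
    have h1 : ‖u - w‖ ≤ 1 / 4 := by
      have := hu.norm_sub_sq_le hR hw (hball p u hu)
      have h2 : 2 / R * ‖q - p‖ ≤ (1 / 4) ^ 2 := by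
        calc 2 / R * ‖q - p‖ ≤ 2 / R * (R / 32) := by gcongr; linarith
          _ = (1 / 4) ^ 2 := by field_simp; norm_num
      exact (sq_le_sq₀ (norm_nonneg _) (by norm_num)).1 (this.trans h2)
    set v := q' - q with hv
    have hv2 : ‖v‖ ≤ 2 * r := by
      have := norm_sub_le (q' - p) (q - p)
      rw [show q' - p - (q - p) = v by rw [hv]; abel] at this
      linarith
    have h3 : inner ℝ w v ≤ 0 := hw.inner_le_of_mem_closure (frontier_subset_closure hq'.1)
    have h4 : -inner ℝ w v ≤ ‖v‖ / 32 := by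
      refine (h.neg_inner_le_of_interior_ball hR hw (hball q w hw) hq'.1).trans ?_
      rw [div_le_iff₀ (by positivity)]
      nlinarith [norm_nonneg v]
    have h5 : |inner ℝ (u - w) v| ≤ 1 / 4 * ‖v‖ :=
      (abs_real_inner_le_norm _ _).trans (by gcongr)
    rw [inner_sub_left] at h5
    have h6 : |inner ℝ u v| ≤ 1 / 2 * ‖v‖ := by
      rw [abs_le] at h5 ⊢
      have := norm_nonneg v
      constructor <;> linarith [h5.1, h5.2]
    have h7 : (inner ℝ u v) ^ 2 ≤ (1 / 2 * ‖v‖) ^ 2 := sq_le_sq.2 (by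
      rwa [abs_of_nonneg (a := 1 / 2 * ‖v‖) (by positivity)])
    have h8 := hP v
    rw [← map_sub]
    have h9 : ‖v‖ ^ 2 ≤ (2 * ‖P v‖) ^ 2 := by nlinarith [sq_nonneg ‖P v‖]
    exact (sq_le_sq₀ (norm_nonneg _) (by positivity)).1 h9
  have hinj : InjOn P K := by
    intro q hq q' hq' hqq
    have := hanti q hq q' hq'
    rw [hqq, sub_self, norm_zero, mul_zero] at this
    exact (sub_eq_zero.1 (norm_le_zero_iff.1 this)).symm
  have hg : LipschitzOnWith 2 (Function.invFunOn P K) (P '' K) := by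
    refine LipschitzOnWith.of_dist_le_mul ?_
    rintro _ ⟨q', hq', rfl⟩ _ ⟨q, hq, rfl⟩
    rw [hinj.leftInvOn_invFunOn hq, hinj.leftInvOn_invFunOn hq', dist_eq_norm, dist_eq_norm]
    exact hanti q hq q' hq'
  have himage : Function.invFunOn P K '' (P '' K) = K := hinj.invFunOn_image subset_rfl
  calc (Measure.euclideanHausdorffMeasure d : Measure E) K
      = Measure.euclideanHausdorffMeasure d (Function.invFunOn P K '' (P '' K)) := by rw [himage]
    _ ≤ ((2 : ℝ≥0) : ℝ≥0∞) ^ d * Measure.euclideanHausdorffMeasure d (P '' K) :=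
        hg.euclideanHausdorffMeasure_image_le d
    _ ≤ 2 ^ d * volume (Metric.closedBall (P p) r) := by
        rw [EuclideanSpace.euclideanHausdorffMeasure_eq_volume, ENNReal.coe_ofNat]
        gcongr
        rintro _ ⟨q, hq, rfl⟩
        rw [Metric.mem_closedBall, dist_eq_norm, ← map_sub]
        exact (hPle _).trans (by simpa [dist_eq_norm] using hq.2)
    _ = _ := by
        rw [Measure.addHaar_closedBall' volume _ hr, finrank_euclideanSpace_fin]
        ring

theorem measure_frontier_lt_top (h : DefiningData Ω U ρ) {d : ℕ}
    (hd : Module.finrank ℝ E = d + 1) :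
    (Measure.euclideanHausdorffMeasure d : Measure E) (frontier Ω) < ∞ := by
  obtain ⟨R, hR, hball⟩ := h.exists_interior_ball
  refine h.isCompact_frontier.measure_lt_top_of_nhdsWithin fun x hx => ?_
  refine ⟨frontier Ω ∩ Metric.closedBall x (R / 32), inter_mem_nhdsWithin _
    (Metric.closedBall_mem_nhds x (by positivity)), ?_⟩
  refine (h.measure_frontier_inter_closedBall_le_of_le hd hR hball hx (by positivity)
    le_rfl).trans_lt ?_
  exact ENNReal.mul_lt_top ENNReal.ofReal_lt_top (ENNReal.mul_lt_top (by simp)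
    (isCompact_closedBall _ _).measure_lt_top)

theorem exists_measure_frontier_inter_closedBall_le (h : DefiningData Ω U ρ) {d : ℕ}
    (hd : Module.finrank ℝ E = d + 1) : ∃ C > 0, ∀ p ∈ frontier Ω, ∀ r ≥ 0,
      (Measure.euclideanHausdorffMeasure d : Measure E) (frontier Ω ∩ Metric.closedBall p r) ≤
        ENNReal.ofReal (C * r ^ d) := by
  obtain ⟨R, hR, hball⟩ := h.exists_interior_ball
  set T := ((Measure.euclideanHausdorffMeasure d : Measure E) (frontier Ω)).toReal with hT
  set V := 2 ^ d * volume (Metric.closedBall (0 : EuclideanSpace ℝ (Fin d)) 1) with hV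
  have hVtop : V ≠ ∞ := ENNReal.mul_ne_top (by simp) (isCompact_closedBall _ _).measure_lt_top.ne
  have hTn : 0 ≤ T := ENNReal.toReal_nonneg
  have hVn : 0 ≤ V.toReal := ENNReal.toReal_nonneg
  refine ⟨V.toReal + T / (R / 32) ^ d + 1, by positivity, fun p hp r hr => ?_⟩
  rcases le_total r (R / 32) with hle | hle
  · refine (h.measure_frontier_inter_closedBall_le_of_le hd hR hball hp hr hle).trans ?_
    rw [← hV, ← ENNReal.ofReal_toReal hVtop, ← ENNReal.ofReal_mul (by positivity), mul_comm,
      ENNReal.toReal_ofReal hVn]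
    refine ENNReal.ofReal_le_ofReal ?_
    gcongr
    have : 0 ≤ T / (R / 32) ^ d := by positivity
    linarith
  -- For radii beyond the local range the finite total area suffices, and is absorbed into the
  -- constant.
  · refine (measure_mono inter_subset_left).trans ?_
    rw [← ENNReal.ofReal_toReal (h.measure_frontier_lt_top hd).ne]
    refine ENNReal.ofReal_le_ofReal ?_
    rw [← hT]
    calc T = T / (R / 32) ^ d * (R / 32) ^ d := by field_simp
      _ ≤ (V.toReal + T / (R / 32) ^ d + 1) * r ^ d := by
        gcongr
        linarith

/-- Orthogonal projection does not increase area, and the projected cap covers the tangential ball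
of radius r / 2: for tangential x, the point p + x is outside Ω while p + x - ‖x‖u is in the
interior ball, so the segment between them meets the boundary within 2‖x‖ of p. -/
theorem exists_le_measure_frontier_inter_closedBall (h : DefiningData Ω U ρ) {d : ℕ}
    (hd : Module.finrank ℝ E = d + 1) : ∃ c > 0, ∃ r₀ > 0, ∀ p ∈ frontier Ω, ∀ r > 0, r ≤ r₀ →
      ENNReal.ofReal (c * r ^ d) ≤
      (Measure.euclideanHausdorffMeasure d : Measure E) (frontier Ω ∩ Metric.closedBall p r) := by
  obtain ⟨R, hR, hball⟩ := h.exists_interior_ball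
  set V := volume (Metric.ball (0 : EuclideanSpace ℝ (Fin d)) 1) with hV
  have hVtop : V ≠ ∞ := measure_ball_lt_top.ne
  have hVpos : 0 < V.toReal :=
    ENNReal.toReal_pos (Metric.measure_ball_pos _ _ one_pos).ne' hVtop
  refine ⟨V.toReal * (1 / 2) ^ d, by positivity, R, hR, fun p hp r hr hrR => ?_⟩
  obtain ⟨u, hu⟩ := exists_isUnitNormal h.isOpen h.convex h.nonempty hp
  obtain ⟨P, hP, hPs⟩ := exists_hyperplane_projection hd hu.norm_eq
  set K := frontier Ω ∩ Metric.closedBall p r with hK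
  have hPle : ∀ x, ‖P x‖ ≤ ‖x‖ := fun x => by
    have h1 := hP x
    have : ‖P x‖ ^ 2 ≤ ‖x‖ ^ 2 := by nlinarith [sq_nonneg (inner ℝ u x)]
    exact (sq_le_sq₀ (norm_nonneg _) (norm_nonneg _)).1 this
  have hLip : LipschitzOnWith 1 P K := by
    refine LipschitzOnWith.of_dist_le_mul fun x _ y _ => ?_
    rw [dist_eq_norm, dist_eq_norm, ← map_sub, NNReal.coe_one, one_mul]
    exact hPle _
  have hPu : P u = 0 := by
    have := hP u
    rw [hu.norm_eq, real_inner_self_eq_norm_sq, hu.norm_eq] at this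
    have h0 : ‖P u‖ ^ 2 = 0 := by linarith
    exact norm_eq_zero.1 (pow_eq_zero_iff two_ne_zero |>.1 h0)
  have hsub : Metric.ball (P p) (r / 2) ⊆ P '' K := by
    intro y hy
    obtain ⟨x, hxy, hux⟩ := hPs (y - P p)
    have hxn : ‖x‖ = ‖y - P p‖ := by
      have := hP x
      rw [hux, hxy] at this
      exact (sq_eq_sq₀ (norm_nonneg _) (norm_nonneg _)).1 (by linarith)
    have hxr : ‖x‖ < r / 2 := by rwa [hxn, ← dist_eq_norm]
    rcases eq_or_ne x 0 with rfl | hx0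
    · refine ⟨p, ⟨hp, Metric.mem_closedBall_self hr.le⟩, ?_⟩
      rw [map_zero] at hxy
      exact (sub_eq_zero.1 hxy.symm).symm
    have hx0' : 0 < ‖x‖ := norm_pos_iff.2 hx0
    have hout : p + x ∉ Ω := fun hmem => by
      have := hu.inner_lt h.isOpen hmem
      rw [add_sub_cancel_left, hux] at this
      exact lt_irrefl _ this
    have hin : p + x - ‖x‖ • u ∈ Ω := by
      refine hball p u hu ?_
      rw [Metric.mem_ball, dist_eq_norm,
        show p + x - ‖x‖ • u - (p - R • u) = x + (R - ‖x‖) • u by module]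
      refine lt_of_pow_lt_pow_left₀ 2 hR.le ?_
      rw [norm_add_sq_real, inner_smul_right, real_inner_comm, hux, norm_smul, hu.norm_eq,
        Real.norm_eq_abs, mul_one, sq_abs]
      nlinarith
    obtain ⟨q, hqs, hqf⟩ := (convex_segment (𝕜 := ℝ) (p + x - ‖x‖ • u)
      (p + x)).isPreconnected.inter_frontier_nonempty_of_mem_of_notMem
        (left_mem_segment ℝ _ _) hin (right_mem_segment ℝ _ _) hout
    rw [segment_eq_image'] at hqs
    obtain ⟨θ, hθ, rfl⟩ := hqs
    have hq : p + x - ‖x‖ • u + θ • (p + x - (p + x - ‖x‖ • u)) =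
        p + x - ((1 - θ) * ‖x‖) • u := by module
    simp only [hq] at hqf
    refine ⟨_, ⟨hqf, ?_⟩, ?_⟩
    · rw [Metric.mem_closedBall, dist_eq_norm,
        show p + x - ((1 - θ) * ‖x‖) • u - p = x - ((1 - θ) * ‖x‖) • u by abel]
      refine (norm_sub_le _ _).trans ?_
      rw [norm_smul, hu.norm_eq, mul_one, Real.norm_eq_abs, abs_of_nonneg
        (mul_nonneg (by linarith [hθ.2]) (norm_nonneg x))]
      nlinarith [hθ.1, hθ.2]
    · rw [map_sub, map_smul, hPu, smul_zero, sub_zero, map_add, hxy]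
      abel
  calc ENNReal.ofReal (V.toReal * (1 / 2) ^ d * r ^ d)
      = volume (Metric.ball (P p) (r / 2)) := by
        rw [Measure.addHaar_ball_of_pos _ _ (half_pos hr), finrank_euclideanSpace_fin, ← hV,
          ← ENNReal.ofReal_toReal hVtop, ← ENNReal.ofReal_mul (by positivity),
          ENNReal.toReal_ofReal hVpos.le]
        congr 1
        rw [div_pow, div_pow, one_pow]
        ring
    _ ≤ volume (P '' K) := measure_mono hsub
    _ ≤ ((1 : ℝ≥0) : ℝ≥0∞) ^ d * (Measure.euclideanHausdorffMeasure d : Measure E) K := by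
        rw [← EuclideanSpace.euclideanHausdorffMeasure_eq_volume]
        exact hLip.euclideanHausdorffMeasure_image_le d
    _ = _ := by simp

end DefiningData

end BoundaryMeasure

end LaplaceBergman
end

noncomputable section

namespace LaplaceBergman

/-! ### Laplace-type estimates for boundary integrals -/

section BoundaryIntegral

theorem summable_pow_mul_succ_pow {x : ℝ} (hx0 : 0 ≤ x) (hx1 : x < 1) (d : ℕ) :
    Summable fun k : ℕ => x ^ k * ((k : ℝ) + 1) ^ d := by
  rcases hx0.eq_or_lt with rfl | hx
  · refine summable_of_ne_finset_zero (s := {0}) fun k hk => ?_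
    rw [zero_pow (by simpa using hk), zero_mul]
  have hlt : ‖x‖ < 1 := by rwa [Real.norm_eq_abs, abs_of_nonneg hx0]
  have h0 : Summable fun k : ℕ => (k : ℝ) ^ d * x ^ k :=
    summable_pow_mul_geometric_of_norm_lt_one d hlt
  have h1 : Summable fun k : ℕ => ((k + 1 : ℕ) : ℝ) ^ d * x ^ (k + 1) :=
    h0.comp_injective (add_left_injective 1)
  refine (h1.mul_left x⁻¹).congr fun k => ?_
  rw [pow_succ]
  push_cast
  field_simp

variable {E : Type*} [NormedAddCommGroup E] [InnerProductSpace ℝ E] [FiniteDimensional ℝ E]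
  [MeasurableSpace E] [BorelSpace E] {Ω U : Set E} {ρ : E → ℝ}

/-- The interior ball keeps the exponent bounded below on a cap of radius of order 1/t, and such a
cap has area of order at least t^(-d). The parameter t stands for √‖z‖. -/
theorem DefiningData.exists_le_lintegral_exp (h : DefiningData Ω U ρ) {d : ℕ}
    (hd : Module.finrank ℝ E = d + 1) : ∃ c > 0, ∀ p u, IsUnitNormal Ω p u → ∀ t ≥ (1 : ℝ),
      ENNReal.ofReal (c * t⁻¹ ^ d) ≤ ∫⁻ ζ in frontier Ω,
        ENNReal.ofReal (Real.exp (2 * (t ^ 2 * inner ℝ u (ζ - p))))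
          ∂(Measure.euclideanHausdorffMeasure d : Measure E) := by
  obtain ⟨R, hR, hball⟩ := h.exists_interior_ball
  obtain ⟨c, hc, r₀, hr₀, hlow⟩ := h.exists_le_measure_frontier_inter_closedBall hd
  -- The bound 1 controls the exponent on the cap; the bound r₀, with t ≥ 1, keeps the cap in the
  -- range of the lower area estimate.
  set r₁ := min r₀ 1 with hr₁
  have hr₁pos : 0 < r₁ := lt_min hr₀ one_pos
  set m := Real.exp (-(1 / R)) with hm
  refine ⟨m * (c * r₁ ^ d), by positivity, fun p u hu t ht => ?_⟩
  have ht0 : 0 < t := by linarith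
  have ht1 : t⁻¹ ≤ 1 := inv_le_one_of_one_le₀ ht
  set K := frontier Ω ∩ Metric.closedBall p (r₁ * t⁻¹) with hK
  have hKm : MeasurableSet K := isClosed_frontier.measurableSet.inter
    Metric.isClosed_closedBall.measurableSet
  have hle : r₁ * t⁻¹ ≤ r₀ := (mul_le_of_le_one_right hr₁pos.le ht1).trans (min_le_left _ _)
  calc ENNReal.ofReal (m * (c * r₁ ^ d) * t⁻¹ ^ d)
      = ENNReal.ofReal m * ENNReal.ofReal (c * (r₁ * t⁻¹) ^ d) := by
        rw [← ENNReal.ofReal_mul (by positivity), mul_pow]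
        congr 1
        ring
    _ ≤ ENNReal.ofReal m * (Measure.euclideanHausdorffMeasure d : Measure E) K := by
        gcongr
        exact hlow p hu.mem_frontier _ (by positivity) hle
    _ = ∫⁻ ζ in K, ENNReal.ofReal m ∂(Measure.euclideanHausdorffMeasure d : Measure E) := by
        rw [setLIntegral_const]
    _ ≤ ∫⁻ ζ in K, ENNReal.ofReal (Real.exp (2 * (t ^ 2 * inner ℝ u (ζ - p))))
          ∂(Measure.euclideanHausdorffMeasure d : Measure E) := by
        refine setLIntegral_mono' hKm fun ζ hζ => ENNReal.ofReal_le_ofReal ?_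
        refine Real.exp_le_exp.2 ?_
        have h1 := h.neg_inner_le_of_interior_ball hR hu (hball p u hu) hζ.1
        have h2 : ‖ζ - p‖ ≤ t⁻¹ := by
          have := hζ.2
          rw [Metric.mem_closedBall, dist_eq_norm] at this
          exact this.trans (mul_le_of_le_one_left (by positivity) (min_le_right _ _))
        have h3 : t ^ 2 * ‖ζ - p‖ ^ 2 ≤ 1 := by
          calc t ^ 2 * ‖ζ - p‖ ^ 2 ≤ t ^ 2 * t⁻¹ ^ 2 := by gcongr
            _ = 1 := by field_simp
        have h4 : t ^ 2 * -inner ℝ u (ζ - p) ≤ t ^ 2 * (‖ζ - p‖ ^ 2 / (2 * R)) := by gcongr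
        have h5 : t ^ 2 * (‖ζ - p‖ ^ 2 / (2 * R)) ≤ 1 / (2 * R) := by
          rw [← mul_div_assoc]
          gcongr
        have h6 : 2 * (1 / (2 * R)) = 1 / R := by field_simp
        linarith
    _ ≤ _ := lintegral_mono_set inter_subset_left

/-- Quadratic separation bounds the integrand by the Gaussian exp(-2c t²‖ζ - p‖²). Sorting the
points by the integer part k of t‖ζ - p‖ leaves a convergent sum of e^(-2ck) times cap areas of
order ((k+1)/t)^d. -/
theorem DefiningData.exists_lintegral_exp_le (h : DefiningData Ω U ρ) {d : ℕ}
    (hd : Module.finrank ℝ E = d + 1) : ∃ C > 0, ∀ p u, IsUnitNormal Ω p u → ∀ t ≥ (1 : ℝ),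
      ∫⁻ ζ in frontier Ω, ENNReal.ofReal (Real.exp (2 * (t ^ 2 * inner ℝ u (ζ - p))))
          ∂(Measure.euclideanHausdorffMeasure d : Measure E) ≤
        ENNReal.ofReal (C * t⁻¹ ^ d) := by
  obtain ⟨c, hc, hsep⟩ := h.exists_quadratic_separation
  obtain ⟨C, hC, hup⟩ := h.exists_measure_frontier_inter_closedBall_le hd
  set μ := (Measure.euclideanHausdorffMeasure d : Measure E) with hμ
  let a : ℕ → ℝ := fun k => Real.exp (-(2 * c)) ^ k * ((k : ℝ) + 1) ^ d
  have ha : Summable a := summable_pow_mul_succ_pow (Real.exp_nonneg _)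
    (Real.exp_lt_one_iff.2 (by linarith)) d
  have ha0 : ∀ k, 0 ≤ a k := fun k => by positivity
  refine ⟨C * (∑' k, a k) + 1, by have : 0 ≤ ∑' k, a k := tsum_nonneg ha0; positivity, fun p u hu t ht => ?_⟩
  have ht0 : 0 < t := by linarith
  let B : ℕ → Set E := fun k => Metric.closedBall p ((k + 1) * t⁻¹)
  have hBm : ∀ k, MeasurableSet (B k) := fun k => Metric.isClosed_closedBall.measurableSet
  calc ∫⁻ ζ in frontier Ω, ENNReal.ofReal (Real.exp (2 * (t ^ 2 * inner ℝ u (ζ - p)))) ∂μ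
      ≤ ∫⁻ ζ in frontier Ω, ∑' k : ℕ, (B k).indicator
          (fun _ => ENNReal.ofReal (Real.exp (-(2 * c)) ^ k)) ζ ∂μ := by
        refine setLIntegral_mono' isClosed_frontier.measurableSet fun ζ hζ => ?_
        set k := ⌊t * ‖ζ - p‖⌋₊ with hk
        have hk1 : (k : ℝ) ≤ t * ‖ζ - p‖ := Nat.floor_le (by positivity)
        have hk2 : t * ‖ζ - p‖ < k + 1 := Nat.lt_floor_add_one _
        have hmem : ζ ∈ B k := by
          simp only [B]
          rw [Metric.mem_closedBall, dist_eq_norm, ← div_eq_mul_inv, le_div_iff₀ ht0]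
          linarith
        refine le_trans ?_ (ENNReal.le_tsum k)
        rw [indicator_of_mem hmem]
        refine ENNReal.ofReal_le_ofReal ?_
        rw [← Real.exp_nat_mul]
        refine Real.exp_le_exp.2 ?_
        have h1 := hsep p u hu ζ (frontier_subset_closure hζ)
        have h2 : t ^ 2 * (c * ‖ζ - p‖ ^ 2) ≤ t ^ 2 * -inner ℝ u (ζ - p) := by gcongr
        -- Replacing k² by k, allowed for natural numbers, makes the decay geometric.
        have h3 : (k : ℝ) ≤ (t * ‖ζ - p‖) ^ 2 := by
          have h4 : (k : ℝ) ≤ (k : ℝ) ^ 2 := by exact_mod_cast Nat.le_self_pow two_ne_zero k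
          exact h4.trans (by gcongr)
        have h5 := mul_le_mul_of_nonneg_left h3 hc.le
        nlinarith
    _ = ∑' k : ℕ, ENNReal.ofReal (Real.exp (-(2 * c)) ^ k) * μ (frontier Ω ∩ B k) := by
        rw [lintegral_tsum fun k => (measurable_const.indicator (hBm k)).aemeasurable]
        refine tsum_congr fun k => ?_
        rw [lintegral_indicator_const (hBm k), Measure.restrict_apply (hBm k), inter_comm]
    _ ≤ ∑' k : ℕ, ENNReal.ofReal (C * t⁻¹ ^ d * a k) := by
        refine ENNReal.tsum_le_tsum fun k => ?_
        refine (mul_le_mul_right (hup p hu.mem_frontier ((k + 1) * t⁻¹) (by positivity)) _).trans ?_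
        rw [← ENNReal.ofReal_mul (by positivity)]
        refine ENNReal.ofReal_le_ofReal (le_of_eq ?_)
        simp only [a]
        rw [mul_pow]
        ring
    _ = ENNReal.ofReal (∑' k, C * t⁻¹ ^ d * a k) :=
        (ENNReal.ofReal_tsum_of_nonneg (fun k => mul_nonneg (by positivity) (ha0 k))
          (ha.mul_left _)).symm
    _ ≤ _ := by
        refine ENNReal.ofReal_le_ofReal ?_
        rw [tsum_mul_left]
        have : 0 ≤ t⁻¹ ^ d := by positivity
        nlinarith

end BoundaryIntegral

end LaplaceBergman
end

noncomputable section

namespace LaplaceBergman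

open scoped Pointwise

/-! ### Regularity and curvature of the support function -/

section SupportFunction

/-- Regularity of a continuous solution of `Ψ (s y) = ι y`, by the inverse function theorem. -/
theorem contDiffAt_of_comp_eq {X G : Type*} [NormedAddCommGroup X] [NormedSpace ℝ X]
    [NormedAddCommGroup G] [NormedSpace ℝ G] [FiniteDimensional ℝ G]
    {Ψ : G → G} {s : X → G} {ι : X → G} {x : X} {k : WithTop ℕ∞} (hk : k ≠ 0)
    {Ψ' : G →L[ℝ] G} (hΨ : ContDiffAt ℝ k Ψ (s x)) (hΨ' : HasFDerivAt Ψ Ψ' (s x))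
    (hinj : ∀ w, Ψ' w = 0 → w = 0) (hι : ContDiffAt ℝ k ι x) (hs : ContinuousAt s x)
    (heq : ∀ᶠ y in 𝓝 x, Ψ (s y) = ι y) : ContDiffAt ℝ k s x := by
  have := FiniteDimensional.complete ℝ G
  have hinj' : Function.Injective (Ψ' : G →ₗ[ℝ] G) :=
    (injective_iff_map_eq_zero _).2 fun w hw => hinj w hw
  let e : G ≃L[ℝ] G := (LinearEquiv.ofInjectiveEndo (Ψ' : G →ₗ[ℝ] G) hinj').toContinuousLinearEquiv
  have he : (e : G →L[ℝ] G) = Ψ' := by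
    ext w
    rfl
  have hΨe : HasFDerivAt Ψ (e : G →L[ℝ] G) (s x) := he ▸ hΨ'
  have hloc := hΨ.to_localInverse hΨe hk
  have hleft := (hΨ.hasStrictFDerivAt' hΨe hk).eventually_left_inverse
  have hx : Ψ (s x) = ι x := heq.self_of_nhds
  rw [hx] at hloc
  refine (hloc.comp x hι).congr_of_eventuallyEq ?_
  filter_upwards [hs.eventually hleft, heq] with y hy1 hy2
  rw [Function.comp_apply, ← hy2]
  exact hy1.symm

theorem _root_.ContDiffAt.hasFDerivAt_fderiv {X Y : Type*} [NormedAddCommGroup X]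
    [NormedSpace ℝ X] [NormedAddCommGroup Y] [NormedSpace ℝ Y] {f : X → Y} {x : X}
    (hf : ContDiffAt ℝ 2 f x) : HasFDerivAt (fderiv ℝ f) (fderiv ℝ (fderiv ℝ f) x) x := by
  have h2 : ContDiffAt ℝ 1 (fderiv ℝ f) x := hf.fderiv_right (by norm_num)
  exact (h2.differentiableAt (by norm_num)).hasFDerivAt

/-- A `C²` function which grows quadratically over its tangent plane in the direction `v` has a
positive second derivative in this direction. -/
theorem hessian_pos_of_quadratic_growth {X : Type*} [NormedAddCommGroup X] [NormedSpace ℝ X]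
    {f : X → ℝ} {x v : X} {κ : ℝ} (hf : ContDiffAt ℝ 2 f x) (hκ : 0 < κ)
    (h : ∀ᶠ t in 𝓝[>] (0 : ℝ), κ * t ^ 2 ≤ f (x + t • v) - f x - t * fderiv ℝ f x v) :
    0 < fderiv ℝ (fderiv ℝ f) x v v := by
  -- Were the second derivative nonpositive, the first derivative would rise by at most κt for small
  -- t > 0. Integration then gives growth at most κt²/2, against the assumed κt².
  by_contra! hle
  have hline : ∀ t : ℝ, HasDerivAt (fun t : ℝ => x + t • v) v t := fun t => by
    simpa using ((hasDerivAt_id t).smul_const v).const_add x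
  have hc : Tendsto (fun t : ℝ => x + t • v) (𝓝 0) (𝓝 x) := by
    have : Continuous (fun t : ℝ => x + t • v) := by fun_prop
    simpa using this.tendsto 0
  have hd1 : ∀ᶠ t in 𝓝 (0 : ℝ), HasDerivAt (fun t : ℝ => f (x + t • v))
      (fderiv ℝ f (x + t • v) v) t := by
    have h1 : ∀ᶠ y in 𝓝 x, ContDiffAt ℝ 2 f y := hf.eventually (by simp)
    filter_upwards [hc.eventually h1] with t ht
    exact (ht.differentiableAt (by norm_num)).hasFDerivAt.comp_hasDerivAt t (hline t)
  have hd2 : HasDerivAt (fun t : ℝ => fderiv ℝ f (x + t • v) v)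
      (fderiv ℝ (fderiv ℝ f) x v v) 0 := by
    have h1 : HasFDerivAt (fderiv ℝ f) (fderiv ℝ (fderiv ℝ f) x) (x + (0 : ℝ) • v) := by
      rw [zero_smul, add_zero]
      exact hf.hasFDerivAt_fderiv
    have h3 : HasDerivAt (fun t : ℝ => fderiv ℝ f (x + t • v)) (fderiv ℝ (fderiv ℝ f) x v) 0 :=
      HasFDerivAt.comp_hasDerivAt (0 : ℝ) h1 (hline 0)
    have h4 := h3.clm_apply (hasDerivAt_const (0 : ℝ) v)
    rwa [map_zero, add_zero] at h4
  have hslope : ∀ᶠ t in 𝓝[>] (0 : ℝ), fderiv ℝ f (x + t • v) v - fderiv ℝ f x v ≤ κ * t := by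
    have h2 := (hasDerivAt_iff_tendsto_slope.1 hd2).mono_left
      (nhdsWithin_mono 0 (fun t (ht : 0 < t) => ht.ne'))
    filter_upwards [h2.eventually (gt_mem_nhds (hle.trans_lt hκ)), self_mem_nhdsWithin] with t ht ht0
    have ht0 : 0 < t := ht0
    simp only [slope_def_field, zero_smul, add_zero, sub_zero] at ht
    rw [div_lt_iff₀ ht0] at ht
    exact ht.le
  obtain ⟨ε, hε, hball⟩ := mem_nhdsGT_iff_exists_Ioo_subset.1
    ((hslope.and (hd1.filter_mono nhdsWithin_le_nhds)).and h)
  have hε : 0 < ε := hε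
  set b := ε / 2 with hb
  have hb0 : 0 < b := half_pos hε
  have hanti : AntitoneOn (fun t : ℝ => f (x + t • v) - t * fderiv ℝ f x v - κ / 2 * t ^ 2)
      (Icc 0 b) := by
    refine antitoneOn_of_hasDerivWithinAt_nonpos
      (f' := fun t => fderiv ℝ f (x + t • v) v - fderiv ℝ f x v - κ * t) (convex_Icc 0 b) ?_ ?_ ?_
    · intro t ht
      refine ContinuousAt.continuousWithinAt ?_
      have : ContinuousAt (fun t : ℝ => f (x + t • v)) t := by
        rcases ht.1.eq_or_lt with rfl | ht0
        · exact hd1.self_of_nhds.continuousAt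
        · exact (hball ⟨ht0, by linarith [ht.2]⟩).1.2.continuousAt
      exact (this.sub (by fun_prop)).sub (by fun_prop)
    · intro t ht
      rw [interior_Icc] at ht
      have h1 := (hball ⟨ht.1, by linarith [ht.2]⟩).1.2
      have h2 := (h1.sub ((hasDerivAt_id t).mul_const (fderiv ℝ f x v))).sub
        ((hasDerivAt_pow 2 t).const_mul (κ / 2))
      refine (h2.congr_deriv ?_).hasDerivWithinAt
      norm_num
      ring
    · intro t ht
      rw [interior_Icc] at ht
      have := (hball ⟨ht.1, by linarith [ht.2]⟩).1.1
      linarith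
  have h1 := hanti (left_mem_Icc.2 hb0.le) (right_mem_Icc.2 hb0.le) hb0.le
  have h2 := (hball ⟨hb0, by linarith⟩ : _ ∧ κ * b ^ 2 ≤ _).2
  simp only [zero_smul, add_zero, zero_mul, sub_zero, ne_eq, OfNat.ofNat_ne_zero,
    not_false_eq_true, zero_pow, mul_zero] at h1
  have : 0 < κ * b ^ 2 := by positivity
  linarith

variable {E : Type*} [NormedAddCommGroup E] [InnerProductSpace ℝ E]

/-- The support function of `Ω` with respect to the real inner product. -/
def innerSupport (Ω : Set E) (y : E) : ℝ := sSup ((fun ζ => inner ℝ y ζ) '' Ω)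

open Classical in
/-- The boundary point of `Ω` with outward normal `y`. -/
def supportPoint (Ω : Set E) (y : E) : E :=
  if h : ∃ p, IsUnitNormal Ω p (‖y‖⁻¹ • y) then h.choose else 0

namespace DefiningData

variable {Ω U : Set E} {ρ : E → ℝ} [FiniteDimensional ℝ E]

theorem isUnitNormal_supportPoint (h : DefiningData Ω U ρ) {y : E} (hy : y ≠ 0) :
    IsUnitNormal Ω (supportPoint Ω y) (‖y‖⁻¹ • y) := by
  have hy' : 0 < ‖y‖ := norm_pos_iff.2 hy
  have hex : ∃ p, IsUnitNormal Ω p (‖y‖⁻¹ • y) := by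
    obtain ⟨p, hp, hmax⟩ := h.isCompact_closure.exists_isMaxOn h.nonempty.closure
      (f := fun ζ => inner ℝ y ζ) (by fun_prop)
    have hle : ∀ ζ ∈ closure Ω, inner ℝ y ζ ≤ inner ℝ y p := fun ζ hζ => hmax hζ
    refine ⟨p, ?_, by simp [norm_smul, hy'.ne'], fun ζ hζ => ?_⟩
    · rw [h.isOpen.frontier_eq]
      refine ⟨hp, fun hpΩ => ?_⟩
      have hc : Tendsto (fun t : ℝ => p + t • y) (𝓝[>] 0) (𝓝 p) := by
        have : Continuous (fun t : ℝ => p + t • y) := by fun_prop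
        have := this.tendsto 0
        rw [zero_smul, add_zero] at this
        exact this.mono_left nhdsWithin_le_nhds
      obtain ⟨t, ht, ht0⟩ :=
        ((hc.eventually (h.isOpen.mem_nhds hpΩ)).and self_mem_nhdsWithin).exists
      have ht0 : 0 < t := ht0
      have := hle _ (subset_closure ht)
      rw [inner_add_right, inner_smul_right, real_inner_self_eq_norm_sq] at this
      have h3 : 0 < t * ‖y‖ ^ 2 := by positivity
      linarith
    · rw [inner_smul_left, inner_sub_right]
      have := hle ζ (subset_closure hζ)
      exact mul_nonpos_of_nonneg_of_nonpos (by simp) (by linarith)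
  rw [supportPoint, dif_pos hex]
  exact hex.choose_spec

theorem inner_le_inner_supportPoint (h : DefiningData Ω U ρ) {y ζ : E} (hy : y ≠ 0)
    (hζ : ζ ∈ closure Ω) : inner ℝ y ζ ≤ inner ℝ y (supportPoint Ω y) := by
  have h1 := (h.isUnitNormal_supportPoint hy).inner_le_of_mem_closure hζ
  rw [inner_smul_left, inner_sub_right] at h1
  have hy' : 0 < ‖y‖⁻¹ := inv_pos.2 (norm_pos_iff.2 hy)
  have h2 := nonpos_of_mul_nonpos_right h1 (by simpa using hy')
  linarith

theorem supportPoint_mem_closure (h : DefiningData Ω U ρ) {y : E} (hy : y ≠ 0) :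
    supportPoint Ω y ∈ closure Ω :=
  frontier_subset_closure (h.isUnitNormal_supportPoint hy).mem_frontier

theorem isLUB_innerSupport (h : DefiningData Ω U ρ) (y : E) :
    IsLUB ((fun ζ => inner ℝ y ζ) '' Ω) (innerSupport Ω y) := by
  refine isLUB_csSup (h.nonempty.image _) ?_
  have : IsCompact ((fun ζ => inner ℝ y ζ) '' closure Ω) :=
    h.isCompact_closure.image (by fun_prop)
  exact this.bddAbove.mono (image_mono subset_closure)

theorem inner_le_innerSupport (h : DefiningData Ω U ρ) (y : E) {ζ : E} (hζ : ζ ∈ closure Ω) :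
    inner ℝ y ζ ≤ innerSupport Ω y := by
  have hc : IsClosed {ζ : E | inner ℝ y ζ ≤ innerSupport Ω y} :=
    isClosed_le (by fun_prop) continuous_const
  exact closure_minimal (fun ζ hζ => (h.isLUB_innerSupport y).1 (mem_image_of_mem _ hζ)) hc hζ

theorem innerSupport_eq (h : DefiningData Ω U ρ) {y : E} (hy : y ≠ 0) :
    innerSupport Ω y = inner ℝ y (supportPoint Ω y) := by
  refine le_antisymm ((h.isLUB_innerSupport y).2 ?_)
    (h.inner_le_innerSupport y (h.supportPoint_mem_closure hy))
  rintro _ ⟨ζ, hζ, rfl⟩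
  exact h.inner_le_inner_supportPoint hy (subset_closure hζ)

omit [FiniteDimensional ℝ E] in
theorem _root_.LaplaceBergman.innerSupport_smul {a : ℝ} (ha : 0 ≤ a) (y : E) :
    innerSupport Ω (a • y) = a * innerSupport Ω y := by
  have : (fun ζ => inner ℝ (a • y) ζ) '' Ω = a • ((fun ζ => inner ℝ y ζ) '' Ω) := by
    rw [← image_smul, image_image]
    refine image_congr fun ζ _ => ?_
    rw [inner_smul_left, smul_eq_mul]
    rfl
  rw [innerSupport, this, Real.sSup_smul_of_nonneg ha, smul_eq_mul, innerSupport]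

theorem exists_abs_innerSupport_sub_le (h : DefiningData Ω U ρ) :
    ∃ D ≥ 0, ∀ y y', |innerSupport Ω y - innerSupport Ω y'| ≤ D * ‖y - y'‖ := by
  obtain ⟨D, hD⟩ := h.isBounded.exists_norm_le
  have key : ∀ y y', innerSupport Ω y - innerSupport Ω y' ≤ |D| * ‖y - y'‖ := by
    intro y y'
    rw [sub_le_iff_le_add]
    refine (h.isLUB_innerSupport y).2 ?_
    rintro _ ⟨ζ, hζ, rfl⟩
    have h1 := h.inner_le_innerSupport y' (subset_closure hζ)
    have h2 := real_inner_le_norm (y - y') ζ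
    rw [inner_sub_left] at h2
    have h3 : ‖y - y'‖ * ‖ζ‖ ≤ |D| * ‖y - y'‖ := by
      rw [mul_comm]
      gcongr
      exact (hD ζ hζ).trans (le_abs_self D)
    simp only
    linarith
  refine ⟨|D|, abs_nonneg D, fun y y' => abs_sub_le_iff.2 ⟨key y y', ?_⟩⟩
  rw [norm_sub_rev]
  exact key y' y

theorem continuous_innerSupport (h : DefiningData Ω U ρ) : Continuous (innerSupport Ω) := by
  obtain ⟨D, hD0, hD⟩ := h.exists_abs_innerSupport_sub_le
  refine (LipschitzWith.of_dist_le_mul (K := ⟨D, hD0⟩) fun y y' => ?_).continuous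
  rw [Real.dist_eq, dist_eq_norm]
  exact hD y y'

/-- Quadratic separation at p, tested at p', together with maximality of p' for y' gives c‖y‖‖p' -
p‖² ≤ ⟨y' - y, p' - p⟩. By Cauchy–Schwarz the inverse Gauss map satisfies a Lipschitz estimate at y.
-/
theorem continuousAt_supportPoint (h : DefiningData Ω U ρ) {y : E} (hy : y ≠ 0) :
    ContinuousAt (supportPoint Ω) y := by
  obtain ⟨c, hc, hsep⟩ := h.exists_quadratic_separation
  have hy0 : 0 < ‖y‖ := norm_pos_iff.2 hy
  have hlip : ∀ᶠ y' in 𝓝 y,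
      ‖supportPoint Ω y' - supportPoint Ω y‖ ≤ (c * ‖y‖)⁻¹ * ‖y' - y‖ := by
    filter_upwards [isOpen_ne.mem_nhds hy] with y' hy'
    set p := supportPoint Ω y
    set p' := supportPoint Ω y'
    have h1 := hsep p _ (h.isUnitNormal_supportPoint hy) p' (h.supportPoint_mem_closure hy')
    rw [inner_smul_left] at h1
    simp only [conj_trivial] at h1
    have h2 : c * ‖y‖ * ‖p' - p‖ ^ 2 ≤ -inner ℝ y (p' - p) := by
      have := mul_le_mul_of_nonneg_left h1 hy0.le
      rw [← neg_mul_eq_mul_neg, ← mul_assoc ‖y‖ ‖y‖⁻¹, mul_inv_cancel₀ hy0.ne'] at this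
      linarith
    have h3 := h.inner_le_inner_supportPoint hy' (h.supportPoint_mem_closure hy)
    have h4 : c * ‖y‖ * ‖p' - p‖ ^ 2 ≤ inner ℝ (y' - y) (p' - p) := by
      rw [inner_sub_left, inner_sub_right y' p' p]
      linarith
    have h5 := h4.trans (real_inner_le_norm _ _)
    rw [inv_mul_eq_div, le_div_iff₀ (by positivity)]
    rcases (norm_nonneg (p' - p)).eq_or_lt with h0 | h0
    · rw [← h0]
      simp
    · nlinarith
  rw [ContinuousAt, tendsto_iff_norm_sub_tendsto_zero]
  refine squeeze_zero' (Eventually.of_forall fun _ => norm_nonneg _) hlip ?_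
  have : Continuous fun y' => (c * ‖y‖)⁻¹ * ‖y' - y‖ := by fun_prop
  simpa using this.tendsto y

/-- Each support point competes in the supremum for the other vector, whence 0 ≤ H(y') - H(y) - ⟨p,
y' - y⟩ ≤ ⟨p' - p, y' - y⟩. Continuity of the support point makes this o(‖y' - y‖). -/
theorem hasFDerivAt_innerSupport (h : DefiningData Ω U ρ) {y : E} (hy : y ≠ 0) :
    HasFDerivAt (innerSupport Ω) (innerSL ℝ (supportPoint Ω y)) y := by
  rw [hasFDerivAt_iff_isLittleO]
  have hbound : ∀ᶠ y' in 𝓝 y, ‖innerSupport Ω y' - innerSupport Ω y -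
      innerSL ℝ (supportPoint Ω y) (y' - y)‖ ≤
      ‖supportPoint Ω y' - supportPoint Ω y‖ * ‖y' - y‖ := by
    filter_upwards [isOpen_ne.mem_nhds hy] with y' hy'
    have h1 := h.inner_le_innerSupport y' (h.supportPoint_mem_closure hy)
    have h2 := h.inner_le_innerSupport y (h.supportPoint_mem_closure hy')
    rw [h.innerSupport_eq hy'] at h1 ⊢
    rw [h.innerSupport_eq hy] at h2 ⊢
    have h3 := real_inner_le_norm (supportPoint Ω y' - supportPoint Ω y) (y' - y)
    rw [innerSL_apply_apply, Real.norm_eq_abs, abs_of_nonneg]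
    · refine le_trans (le_of_sub_nonneg ?_) h3
      simp only [inner_sub_left, inner_sub_right, real_inner_comm] at h2 ⊢
      linarith
    · simp only [inner_sub_right, real_inner_comm] at h1 ⊢
      linarith
  rw [Asymptotics.isLittleO_iff]
  intro ε hε
  have hcont := (h.continuousAt_supportPoint hy).eventually (Metric.ball_mem_nhds _ hε)
  filter_upwards [hbound, hcont] with y' h1 h2
  rw [dist_eq_norm] at h2
  exact h1.trans (by gcongr)

/-- The support point and its Lagrange multiplier l = ‖y‖/‖dρ(p)‖ solve the system l∇ρ(p) = y, ρ(p)
= 0. Its linearization is injective because the Hessian of ρ is definite on tangent vectors, so the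
inverse function theorem applies. -/
theorem contDiffAt_supportPoint (h : DefiningData Ω U ρ) {y : E} (hy : y ≠ 0) :
    ContDiffAt ℝ 1 (supportPoint Ω) y := by
  let T : (E →L[ℝ] ℝ) →L[ℝ] E :=
    (InnerProductSpace.toDual ℝ E).symm.toContinuousLinearEquiv.toContinuousLinearMap
  have hT : ∀ (f : E →L[ℝ] ℝ) (v : E), inner ℝ (T f) v = f v := fun f v =>
    InnerProductSpace.toDual_symm_apply
  let Ψ : E × ℝ → E × ℝ := fun z => (z.2 • T (fderiv ℝ ρ z.1), ρ z.1)
  let s : E → E × ℝ := fun y => (supportPoint Ω y, ‖y‖ / ‖fderiv ℝ ρ (supportPoint Ω y)‖)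
  have hnormal := fun {y : E} (hy : y ≠ 0) => h.isUnitNormal_supportPoint hy
  have hpos : ∀ {y : E}, y ≠ 0 → 0 < ‖fderiv ℝ ρ (supportPoint Ω y)‖ := fun hy =>
    norm_pos_iff.2 (h.fderiv_ne_zero _ (hnormal hy).mem_frontier)
  have hU : ∀ {y : E}, y ≠ 0 → supportPoint Ω y ∈ U := fun hy =>
    h.frontier_subset (hnormal hy).mem_frontier
  have heq : ∀ {y : E}, y ≠ 0 → Ψ (s y) = (y, 0) := by
    intro y hy
    refine Prod.ext ?_ (h.eq_zero_of_mem_frontier (hnormal hy).mem_frontier)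
    refine ext_inner_right ℝ fun v => ?_
    have hn := hpos hy
    have hy0 : 0 < ‖y‖ := norm_pos_iff.2 hy
    simp only [Ψ, s]
    rw [inner_smul_left, hT, h.fderiv_apply_eq_norm_mul_inner (hnormal hy), inner_smul_left]
    simp only [conj_trivial]
    field_simp
  set p := supportPoint Ω y with hp
  set l := ‖y‖ / ‖fderiv ℝ ρ p‖ with hl
  have hl0 : 0 < l := div_pos (norm_pos_iff.2 hy) (hpos hy)
  have hsy : s y = (p, l) := rfl
  have hρ : ContDiffAt ℝ 2 ρ p := h.contDiffAt (hU hy)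
  have hdρ : ContDiffAt ℝ 1 (fderiv ℝ ρ) p := hρ.fderiv_right (by norm_num)
  have hΨ : ContDiffAt ℝ 1 Ψ (s y) := by
    refine ContDiffAt.prodMk (contDiffAt_snd.smul ?_) ?_
    · exact T.contDiff.contDiffAt.comp (s y) (ContDiffAt.comp (s y) hdρ contDiffAt_fst)
    · exact (ContDiffAt.comp (s y) (hρ.of_le (by norm_num)) contDiffAt_fst)
  have hfst : HasFDerivAt (Prod.fst : E × ℝ → E) (ContinuousLinearMap.fst ℝ E ℝ) (s y) :=
    hasFDerivAt_fst
  have hd1 : HasFDerivAt (fun z : E × ℝ => ρ z.1)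
      ((fderiv ℝ ρ p).comp (ContinuousLinearMap.fst ℝ E ℝ)) (s y) :=
    HasFDerivAt.comp (s y) (h.hasFDerivAt (hU hy)) hfst
  have hd2 : HasFDerivAt (fun z : E × ℝ => T (fderiv ℝ ρ z.1))
      (T.comp ((fderiv ℝ (fderiv ℝ ρ) p).comp (ContinuousLinearMap.fst ℝ E ℝ))) (s y) :=
    T.hasFDerivAt.comp (s y) (HasFDerivAt.comp (s y) (h.hasFDerivAt_fderiv (hU hy)) hfst)
  have hΨ' := (hasFDerivAt_snd (𝕜 := ℝ) (E := E) (F := ℝ) (p := s y)).smul hd2 |>.prodMk hd1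
  have hres : ContDiffAt ℝ 1 s y := by
    refine contDiffAt_of_comp_eq one_ne_zero hΨ hΨ' ?_
      (ι := fun y => (y, (0 : ℝ))) (contDiffAt_id.prodMk contDiffAt_const) ?_ ?_
    · rintro ⟨w, τ⟩ hw
      have h1 := congrArg Prod.fst hw
      have h2 := congrArg Prod.snd hw
      simp [hsy] at h1 h2
      -- Pairing with the tangent vector w removes the multiplier term and leaves l·D²ρ(w, w) = 0.
      have h3 := congrArg (fun z => inner ℝ z w) h1
      simp only [inner_add_left, inner_smul_left, hT, h2, inner_zero_left, conj_trivial,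
        mul_zero, add_zero, mul_eq_zero, hl0.ne', false_or] at h3
      have hw0 : w = 0 := by
        by_contra hne
        exact (h.hessian_pos p (hnormal hy).mem_frontier w hne h2).ne' h3
      rw [hw0, map_zero, map_zero, smul_zero, zero_add, smul_eq_zero] at h1
      have hT0 : T (fderiv ℝ ρ p) ≠ 0 := fun h0 =>
        h.fderiv_ne_zero p (hnormal hy).mem_frontier (by
          ext v
          rw [← hT, h0, inner_zero_left]
          rfl)
      rw [hw0, h1.resolve_right hT0]
      rfl
    · have hc := h.continuousAt_supportPoint hy
      refine hc.prodMk (continuousAt_id.norm.div ?_ (hpos hy).ne')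
      exact (ContinuousAt.comp (f := supportPoint Ω) (g := fderiv ℝ ρ) hdρ.continuousAt hc).norm
    · filter_upwards [isOpen_ne.mem_nhds hy] with y' hy'
      exact heq hy'
  exact contDiffAt_fst.comp y hres

/-- No derivative is lost, since the gradient is the support point and this is already C¹. -/
theorem contDiffAt_innerSupport (h : DefiningData Ω U ρ) {y : E} (hy : y ≠ 0) :
    ContDiffAt ℝ 2 (innerSupport Ω) y := by
  rw [show (2 : WithTop ℕ∞) = (1 : ℕ) + 1 by norm_num, contDiffAt_succ_iff_hasFDerivAt]
  refine ⟨fun y => innerSL ℝ (supportPoint Ω y), ⟨{0}ᶜ, isOpen_ne.mem_nhds hy, fun x hx =>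
    h.hasFDerivAt_innerSupport hx⟩, ?_⟩
  exact (innerSL ℝ).contDiff.contDiffAt.comp y (h.contDiffAt_supportPoint hy)

/-- The support function grows quadratically over its tangent plane in all non-radial
directions. -/
theorem innerSupport_quadratic_growth (h : DefiningData Ω U ρ) {y v : E} (hy : y ≠ 0)
    (hv : ∀ a : ℝ, v ≠ a • y) : ∃ κ > 0, ∀ᶠ t in 𝓝[>] (0 : ℝ), κ * t ^ 2 ≤
      innerSupport Ω (y + t • v) - innerSupport Ω y - t * fderiv ℝ (innerSupport Ω) y v := by
  obtain ⟨R, hR, hball⟩ := h.exists_interior_ball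
  have hy0 : 0 < ‖y‖ := norm_pos_iff.2 hy
  set p := supportPoint Ω y with hp
  set u := ‖y‖⁻¹ • y with hu
  have hnormal := h.isUnitNormal_supportPoint hy
  have hun : ‖u‖ = 1 := hnormal.norm_eq
  have hyu : y = ‖y‖ • u := by rw [hu, smul_inv_smul₀ hy0.ne']
  have hclosed : Metric.closedBall (p - R • u) R ⊆ closure Ω := by
    rw [← closure_ball _ hR.ne']
    exact closure_mono (hball p u hnormal)
  -- The left side is the support function of the tangent interior ball at p. It agrees with that of
  -- Ω at y, so its growth passes to Ω.
  have hlow : ∀ x : E, x ≠ 0 → inner ℝ x p + R * (‖x‖ - inner ℝ u x) ≤ innerSupport Ω x := by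
    intro x hx
    have hx0 : 0 < ‖x‖ := norm_pos_iff.2 hx
    have hmem : p - R • u + (R * ‖x‖⁻¹) • x ∈ closure Ω := by
      refine hclosed ?_
      rw [Metric.mem_closedBall, dist_eq_norm, add_sub_cancel_left, norm_smul, Real.norm_eq_abs,
        abs_of_pos (by positivity), mul_assoc, inv_mul_cancel₀ hx0.ne', mul_one]
    have := h.inner_le_innerSupport x hmem
    rw [inner_add_right, inner_sub_right, inner_smul_right _ x, inner_smul_right _ u,
      real_inner_self_eq_norm_sq, real_inner_comm u x] at this
    have h2 : R * ‖x‖⁻¹ * ‖x‖ ^ 2 = R * ‖x‖ := by field_simp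
    linarith
  set D := ‖v‖ ^ 2 - (inner ℝ u v) ^ 2 with hD
  have hDpos : 0 < D := by
    have h1 : ‖v - inner ℝ u v • u‖ ^ 2 = D := by
      rw [norm_sub_sq_real, inner_smul_right, norm_smul, hun, Real.norm_eq_abs, mul_one, sq_abs,
        real_inner_comm u v]
      ring
    rw [← h1]
    have : v - inner ℝ u v • u ≠ 0 := fun h0 => hv (inner ℝ u v * ‖y‖⁻¹) (by
      rw [mul_smul]
      exact sub_eq_zero.1 h0)
    positivity
  have hline : Continuous (fun t : ℝ => y + t • v) := by fun_prop
  refine ⟨R * (D / (4 * ‖y‖)), by positivity, ?_⟩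
  have hlt : ∀ᶠ t in 𝓝 (0 : ℝ), ‖y + t • v‖ < 2 * ‖y‖ := by
    refine (hline.norm.tendsto 0).eventually (gt_mem_nhds ?_)
    simp only [zero_smul, add_zero]
    linarith
  have hne : ∀ᶠ t in 𝓝 (0 : ℝ), y + t • v ≠ 0 := by
    refine (hline.tendsto 0).eventually (isOpen_ne.mem_nhds ?_)
    simpa using hy
  refine ((hlt.and hne).filter_mono nhdsWithin_le_nhds).mono ?_
  rintro t ⟨h1, h2⟩
  have h3 := hlow _ h2
  rw [(h.hasFDerivAt_innerSupport hy).fderiv, innerSL_apply_apply, h.innerSupport_eq hy]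
  set x := y + t • v with hx
  have hx0 : 0 < ‖x‖ := norm_pos_iff.2 h2
  have hxy : inner ℝ x p = inner ℝ y p + t * inner ℝ p v := by
    rw [hx, inner_add_left, inner_smul_left, real_inner_comm p v]
    rfl
  have hux : inner ℝ u x = ‖y‖ + t * inner ℝ u v := by
    rw [hx, inner_add_right, inner_smul_right]
    congr 1
    rw [hu, inner_smul_left, real_inner_self_eq_norm_sq]
    simp only [conj_trivial]
    field_simp
  have hxx : ‖x‖ ^ 2 = ‖y‖ ^ 2 + 2 * (t * (‖y‖ * inner ℝ u v)) + t ^ 2 * ‖v‖ ^ 2 := by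
    rw [hx, norm_add_sq_real, inner_smul_right, norm_smul, mul_pow, Real.norm_eq_abs, sq_abs]
    congr 3
    conv_lhs => rw [hyu]
    rw [inner_smul_left]
    simp
  -- The growth of ‖x‖ - ⟨u, x⟩ is read off from this difference of squares. D is the squared
  -- distance from v to the line ℝu, and the second factor is at most 4‖y‖ for small t.
  have hprod : (‖x‖ - inner ℝ u x) * (‖x‖ + inner ℝ u x) = t ^ 2 * D := by
    rw [hux, hD]
    linear_combination hxx
  have hle : |inner ℝ u x| ≤ ‖x‖ := by
    simpa [hun] using abs_real_inner_le_norm u x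
  have hle1 := abs_le.1 hle
  have hkey : t ^ 2 * D ≤ (‖x‖ - inner ℝ u x) * (4 * ‖y‖) := by
    rw [← hprod]
    refine mul_le_mul_of_nonneg_left ?_ (by linarith)
    linarith
  have hfin : D / (4 * ‖y‖) * t ^ 2 ≤ ‖x‖ - inner ℝ u x := by
    rw [div_mul_eq_mul_div, div_le_iff₀ (by positivity)]
    linarith
  have := mul_le_mul_of_nonneg_left hfin hR.le
  linarith

end DefiningData

end SupportFunction

end LaplaceBergman
end

noncomputable section

namespace LaplaceBergman

open scoped ComplexOrder

/-! ### Levi forms, scaling and the Monge–Ampère density -/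

section ComplexHessian

variable {n : ℕ}

/-- The coordinatewise complex conjugation of `ℂⁿ`. -/
def conjCn (n : ℕ) : Cn n ≃ₗᵢ[ℝ] Cn n :=
  LinearIsometryEquiv.piLpCongrRight 2 fun _ => Complex.conjLIE

@[simp]
theorem conjCn_apply (z : Cn n) (j : Fin n) : conjCn n z j = (starRingEnd ℂ) (z j) := rfl

/-- Conjugation is a real-linear isometry, so this identity carries every estimate for the real
support function over to H. -/
theorem inner_conjCn (z ζ : Cn n) : inner ℝ (conjCn n z) ζ = (pairing ζ z).re := by
  rw [PiLp.inner_apply, pairing, Complex.re_sum]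
  refine Finset.sum_congr rfl fun j _ => ?_
  rw [Complex.inner]
  simp [mul_comm]

theorem supportFun_eq (Ω : Set (Cn n)) : supportFun Ω = fun z => innerSupport Ω (conjCn n z) := by
  funext z
  simp only [supportFun, innerSupport, inner_conjCn]

theorem IsBoundedStronglyConvexDomain.exists_definingData {Ω : Set (Cn n)}
    (h : IsBoundedStronglyConvexDomain Ω) : ∃ U ρ, DefiningData Ω U ρ := by
  obtain ⟨U, ρ, h1, h2, h3, h4, h5, h6⟩ := h.exists_defining
  exact ⟨U, ρ, h.nonempty, h.isOpen, h.convex, h.isBounded, h1, h2, h3, h4, h5, h6⟩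

theorem I_smul_ex (j : Fin n) : Complex.I • ex j = ey j := by
  ext k
  simp [ex, ey]

theorem complex_smul_eq (c : ℂ) (v : Cn n) : c • v = c.re • v + c.im • (Complex.I • v) := by
  ext k
  simp only [PiLp.smul_apply, PiLp.add_apply, smul_eq_mul, Complex.real_smul]
  conv_lhs => rw [← Complex.re_add_im c]
  ring

/-- The sesquilinear form attached to a real bilinear form: for the real Hessian it is the Levi
form. -/
def leviForm (B : Cn n →L[ℝ] Cn n →L[ℝ] ℝ) : Cn n →ₗ[ℂ] Cn n →ₛₗ[starRingEnd ℂ] ℂ :=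
  LinearMap.mk₂'ₛₗ (RingHom.id ℂ) (starRingEnd ℂ)
    (fun v w => (((B v w + B (Complex.I • v) (Complex.I • w) : ℝ) : ℂ) +
      Complex.I * ((B v (Complex.I • w) - B (Complex.I • v) w : ℝ) : ℂ)) / 4)
    (fun v v' w => by
      simp only [smul_add, map_add, _root_.add_apply]
      push_cast
      ring)
    (fun c v w => by
      simp only [RingHom.id_apply]
      rw [smul_comm Complex.I c v, complex_smul_eq c v, complex_smul_eq c (Complex.I • v),
        smul_smul Complex.I Complex.I v, Complex.I_mul_I]
      simp only [map_add, map_smul, neg_smul, one_smul, map_neg, _root_.add_apply,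
        _root_.smul_apply, _root_.neg_apply, smul_eq_mul]
      push_cast
      conv_rhs => rw [← Complex.re_add_im c]
      linear_combination (-(c.im : ℂ) * (B v (Complex.I • w) - B (Complex.I • v) w) / 4) *
        Complex.I_sq)
    (fun v w w' => by
      simp only [smul_add, map_add]
      push_cast
      ring)
    (fun c v w => by
      rw [smul_comm Complex.I c w, complex_smul_eq c w, complex_smul_eq c (Complex.I • w),
        smul_smul Complex.I Complex.I w, Complex.I_mul_I]
      simp only [map_add, map_smul, neg_smul, one_smul, map_neg, smul_eq_mul]
      push_cast
      have hc : (starRingEnd ℂ) c = c.re - c.im * Complex.I := by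
        apply Complex.ext <;> simp
      rw [hc]
      linear_combination ((c.im : ℂ) * (B v (Complex.I • w) - B (Complex.I • v) w) / 4) *
        Complex.I_sq)

theorem leviForm_apply (B : Cn n →L[ℝ] Cn n →L[ℝ] ℝ) (v w : Cn n) :
    leviForm B v w = (((B v w + B (Complex.I • v) (Complex.I • w) : ℝ) : ℂ) +
      Complex.I * ((B v (Complex.I • w) - B (Complex.I • v) w : ℝ) : ℂ)) / 4 := rfl

theorem complexHessian_apply (u : Cn n → ℝ) (p : Cn n) (j k : Fin n) :
    complexHessian u p j k = leviForm (fderiv ℝ (fderiv ℝ u) p) (ex j) (ex k) := by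
  rw [leviForm_apply, I_smul_ex, I_smul_ex]
  rfl

theorem sum_smul_ex (v : Cn n) : ∑ j, v j • ex j = v := by
  ext k
  simp [ex, Pi.single_apply]

theorem leviForm_self {B : Cn n →L[ℝ] Cn n →L[ℝ] ℝ} (hB : ∀ v w, B v w = B w v) (v : Cn n) :
    leviForm B v v = (((B v v + B (Complex.I • v) (Complex.I • v)) / 4 : ℝ) : ℂ) := by
  rw [leviForm_apply, hB v (Complex.I • v)]
  push_cast
  ring

theorem I_smul_ne_smul {p : Cn n} (hp : p ≠ 0) (a : ℝ) : Complex.I • p ≠ a • p := by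
  intro h
  have h1 : (Complex.I - (a : ℂ)) • p = 0 := by
    rw [sub_smul, h, Complex.coe_smul, sub_self]
  have h2 := congrArg Complex.im ((smul_eq_zero.1 h1).resolve_right hp)
  simp at h2

/-- The Levi form at v is a quarter of B(v, v) + B(iv, iv). A nonzero v and iv cannot both be real
multiples of p, so positivity of B off the radial line, with nonnegativity on it, is enough. -/
theorem posDef_complexHessian {u : Cn n → ℝ} {p : Cn n} (hu : ContDiffAt ℝ 2 u p) (hp : p ≠ 0)
    (hpos : ∀ v : Cn n, (∀ a : ℝ, v ≠ a • p) → 0 < fderiv ℝ (fderiv ℝ u) p v v) :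
    (complexHessian u p).PosDef := by
  set B := fderiv ℝ (fderiv ℝ u) p with hBdef
  have hB : ∀ v w, B v w = B w v := fun v w =>
    (hu.isSymmSndFDerivAt (by simp)).eq v w
  have hnonneg : ∀ v, 0 ≤ B v v := by
    intro v
    by_cases hv : ∀ a : ℝ, v ≠ a • p
    · exact (hpos v hv).le
    push Not at hv
    obtain ⟨a, rfl⟩ := hv
    -- Nonnegativity in the radial direction is obtained as a limit from the nonradial vectors ap +
    -- t·ip.
    have hc : Tendsto (fun t : ℝ => B (a • p + t • Complex.I • p) (a • p + t • Complex.I • p))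
        (𝓝[≠] 0) (𝓝 (B (a • p) (a • p))) := by
      have : Continuous fun t : ℝ =>
          B (a • p + t • Complex.I • p) (a • p + t • Complex.I • p) := by fun_prop
      have h0 := this.tendsto 0
      rw [zero_smul, add_zero] at h0
      exact h0.mono_left nhdsWithin_le_nhds
    refine ge_of_tendsto hc ?_
    filter_upwards [self_mem_nhdsWithin] with t ht
    refine (hpos _ fun b hb => ?_).le
    have h1 : Complex.I • p = (t⁻¹ * (b - a)) • p := by
      rw [mul_smul, sub_smul, ← hb, add_sub_cancel_left, inv_smul_smul₀ ht]
    exact I_smul_ne_smul hp _ h1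
  refine Matrix.PosDef.of_dotProduct_mulVec_pos ?_ ?_
  · ext j k
    rw [Matrix.conjTranspose_apply, complexHessian_apply, complexHessian_apply, leviForm_apply,
      leviForm_apply]
    simp only [← hBdef, RCLike.star_def, map_div₀, map_add, map_mul, Complex.conj_ofReal,
      Complex.conj_I, map_ofNat]
    rw [hB (ex k), hB (Complex.I • ex k), hB (ex k), hB (Complex.I • ex k)]
    push_cast
    ring
  · intro x hx
    -- The first index of the complex Hessian carries the linear slot of the Levi form, so x*Hx is
    -- the form evaluated at the conjugate of x.
    set v : Cn n := WithLp.toLp 2 (star x) with hv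
    have hv0 : v ≠ 0 := by
      intro h0
      apply hx
      have : star x = 0 := by
        have := congrArg (WithLp.ofLp) h0
        simpa [hv] using this
      exact star_eq_zero.1 this
    have hquad : star x ⬝ᵥ (complexHessian u p).mulVec x = leviForm B v v := by
      conv_rhs => rw [← sum_smul_ex v]
      simp only [map_sum, LinearMap.sum_apply, map_smul, LinearMap.smul_apply, LinearMap.map_smulₛₗ,
        dotProduct, Matrix.mulVec, smul_eq_mul, complexHessian_apply, Finset.mul_sum]
      rw [Finset.sum_comm]
      refine Finset.sum_congr rfl fun j _ => Finset.sum_congr rfl fun k _ => ?_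
      simp [hv]
      ring
    rw [hquad, leviForm_self hB]
    rw [Complex.zero_lt_real]
    refine div_pos ?_ (by norm_num)
    by_cases hvp : ∀ a : ℝ, v ≠ a • p
    · exact add_pos_of_pos_of_nonneg (hpos v hvp) (hnonneg _)
    · push Not at hvp
      obtain ⟨a, ha⟩ := hvp
      have ha0 : a ≠ 0 := by
        rintro rfl
        exact hv0 (by rw [ha, zero_smul])
      refine add_pos_of_nonneg_of_pos (hnonneg _) (hpos _ fun b hb => ?_)
      rw [ha, smul_comm] at hb
      refine I_smul_ne_smul hp (a⁻¹ * b) ?_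
      rw [mul_smul, ← hb, inv_smul_smul₀ ha0]

section Homogeneous

theorem norm_smul_bilinear_le {X : Type*} [NormedAddCommGroup X] [NormedSpace ℝ X] (a : ℝ)
    (B : X →L[ℝ] X →L[ℝ] ℝ) : ‖a • B‖ ≤ |a| * ‖B‖ := by
  refine ContinuousLinearMap.opNorm_le_bound _ (by positivity) fun v => ?_
  rw [_root_.smul_apply, norm_smul, Real.norm_eq_abs, mul_assoc]
  exact mul_le_mul_of_nonneg_left (B.le_opNorm v) (abs_nonneg a)

variable {f : Cn n → ℝ}

theorem fderiv_fderiv_const_mul_comp_smul {X : Type*} [NormedAddCommGroup X] [NormedSpace ℝ X]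
    (f : X → ℝ) {a : ℝ} (ha : a ≠ 0) (z : X) :
    fderiv ℝ (fderiv ℝ fun z => a⁻¹ * f (a • z)) z = a • fderiv ℝ (fderiv ℝ f) (a • z) := by
  have h1 : (fderiv ℝ fun z => a⁻¹ * f (a • z)) = fun z => fderiv ℝ f (a • z) := by
    funext z
    have : (fun z => a⁻¹ * f (a • z)) = a⁻¹ • fun z => f (a • z) := rfl
    rw [this, fderiv_const_smul_field, Pi.smul_apply, fderiv_comp_smul, inv_smul_smul₀ ha]
  rw [h1, fderiv_comp_smul]

theorem complexHessian_const_mul_comp_smul (f : Cn n → ℝ) {a : ℝ} (ha : a ≠ 0) (z : Cn n) :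
    complexHessian (fun z => a⁻¹ * f (a • z)) z = (a : ℂ) • complexHessian f (a • z) := by
  ext j k
  simp only [complexHessian, fderiv_fderiv_const_mul_comp_smul f ha, Matrix.smul_apply,
    _root_.smul_apply, smul_eq_mul]
  push_cast
  ring

/-- This rescaling fixes functions homogeneous of degree one, so it makes the density of H
homogeneous of degree -n. It also relates the regularizations of H at different scales. -/
theorem smoothMongeAmpereDensity_const_mul_comp_smul (f : Cn n → ℝ) {a : ℝ} (ha : a ≠ 0)
    (z : Cn n) : smoothMongeAmpereDensity (fun z => a⁻¹ * f (a • z)) z =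
      a ^ n * smoothMongeAmpereDensity f (a • z) := by
  rw [smoothMongeAmpereDensity, complexHessian_const_mul_comp_smul f ha, Matrix.det_smul,
    Fintype.card_fin, ← Complex.ofReal_pow, Complex.re_ofReal_mul, smoothMongeAmpereDensity]
  ring

theorem continuousAt_complexHessian {u : Cn n → ℝ} {p : Cn n} (hu : ContDiffAt ℝ 2 u p) :
    ContinuousAt (complexHessian u) p := by
  have h1 : ContDiffAt ℝ 1 (fderiv ℝ u) p := hu.fderiv_right (by norm_num)
  have h2 : ContinuousAt (fderiv ℝ (fderiv ℝ u)) p :=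
    (h1.fderiv_right (m := 0) (by norm_num)).continuousAt
  have h3 : ∀ v w : Cn n, ContinuousAt (fun p => fderiv ℝ (fderiv ℝ u) p v w) p := fun v w =>
    (h2.clm_apply continuousAt_const).clm_apply continuousAt_const
  refine continuousAt_pi.2 fun j => continuousAt_pi.2 fun k => ?_
  have h4 : ∀ v w : Cn n, ContinuousAt (fun p => ((fderiv ℝ (fderiv ℝ u) p v w : ℝ) : ℂ)) p :=
    fun v w => Complex.continuous_ofReal.continuousAt.comp (h3 v w)
  simp only [complexHessian, Complex.ofReal_add, Complex.ofReal_sub]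
  exact (((h4 _ _).add (h4 _ _)).add (continuousAt_const.mul ((h4 _ _).sub (h4 _ _)))).div_const _

theorem continuousAt_smoothMongeAmpereDensity {u : Cn n → ℝ} {p : Cn n}
    (hu : ContDiffAt ℝ 2 u p) : ContinuousAt (smoothMongeAmpereDensity u) p := by
  have h1 := continuousAt_complexHessian hu
  have h2 : Continuous fun A : Matrix (Fin n) (Fin n) ℂ => A.det.re :=
    Complex.continuous_re.comp continuous_id.matrix_det
  exact continuousAt_const.mul (h2.continuousAt.comp h1)

theorem norm_complexHessian_apply_le (u : Cn n → ℝ) (p : Cn n) (j k : Fin n) :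
    ‖complexHessian u p j k‖ ≤ ‖fderiv ℝ (fderiv ℝ u) p‖ := by
  set B := fderiv ℝ (fderiv ℝ u) p with hB
  have hx : ∀ j : Fin n, ‖ex j‖ = 1 := fun j => by simp [ex]
  have hy : ∀ j : Fin n, ‖ey j‖ = 1 := fun j => by simp [ey]
  have hb : ∀ v w : Cn n, ‖v‖ = 1 → ‖w‖ = 1 → |B v w| ≤ ‖B‖ := fun v w hv hw => by
    simpa [hv, hw] using B.le_opNorm₂ v w
  have h1 := hb _ _ (hx j) (hx k)
  have h2 := hb _ _ (hy j) (hy k)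
  have h3 := hb _ _ (hx j) (hy k)
  have h4 := hb _ _ (hy j) (hx k)
  rw [complexHessian, norm_div]
  have h5 := norm_add_le (((B (ex j) (ex k) + B (ey j) (ey k) : ℝ) : ℂ))
    (Complex.I * ((B (ex j) (ey k) - B (ey j) (ex k) : ℝ) : ℂ))
  rw [norm_mul, Complex.norm_I, one_mul, Complex.norm_real, Complex.norm_real, Real.norm_eq_abs,
    Real.norm_eq_abs] at h5
  have h6 := abs_add_le (B (ex j) (ex k)) (B (ey j) (ey k))
  have h7 := abs_sub (B (ex j) (ey k)) (B (ey j) (ex k))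
  have h8 : ‖(4 : ℂ)‖ = 4 := by simp
  rw [h8, div_le_iff₀ (by norm_num)]
  linarith

theorem abs_smoothMongeAmpereDensity_le (u : Cn n → ℝ) (p : Cn n) :
    |smoothMongeAmpereDensity u p| ≤ (n.factorial : ℝ) / Real.pi ^ n *
      (n.factorial * ‖fderiv ℝ (fderiv ℝ u) p‖ ^ n) := by
  rw [smoothMongeAmpereDensity, abs_mul, abs_of_nonneg (by positivity)]
  gcongr
  refine (Complex.abs_re_le_norm _).trans ?_
  have := Matrix.det_le (abv := NormedField.toAbsoluteValue ℂ)
    (x := ‖fderiv ℝ (fderiv ℝ u) p‖) fun j k => norm_complexHessian_apply_le u p j k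
  rwa [Fintype.card_fin, nsmul_eq_mul] at this

end Homogeneous

section Support

variable {Ω : Set (Cn n)}

theorem supportFun_smul {a : ℝ} (ha : 0 ≤ a) (z : Cn n) :
    supportFun Ω (a • z) = a * supportFun Ω z := by
  simp only [supportFun_eq, map_smul, innerSupport_smul ha]

namespace IsBoundedStronglyConvexDomain

theorem contDiffAt_supportFun (h : IsBoundedStronglyConvexDomain Ω) {z : Cn n} (hz : z ≠ 0) :
    ContDiffAt ℝ 2 (supportFun Ω) z := by
  obtain ⟨U, ρ, hd⟩ := h.exists_definingData
  rw [supportFun_eq]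
  have h1 : conjCn n z ≠ 0 := by simpa using hz
  exact (hd.contDiffAt_innerSupport h1).comp z (conjCn n).contDiff.contDiffAt

theorem hessian_supportFun_pos (h : IsBoundedStronglyConvexDomain Ω) {z v : Cn n} (hz : z ≠ 0)
    (hv : ∀ a : ℝ, v ≠ a • z) : 0 < fderiv ℝ (fderiv ℝ (supportFun Ω)) z v v := by
  obtain ⟨U, ρ, hd⟩ := h.exists_definingData
  have h1 : conjCn n z ≠ 0 := by simpa using hz
  obtain ⟨κ, hκ, hgrow⟩ := hd.innerSupport_quadratic_growth h1 (v := conjCn n v) (fun a ha =>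
    hv a ((conjCn n).injective (by rw [ha, map_smul])))
  refine hessian_pos_of_quadratic_growth (h.contDiffAt_supportFun hz) hκ ?_
  refine hgrow.mono fun t ht => ?_
  have hf : fderiv ℝ (supportFun Ω) z v = fderiv ℝ (innerSupport Ω) (conjCn n z) (conjCn n v) := by
    have h2 := (hd.hasFDerivAt_innerSupport h1).comp z
      (conjCn n).toContinuousLinearEquiv.hasFDerivAt
    rw [supportFun_eq, (hd.hasFDerivAt_innerSupport h1).fderiv]
    exact congrArg (fun L => L v) h2.fderiv
  rw [hf, supportFun_eq]
  simpa using ht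

theorem continuous_supportFun (h : IsBoundedStronglyConvexDomain Ω) :
    Continuous (supportFun Ω) := by
  obtain ⟨U, ρ, hd⟩ := h.exists_definingData
  rw [supportFun_eq]
  exact hd.continuous_innerSupport.comp (conjCn n).continuous

theorem smoothMongeAmpereDensity_supportFun_pos (h : IsBoundedStronglyConvexDomain Ω) {z : Cn n}
    (hz : z ≠ 0) : 0 < smoothMongeAmpereDensity (supportFun Ω) z := by
  have := (posDef_complexHessian (h.contDiffAt_supportFun hz) hz
    fun v hv => h.hessian_supportFun_pos hz hv).det_pos
  have h2 := (Complex.lt_def.1 this).1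
  rw [smoothMongeAmpereDensity]
  simp only [Complex.zero_re] at h2
  positivity

theorem _root_.LaplaceBergman.supportFun_eq_inv_mul {a : ℝ} (ha : 0 < a) :
    supportFun Ω = fun z => a⁻¹ * supportFun Ω (a • z) := by
  funext z
  rw [supportFun_smul ha.le, inv_mul_cancel_left₀ ha.ne']

theorem _root_.LaplaceBergman.smoothMongeAmpereDensity_supportFun_smul {a : ℝ} (ha : 0 < a)
    (z : Cn n) : a ^ n * smoothMongeAmpereDensity (supportFun Ω) (a • z) =
      smoothMongeAmpereDensity (supportFun Ω) z := by
  conv_rhs => rw [supportFun_eq_inv_mul (Ω := Ω) ha]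
  rw [smoothMongeAmpereDensity_const_mul_comp_smul _ ha.ne']

theorem _root_.LaplaceBergman.fderiv_fderiv_supportFun_smul {a : ℝ} (ha : 0 < a) (z : Cn n) :
    a • fderiv ℝ (fderiv ℝ (supportFun Ω)) (a • z) = fderiv ℝ (fderiv ℝ (supportFun Ω)) z := by
  conv_rhs => rw [supportFun_eq_inv_mul (Ω := Ω) ha]
  rw [fderiv_fderiv_const_mul_comp_smul _ ha.ne']

theorem exists_norm_hessian_supportFun_le (h : IsBoundedStronglyConvexDomain Ω) :
    ∃ C > 0, ∀ z : Cn n, z ≠ 0 → ‖fderiv ℝ (fderiv ℝ (supportFun Ω)) z‖ ≤ C * ‖z‖⁻¹ := by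
  have hcont : ContinuousOn (fderiv ℝ (fderiv ℝ (supportFun Ω))) (Metric.sphere (0 : Cn n) 1) := by
    intro z hz
    have hz0 : z ≠ 0 := ne_zero_of_mem_unit_sphere (⟨z, hz⟩ : Metric.sphere (0 : Cn n) 1)
    have h1 : ContDiffAt ℝ 1 (fderiv ℝ (supportFun Ω)) z :=
      (h.contDiffAt_supportFun hz0).fderiv_right (by norm_num)
    exact (h1.fderiv_right (m := 0) (by norm_num)).continuousAt.continuousWithinAt
  obtain ⟨C, hC⟩ := (isCompact_sphere (0 : Cn n) 1).exists_bound_of_continuousOn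
    (f := fderiv ℝ (fderiv ℝ (supportFun Ω))) hcont
  refine ⟨|C| + 1, by positivity, fun z hz => ?_⟩
  have hz0 : 0 < ‖z‖ := norm_pos_iff.2 hz
  rw [← fderiv_fderiv_supportFun_smul (inv_pos.2 hz0) z]
  refine (norm_smul_bilinear_le _ _).trans ?_
  rw [abs_inv, abs_norm, mul_comm]
  gcongr
  refine (hC _ ?_).trans ((le_abs_self C).trans (by linarith))
  simp [norm_smul, hz0.ne']

/-- Homogeneity of degree -n reduces both bounds to the unit sphere, where the density is continuous
and positive. -/
theorem exists_smoothMongeAmpereDensity_supportFun_bounds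
    (h : IsBoundedStronglyConvexDomain Ω) : ∃ c C : ℝ, 0 < c ∧ 0 < C ∧ ∀ z : Cn n, z ≠ 0 →
      c * (‖z‖ ^ n)⁻¹ ≤ smoothMongeAmpereDensity (supportFun Ω) z ∧
      smoothMongeAmpereDensity (supportFun Ω) z ≤ C * (‖z‖ ^ n)⁻¹ := by
  have hne : ∀ z ∈ Metric.sphere (0 : Cn n) 1, z ≠ 0 := fun z hz =>
    ne_zero_of_mem_unit_sphere (⟨z, hz⟩ : Metric.sphere (0 : Cn n) 1)
  have hcont : ContinuousOn (smoothMongeAmpereDensity (supportFun Ω))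
      (Metric.sphere (0 : Cn n) 1) := fun z hz =>
    (continuousAt_smoothMongeAmpereDensity
      (h.contDiffAt_supportFun (hne z hz))).continuousWithinAt
  obtain ⟨C, hC⟩ := (isCompact_sphere (0 : Cn n) 1).exists_bound_of_continuousOn hcont
  obtain ⟨c, hc, hcle⟩ : ∃ c > 0, ∀ z ∈ Metric.sphere (0 : Cn n) 1,
      c ≤ smoothMongeAmpereDensity (supportFun Ω) z := by
    rcases (Metric.sphere (0 : Cn n) 1).eq_empty_or_nonempty with he | hnon
    · exact ⟨1, one_pos, fun z hz => by simp [he] at hz⟩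
    · obtain ⟨z0, hz0, hmin⟩ := (isCompact_sphere (0 : Cn n) 1).exists_isMinOn hnon hcont
      exact ⟨_, h.smoothMongeAmpereDensity_supportFun_pos (hne z0 hz0), fun z hz => hmin hz⟩
  refine ⟨c, |C| + 1, hc, by positivity, fun z hz => ?_⟩
  have hz0 : 0 < ‖z‖ := norm_pos_iff.2 hz
  have hmem : ‖z‖⁻¹ • z ∈ Metric.sphere (0 : Cn n) 1 := by simp [norm_smul, hz0.ne']
  rw [← smoothMongeAmpereDensity_supportFun_smul (inv_pos.2 hz0) z, inv_pow, mul_comm _ (_⁻¹),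
    mul_comm _ (_⁻¹)]
  refine ⟨by gcongr; exact hcle _ hmem, ?_⟩
  gcongr
  exact (le_abs_self _).trans ((hC _ hmem).trans ((le_abs_self C).trans (by linarith)))

end IsBoundedStronglyConvexDomain

end Support

end ComplexHessian

end LaplaceBergman
end

noncomputable section

namespace LaplaceBergman

/-! ### Regularizations of the support function -/

section Mollification

section General

variable {X F : Type*} [NormedAddCommGroup X] [NormedSpace ℝ X] [FiniteDimensional ℝ X]
  [MeasurableSpace X] [BorelSpace X] [NormedAddCommGroup F] [NormedSpace ℝ F]
  {χ : X → ℝ} {f : X → F} {V : Set X}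

omit [NormedSpace ℝ X] [FiniteDimensional ℝ X] [MeasurableSpace X] [BorelSpace X] in
theorem continuous_smul_comp_of_tsupport (hχ : Continuous χ) (hV : IsOpen V)
    (hf : ContinuousOn f V) {φ : X → X} (hφ : Continuous φ) (hx : ∀ w ∈ tsupport χ, φ w ∈ V) :
    Continuous fun w => χ w • f (φ w) := by
  refine continuous_of_tsupport fun w hw => ?_
  have hw' : w ∈ tsupport χ := closure_mono (Function.support_smul_subset_left _ _) hw
  exact hχ.continuousAt.smul ((hf.continuousAt (hV.mem_nhds (hx w hw'))).comp hφ.continuousAt)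

/-- Differentiation of a convolution under the integral sign, when the second factor is
differentiable near the relevant points only. -/
theorem hasFDerivAt_integral_smul_comp_sub {μ : Measure X} [IsFiniteMeasureOnCompacts μ]
    {f' : X → X →L[ℝ] F} (hχ : Continuous χ) (hχc : HasCompactSupport χ) (hV : IsOpen V)
    (hf : ∀ x ∈ V, HasFDerivAt f (f' x) x) (hf' : ContinuousOn f' V)
    {x : X} (hx : ∀ w ∈ tsupport χ, x - w ∈ V) :
    HasFDerivAt (fun x => ∫ w, χ w • f (x - w) ∂μ) (∫ w, χ w • f' (x - w) ∂μ) x := by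
  have hprop := FiniteDimensional.proper ℝ X
  have hfc : ContinuousOn f V := fun y hy => (hf y hy).continuousAt.continuousWithinAt
  -- Only the values of f near this compact set matter. A closed thickening of it stays inside V,
  -- and the bound of f' there provides the dominating function.
  set K := (fun w => x - w) '' tsupport χ with hK
  have hKc : IsCompact K := IsCompact.image hχc (by fun_prop)
  have hKV : K ⊆ V := by
    rintro _ ⟨w, hw, rfl⟩
    exact hx w hw
  obtain ⟨δ, hδ, hδV⟩ := hKc.exists_cthickening_subset_open hV hKV
  obtain ⟨M, hM⟩ := (hKc.cthickening (r := δ)).exists_bound_of_continuousOn (hf'.mono hδV)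
  have hmem : ∀ y ∈ Metric.ball x δ, ∀ w ∈ tsupport χ, y - w ∈ Metric.cthickening δ K := by
    intro y hy w hw
    refine Metric.mem_cthickening_of_dist_le _ (x - w) δ K ⟨w, hw, rfl⟩ ?_
    rw [dist_sub_right]
    exact (Metric.mem_ball.1 hy).le
  refine (hasFDerivAt_integral_of_dominated_of_fderiv_le (F := fun x w => χ w • f (x - w))
    (F' := fun x w => χ w • f' (x - w)) (bound := fun w => |χ w| * M)
    (Metric.ball_mem_nhds x hδ) ?_ ?_ ?_ ?_ ?_ ?_)
  · filter_upwards [Metric.ball_mem_nhds x hδ] with y hy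
    exact (continuous_smul_comp_of_tsupport hχ hV hfc (continuous_const.sub continuous_id)
      fun w hw => hδV (hmem y hy w hw)).aestronglyMeasurable
  · exact (continuous_smul_comp_of_tsupport hχ hV hfc (continuous_const.sub continuous_id)
      hx).integrable_of_hasCompactSupport hχc.smul_right
  · exact (continuous_smul_comp_of_tsupport hχ hV hf' (continuous_const.sub continuous_id) hx).aestronglyMeasurable
  · refine Eventually.of_forall fun w y hy => ?_
    by_cases hw : w ∈ tsupport χ
    · rw [norm_smul, Real.norm_eq_abs]
      exact mul_le_mul_of_nonneg_left (hM _ (hmem y hy w hw)) (abs_nonneg _)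
    · simp [image_eq_zero_of_notMem_tsupport hw]
  · have : HasCompactSupport fun w => |χ w| * M :=
      (hχc.comp_left (g := fun t : ℝ => |t|) abs_zero).mul_right
    exact (hχ.abs.mul continuous_const).integrable_of_hasCompactSupport this
  · refine Eventually.of_forall fun w y hy => ?_
    by_cases hw : w ∈ tsupport χ
    · have h1 := hf _ (hδV (hmem y hy w hw))
      have h2 : HasFDerivAt (fun y => y - w) (ContinuousLinearMap.id ℝ X) y :=
        (hasFDerivAt_id y).sub_const w
      exact (h1.comp y h2).const_smul (χ w)
    · simp only [image_eq_zero_of_notMem_tsupport hw, zero_smul]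
      exact hasFDerivAt_const _ _

omit [NormedSpace ℝ X] [FiniteDimensional ℝ X] in
theorem norm_integral_smul_sub_le [CompleteSpace F] {μ : Measure X}
    [IsFiniteMeasureOnCompacts μ] (hχ : Continuous χ) (hχc : HasCompactSupport χ)
    (hχ0 : ∀ w, 0 ≤ χ w) (hχ1 : ∫ w, χ w ∂μ = 1) {g : X → F} {a : F} {C : ℝ}
    (hg : Continuous fun w => χ w • g w) (hC : ∀ w ∈ tsupport χ, ‖g w - a‖ ≤ C) :
    ‖(∫ w, χ w • g w ∂μ) - a‖ ≤ C := by
  have hχi : Integrable χ μ := hχ.integrable_of_hasCompactSupport hχc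
  have h1 : a = ∫ w, χ w • a ∂μ := by rw [integral_smul_const, hχ1, one_smul]
  have h2 : (∫ w, χ w • g w ∂μ) - a = ∫ w, χ w • (g w - a) ∂μ := by
    conv_lhs => rw [h1]
    rw [← integral_sub (hg.integrable_of_hasCompactSupport hχc.smul_right) (hχi.smul_const a)]
    simp only [smul_sub]
  rw [h2]
  calc ‖∫ w, χ w • (g w - a) ∂μ‖ ≤ ∫ w, χ w * C ∂μ := by
        refine norm_integral_le_of_norm_le (hχi.mul_const C) (Eventually.of_forall fun w => ?_)
        rw [norm_smul, Real.norm_eq_abs, abs_of_nonneg (hχ0 w)]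
        by_cases hw : w ∈ tsupport χ
        · exact mul_le_mul_of_nonneg_left (hC w hw) (hχ0 w)
        · simp [image_eq_zero_of_notMem_tsupport hw]
    _ = C := by rw [integral_mul_const, hχ1, one_mul]

end General

variable {n : ℕ} {Ω : Set (Cn n)} {χ : Cn n → ℝ}

/-- By homogeneity, regularizing at scale ε is a dilation of regularizing at scale one, so estimates
at scale one become uniform in ε. The factor is written (ε⁻¹)⁻¹ to fit the scaling lemmas with a =
ε⁻¹. -/
theorem mollify_supportFun_eq {ε : ℝ} (hε : 0 < ε) :
    mollify χ (supportFun Ω) ε =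
      fun z => (ε⁻¹)⁻¹ * mollify χ (supportFun Ω) 1 (ε⁻¹ • z) := by
  funext z
  rw [mollify, mollify, ← integral_const_mul]
  refine integral_congr_ae (Eventually.of_forall fun w => ?_)
  have h1 : z - ε • w = ε • (ε⁻¹ • z - (1 : ℝ) • w) := by
    rw [smul_sub, smul_inv_smul₀ hε.ne', one_smul]
  simp only [inv_inv]
  rw [h1, supportFun_smul hε.le]
  ring

theorem contDiff_mollify_supportFun (h : IsBoundedStronglyConvexDomain Ω) (hχ : IsMollifier χ) :
    ContDiff ℝ 2 (mollify χ (supportFun Ω) 1) := by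
  have h1 : mollify χ (supportFun Ω) 1 =
      MeasureTheory.convolution χ (supportFun Ω) (ContinuousLinearMap.mul ℝ ℝ) volume := by
    funext z
    simp [mollify, convolution]
  rw [h1]
  exact_mod_cast contDiff_infty.1 (hχ.hasCompactSupport.contDiff_convolution_left _ hχ.contDiff
    h.continuous_supportFun.locallyIntegrable) 2

theorem IsMollifier.exists_radius (hχ : IsMollifier χ) :
    ∃ R > 0, ∀ w ∈ tsupport χ, ‖w‖ ≤ R := by
  obtain ⟨R, hR⟩ := IsCompact.exists_bound_of_continuousOn (s := tsupport χ) (f := id)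
    hχ.hasCompactSupport continuousOn_id
  exact ⟨|R| + 1, by positivity, fun w hw => (hR w hw).trans ((le_abs_self R).trans (by linarith))⟩

theorem IsBoundedStronglyConvexDomain.contDiffOn_supportFun
    (h : IsBoundedStronglyConvexDomain Ω) : ContDiffOn ℝ 2 (supportFun Ω) {0}ᶜ := fun _ hz =>
  (h.contDiffAt_supportFun hz).contDiffWithinAt

theorem IsBoundedStronglyConvexDomain.continuousOn_hessian_supportFun
    (h : IsBoundedStronglyConvexDomain Ω) :
    ContinuousOn (fderiv ℝ (fderiv ℝ (supportFun Ω))) {0}ᶜ :=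
  ((h.contDiffOn_supportFun.fderiv_of_isOpen (m := 1) isOpen_compl_singleton
    (by norm_num)).fderiv_of_isOpen (m := 0) isOpen_compl_singleton (by norm_num)).continuousOn

theorem sub_ne_zero_of_norm_lt {R : ℝ} {z w : Cn n} (hw : ‖w‖ ≤ R) (hz : R < ‖z‖) :
    z - w ∈ ({0}ᶜ : Set (Cn n)) := by
  intro h0
  rw [mem_singleton_iff, sub_eq_zero] at h0
  rw [h0] at hz
  linarith

/-- Beyond the radius of the kernel the averaging does not meet the origin, the only singularity of
H, so both derivatives pass under the integral. -/
theorem hessian_mollify_supportFun (h : IsBoundedStronglyConvexDomain Ω) (hχ : IsMollifier χ)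
    {R : ℝ} (hR : ∀ w ∈ tsupport χ, ‖w‖ ≤ R) {z : Cn n} (hz : R < ‖z‖) :
    fderiv ℝ (fderiv ℝ (mollify χ (supportFun Ω) 1)) z =
      ∫ w, χ w • fderiv ℝ (fderiv ℝ (supportFun Ω)) (z - w) := by
  have hd : ∀ x ∈ ({0}ᶜ : Set (Cn n)), HasFDerivAt (supportFun Ω) (fderiv ℝ (supportFun Ω) x) x :=
    fun x hx => ((h.contDiffAt_supportFun hx).differentiableAt (by norm_num)).hasFDerivAt
  have hdc : ContinuousOn (fderiv ℝ (supportFun Ω)) {0}ᶜ :=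
    (h.contDiffOn_supportFun.fderiv_of_isOpen (m := 1) isOpen_compl_singleton
      (by norm_num)).continuousOn
  have hdd : ∀ x ∈ ({0}ᶜ : Set (Cn n)), HasFDerivAt (fderiv ℝ (supportFun Ω))
      (fderiv ℝ (fderiv ℝ (supportFun Ω)) x) x :=
    fun x hx => (h.contDiffAt_supportFun hx).hasFDerivAt_fderiv
  have hm : mollify χ (supportFun Ω) 1 = fun z => ∫ w, χ w • supportFun Ω (z - w) := by
    funext z
    simp [mollify]
  have hev : fderiv ℝ (mollify χ (supportFun Ω) 1) =ᶠ[𝓝 z]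
      fun z => ∫ w, χ w • fderiv ℝ (supportFun Ω) (z - w) := by
    have : ∀ᶠ y in 𝓝 z, R < ‖y‖ := continuous_norm.continuousAt.eventually (lt_mem_nhds hz)
    filter_upwards [this] with y hy
    rw [hm]
    exact (hasFDerivAt_integral_smul_comp_sub hχ.contDiff.continuous hχ.hasCompactSupport
      isOpen_compl_singleton hd hdc fun w hw => sub_ne_zero_of_norm_lt (hR w hw) hy).fderiv
  rw [hev.fderiv_eq]
  exact (hasFDerivAt_integral_smul_comp_sub hχ.contDiff.continuous hχ.hasCompactSupport
    isOpen_compl_singleton hdd h.continuousOn_hessian_supportFun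
    fun w hw => sub_ne_zero_of_norm_lt (hR w hw) hz).fderiv

/-- For ‖z‖ ≥ 2R the Hessian is an average of Hessians of H at points of norm at least ‖z‖/2. For
‖z‖ ≤ 2R it is bounded by continuity, and ‖z‖⁻¹ is bounded below. -/
theorem exists_norm_hessian_mollify_supportFun_le (h : IsBoundedStronglyConvexDomain Ω)
    (hχ : IsMollifier χ) : ∃ C > 0, ∀ z : Cn n, z ≠ 0 →
      ‖fderiv ℝ (fderiv ℝ (mollify χ (supportFun Ω) 1)) z‖ ≤ C * ‖z‖⁻¹ := by
  obtain ⟨R, hR0, hR⟩ := hχ.exists_radius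
  obtain ⟨C, hC, hCle⟩ := h.exists_norm_hessian_supportFun_le
  have hcont : Continuous (fderiv ℝ (fderiv ℝ (mollify χ (supportFun Ω) 1))) :=
    ((contDiff_mollify_supportFun h hχ).fderiv_right (m := 1) (by norm_num)).continuous_fderiv
      (by norm_num)
  obtain ⟨M, hM⟩ := (isCompact_closedBall (0 : Cn n) (2 * R)).exists_bound_of_continuousOn
    (f := fderiv ℝ (fderiv ℝ (mollify χ (supportFun Ω) 1))) hcont.continuousOn
  refine ⟨|M| * (2 * R) + 2 * C, by positivity, fun z hz => ?_⟩
  have hz0 : 0 < ‖z‖ := norm_pos_iff.2 hz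
  rw [← div_eq_mul_inv, le_div_iff₀ hz0]
  rcases le_total ‖z‖ (2 * R) with hle | hle
  · have h1 := (hM z (by simpa using hle)).trans (le_abs_self M)
    have h2 : ‖fderiv ℝ (fderiv ℝ (mollify χ (supportFun Ω) 1)) z‖ * ‖z‖ ≤ |M| * (2 * R) := by
      gcongr
    linarith
  · rw [hessian_mollify_supportFun h hχ hR (by linarith)]
    have hbd : ‖(∫ w, χ w • fderiv ℝ (fderiv ℝ (supportFun Ω)) (z - w)) - 0‖ ≤
        C * (‖z‖ / 2)⁻¹ := by
      refine norm_integral_smul_sub_le hχ.contDiff.continuous hχ.hasCompactSupport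
        hχ.nonneg hχ.integral_eq_one ?_ ?_
      · exact continuous_smul_comp_of_tsupport (F := Cn n →L[ℝ] Cn n →L[ℝ] ℝ)
          hχ.contDiff.continuous isOpen_compl_singleton h.continuousOn_hessian_supportFun
          (continuous_const.sub continuous_id)
          fun w hw => sub_ne_zero_of_norm_lt (hR w hw) (by linarith)
      · intro w hw
        rw [sub_zero]
        refine (hCle _ (sub_ne_zero_of_norm_lt (hR w hw) (by linarith))).trans ?_
        have := norm_sub_norm_le z w
        have := hR w hw
        gcongr
        linarith
    rw [sub_zero] at hbd
    calc _ ≤ C * (‖z‖ / 2)⁻¹ * ‖z‖ := by gcongr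
      _ = 2 * C := by field_simp
      _ ≤ _ := by
        have : 0 ≤ |M| * (2 * R) := by positivity
        linarith

/-- The powers of ε coming from the dilation and from the Hessian bound cancel, which gives one
dominating function for all ε. -/
theorem exists_abs_density_mollify_supportFun_le (h : IsBoundedStronglyConvexDomain Ω)
    (hχ : IsMollifier χ) : ∃ C > 0, ∀ ε > 0, ∀ z : Cn n, z ≠ 0 →
      |smoothMongeAmpereDensity (mollify χ (supportFun Ω) ε) z| ≤ C * (‖z‖ ^ n)⁻¹ := by
  obtain ⟨C, hC, hCle⟩ := exists_norm_hessian_mollify_supportFun_le h hχ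
  refine ⟨(n.factorial : ℝ) / Real.pi ^ n * (n.factorial * C ^ n), by positivity,
    fun ε hε z hz => ?_⟩
  have hz0 : 0 < ‖z‖ := norm_pos_iff.2 hz
  have hε' : 0 < ε⁻¹ := inv_pos.2 hε
  rw [mollify_supportFun_eq hε, smoothMongeAmpereDensity_const_mul_comp_smul _ hε'.ne', abs_mul,
    abs_of_nonneg (by positivity)]
  have h1 := abs_smoothMongeAmpereDensity_le (mollify χ (supportFun Ω) 1) (ε⁻¹ • z)
  have h2 := hCle (ε⁻¹ • z) (smul_ne_zero hε'.ne' hz)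
  rw [norm_smul, Real.norm_eq_abs, abs_of_pos hε'] at h2
  calc ε⁻¹ ^ n * |smoothMongeAmpereDensity (mollify χ (supportFun Ω) 1) (ε⁻¹ • z)|
      ≤ ε⁻¹ ^ n * ((n.factorial : ℝ) / Real.pi ^ n *
        (n.factorial * (C * (ε⁻¹ * ‖z‖)⁻¹) ^ n)) := by
        refine mul_le_mul_of_nonneg_left (h1.trans ?_) (by positivity)
        gcongr
    _ = _ := by
        rw [mul_inv, inv_inv, mul_pow, mul_pow, inv_pow, inv_pow]
        field_simp

theorem smul_integral_smul_eq {X F : Type*} [MeasurableSpace X] [NormedAddCommGroup F]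
    [NormedSpace ℝ F] {μ : Measure X} (a : ℝ) (f : X → ℝ) {g g' : X → F}
    (hg : ∀ x, a • g x = g' x) : a • ∫ x, f x • g x ∂μ = ∫ x, f x • g' x ∂μ := by
  rw [← integral_smul]
  simp only [← hg, smul_comm a]

theorem tendsto_hessian_mollify_supportFun (h : IsBoundedStronglyConvexDomain Ω)
    (hχ : IsMollifier χ) {z : Cn n} (hz : z ≠ 0) :
    Tendsto (fun ε : ℝ => fderiv ℝ (fderiv ℝ (mollify χ (supportFun Ω) ε)) z) (𝓝[>] 0)
      (𝓝 (fderiv ℝ (fderiv ℝ (supportFun Ω)) z)) := by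
  obtain ⟨R, hR0, hR⟩ := hχ.exists_radius
  have hz0 : 0 < ‖z‖ := norm_pos_iff.2 hz
  set B := fderiv ℝ (fderiv ℝ (supportFun Ω)) with hB
  refine (tendsto_iff_norm_sub_tendsto_zero (E := Cn n →L[ℝ] Cn n →L[ℝ] ℝ)).2 ?_
  rw [Metric.tendsto_nhds]
  intro η hη
  have hcont : ContinuousAt B z :=
    h.continuousOn_hessian_supportFun.continuousAt (isOpen_compl_singleton.mem_nhds hz)
  obtain ⟨δ, hδ, hδB⟩ := (Metric.continuousAt_iff (α := Cn n)
    (β := Cn n →L[ℝ] Cn n →L[ℝ] ℝ)).1 hcont (η / 2) (half_pos hη)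
  -- The first bound keeps the averaging points where the Hessian is within η / 2 of its value at z;
  -- the second keeps them away from the origin.
  have hsmall : ∀ᶠ ε in 𝓝[>] (0 : ℝ), ε < min (δ / R) (‖z‖ / R) :=
    (gt_mem_nhds (lt_min (by positivity) (by positivity))).filter_mono nhdsWithin_le_nhds
  filter_upwards [hsmall, self_mem_nhdsWithin] with ε hε1 hε
  have hε : 0 < ε := hε
  have hεδ : ε * R < δ := (lt_div_iff₀ hR0).1 (hε1.trans_le (min_le_left _ _))
  have hεz : ε * R < ‖z‖ := (lt_div_iff₀ hR0).1 (hε1.trans_le (min_le_right _ _))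
  have hε' : 0 < ε⁻¹ := inv_pos.2 hε
  have hbig : R < ‖ε⁻¹ • z‖ := by
    rw [norm_smul, Real.norm_eq_abs, abs_of_pos hε', inv_mul_eq_div, lt_div_iff₀ hε]
    linarith
  have hne : ∀ w ∈ tsupport χ, ε⁻¹ • z - w ∈ ({0}ᶜ : Set (Cn n)) := fun w hw =>
    sub_ne_zero_of_norm_lt (hR w hw) hbig
  have hscale : ∀ w, ε⁻¹ • B (ε⁻¹ • z - w) = B (z - ε • w) := by
    intro w
    rw [hB, ← fderiv_fderiv_supportFun_smul hε' (z - ε • w), smul_sub, inv_smul_smul₀ hε.ne']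
  have heq : fderiv ℝ (fderiv ℝ (mollify χ (supportFun Ω) ε)) z =
      ∫ w, χ w • B (z - ε • w) := by
    rw [mollify_supportFun_eq hε, fderiv_fderiv_const_mul_comp_smul _ hε'.ne',
      hessian_mollify_supportFun h hχ hR hbig]
    exact smul_integral_smul_eq (F := Cn n →L[ℝ] Cn n →L[ℝ] ℝ) ε⁻¹ χ hscale
  have hcont' : Continuous fun w => χ w • B (z - ε • w) := by
    refine continuous_smul_comp_of_tsupport (F := Cn n →L[ℝ] Cn n →L[ℝ] ℝ)
      (φ := fun w => z - ε • w) hχ.contDiff.continuous isOpen_compl_singleton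
      h.continuousOn_hessian_supportFun (by fun_prop) fun w hw h0 => hne w hw ?_
    rw [mem_singleton_iff] at h0 ⊢
    rw [← inv_smul_smul₀ hε.ne' w, ← smul_sub, h0, smul_zero]
  rw [heq]
  refine (dist_zero_right _).trans_lt ?_
  refine (norm_norm (E := Cn n →L[ℝ] Cn n →L[ℝ] ℝ) _).trans_lt ?_
  refine (norm_integral_smul_sub_le hχ.contDiff.continuous hχ.hasCompactSupport
    hχ.nonneg hχ.integral_eq_one hcont' (C := η / 2) ?_).trans_lt (half_lt_self hη)
  intro w hw
  rw [← dist_eq_norm]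
  refine (hδB ?_).le
  rw [dist_eq_norm, sub_sub_cancel_left, norm_neg, norm_smul, Real.norm_eq_abs, abs_of_pos hε]
  exact (mul_le_mul_of_nonneg_left (hR w hw) hε.le).trans_lt hεδ

theorem tendsto_density_mollify_supportFun (h : IsBoundedStronglyConvexDomain Ω)
    (hχ : IsMollifier χ) {z : Cn n} (hz : z ≠ 0) :
    Tendsto (fun ε : ℝ => smoothMongeAmpereDensity (mollify χ (supportFun Ω) ε) z) (𝓝[>] 0)
      (𝓝 (smoothMongeAmpereDensity (supportFun Ω) z)) := by
  have hB := tendsto_hessian_mollify_supportFun h hχ hz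
  have hlin : ∀ v w : Cn n, Tendsto (fun ε : ℝ =>
      ((fderiv ℝ (fderiv ℝ (mollify χ (supportFun Ω) ε)) z v w : ℝ) : ℂ)) (𝓝[>] 0)
      (𝓝 ((fderiv ℝ (fderiv ℝ (supportFun Ω)) z v w : ℝ) : ℂ)) := fun v w =>
    (Complex.continuous_ofReal.tendsto _).comp
      (((by fun_prop : Continuous fun B : Cn n →L[ℝ] Cn n →L[ℝ] ℝ => B v w).tendsto _).comp hB)
  have hH : Tendsto (fun ε : ℝ => complexHessian (mollify χ (supportFun Ω) ε) z) (𝓝[>] 0)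
      (𝓝 (complexHessian (supportFun Ω) z)) := by
    refine tendsto_pi_nhds.2 fun j => tendsto_pi_nhds.2 fun k => ?_
    simp only [complexHessian, Complex.ofReal_add, Complex.ofReal_sub]
    exact (((hlin _ _).add (hlin _ _)).add
      (((hlin _ _).sub (hlin _ _)).const_mul _)).div_const _
  have hdet : Continuous fun A : Matrix (Fin n) (Fin n) ℂ => A.det.re :=
    Complex.continuous_re.comp continuous_id.matrix_det
  exact ((hdet.tendsto _).comp hH).const_mul _

end Mollification

end LaplaceBergman
end

noncomputable section

namespace LaplaceBergman

/-! ### The Monge–Ampère measure of the support function -/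

section MongeAmpere

variable {n : ℕ} {Ω : Set (Cn n)}

theorem finrank_real_Cn (n : ℕ) : Module.finrank ℝ (Cn n) = 2 * n := by
  rw [← Module.finrank_mul_finrank ℝ ℂ (Cn n), Complex.finrank_real_complex,
    finrank_euclideanSpace_fin]

theorem nontrivial_Cn (hn : 1 ≤ n) : Nontrivial (Cn n) := by
  have : Nonempty (Fin n) := ⟨⟨0, hn⟩⟩
  exact Module.nontrivial_of_finrank_pos (R := ℝ) (by rw [finrank_real_Cn]; omega)

/-- In polar coordinates in real dimension 2n the integrand becomes r^(2n-1) r^(-n) = r^(n-1). -/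
theorem integrableOn_inv_norm_pow (hn : 1 ≤ n) (r : ℝ) :
    IntegrableOn (fun z : Cn n => (‖z‖ ^ n)⁻¹) (Metric.ball 0 r) := by
  have := nontrivial_Cn hn
  rw [integrableOn_fun_norm_addHaar volume (f := fun y : ℝ => (y ^ n)⁻¹), finrank_real_Cn]
  have h1 : IntegrableOn (fun y : ℝ => y ^ (n - 1)) (Ioo 0 r) :=
    ((continuous_pow (n - 1)).integrableOn_Icc (a := 0) (b := r)).mono_set Ioo_subset_Icc_self
  refine h1.congr_fun (fun y hy => ?_) measurableSet_Ioo
  have hy0 : y ≠ 0 := hy.1.ne'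
  simp only [smul_eq_mul]
  rw [eq_mul_inv_iff_mul_eq₀ (pow_ne_zero _ hy0), ← pow_add]
  congr 1
  omega

/-- The Monge–Ampère measure of the support function: it has no atom at the origin. -/
def supportMongeAmpere (Ω : Set (Cn n)) : Measure (Cn n) :=
  volume.withDensity fun z => ENNReal.ofReal (smoothMongeAmpereDensity (supportFun Ω) z)

theorem ae_ne_zero (hn : 1 ≤ n) : ∀ᵐ z : Cn n, z ≠ 0 := by
  have := nontrivial_Cn hn
  exact Measure.ae_ne volume 0

theorem IsBoundedStronglyConvexDomain.aemeasurable_density (h : IsBoundedStronglyConvexDomain Ω)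
    (hn : 1 ≤ n) : AEMeasurable (smoothMongeAmpereDensity (supportFun Ω)) := by
  have := nontrivial_Cn hn
  have hc : ContinuousOn (smoothMongeAmpereDensity (supportFun Ω)) {0}ᶜ := fun z hz =>
    (continuousAt_smoothMongeAmpereDensity (h.contDiffAt_supportFun hz)).continuousWithinAt
  have := hc.aemeasurable (μ := volume) (measurableSet_singleton 0).compl
  rwa [Measure.restrict_eq_self_of_ae_mem (s := ({0}ᶜ : Set (Cn n))) (ae_ne_zero hn)] at this

theorem isFiniteMeasureOnCompacts_supportMongeAmpere (h : IsBoundedStronglyConvexDomain Ω)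
    (hn : 1 ≤ n) : IsFiniteMeasureOnCompacts (supportMongeAmpere Ω) := by
  obtain ⟨c, C, hc, hC, hbd⟩ := h.exists_smoothMongeAmpereDensity_supportFun_bounds
  refine ⟨fun K hK => ?_⟩
  obtain ⟨r, hr⟩ := hK.isBounded.subset_ball 0
  refine (measure_mono hr).trans_lt ?_
  rw [supportMongeAmpere, withDensity_apply _ measurableSet_ball]
  have hint := (integrableOn_inv_norm_pow hn r).const_mul C
  refine lt_of_le_of_lt (lintegral_mono_ae ?_) hint.lintegral_lt_top
  filter_upwards [ae_restrict_of_ae (ae_ne_zero hn)] with z hz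
  exact ENNReal.ofReal_le_ofReal (hbd z hz).2

theorem continuous_density_mollify (h : IsBoundedStronglyConvexDomain Ω) {χ : Cn n → ℝ}
    (hχ : IsMollifier χ) {ε : ℝ} (hε : 0 < ε) :
    Continuous (smoothMongeAmpereDensity (mollify χ (supportFun Ω) ε)) := by
  refine continuous_iff_continuousAt.2 fun z => continuousAt_smoothMongeAmpereDensity ?_
  rw [mollify_supportFun_eq hε]
  exact ((contDiff_const (c := (ε⁻¹)⁻¹)).mul ((contDiff_mollify_supportFun h hχ).comp
    (contDiff_const_smul ε⁻¹))).contDiffAt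

/-- The Monge–Ampère measure of the support function exists and is absolutely continuous. -/
theorem isMongeAmpereMeasure_supportMongeAmpere (h : IsBoundedStronglyConvexDomain Ω)
    (hn : 1 ≤ n) : IsMongeAmpereMeasure (supportFun Ω) (supportMongeAmpere Ω) := by
  refine ⟨isFiniteMeasureOnCompacts_supportMongeAmpere h hn, fun χ hχ ψ hψ hψc => ?_⟩
  have hM : ∫ z, ψ z ∂(supportMongeAmpere Ω) =
      ∫ z, ψ z * smoothMongeAmpereDensity (supportFun Ω) z := by
    rw [supportMongeAmpere, integral_withDensity_eq_integral_toReal_smul₀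
      (h.aemeasurable_density hn).ennreal_ofReal (Eventually.of_forall fun z =>
        ENNReal.ofReal_lt_top)]
    refine integral_congr_ae ?_
    filter_upwards [ae_ne_zero hn] with z hz
    rw [ENNReal.toReal_ofReal (h.smoothMongeAmpereDensity_supportFun_pos hz).le, smul_eq_mul,
      mul_comm]
  rw [hM]
  obtain ⟨C, hC, hCle⟩ := exists_abs_density_mollify_supportFun_le h hχ
  obtain ⟨r, hr⟩ := (IsCompact.isBounded hψc).subset_ball 0
  obtain ⟨M, hM⟩ := hψ.bounded_above_of_compact_support hψc
  -- The dominating function, independent of ε; its integrability at the origin is what excludes an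
  -- atom in the limit.
  have hint : Integrable ((Metric.ball 0 r).indicator fun z : Cn n => M * (C * (‖z‖ ^ n)⁻¹)) :=
    (integrable_indicator_iff measurableSet_ball).2
      (((integrableOn_inv_norm_pow hn r).const_mul C).const_mul M)
  refine tendsto_integral_filter_of_dominated_convergence _ ?_ ?_ hint ?_
  · filter_upwards [self_mem_nhdsWithin] with ε hε
    exact (hψ.mul (continuous_density_mollify h hχ hε)).aestronglyMeasurable
  · filter_upwards [self_mem_nhdsWithin] with ε hε
    filter_upwards [ae_ne_zero hn] with z hz
    by_cases hzr : z ∈ Metric.ball (0 : Cn n) r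
    · rw [indicator_of_mem hzr, norm_mul, Real.norm_eq_abs (smoothMongeAmpereDensity _ _)]
      exact mul_le_mul (hM z) (hCle ε hε z hz) (abs_nonneg _) ((norm_nonneg _).trans (hM z))
    · rw [indicator_of_notMem hzr,
        image_eq_zero_of_notMem_tsupport fun hz' => hzr (hr hz'), zero_mul, norm_zero]
  · filter_upwards [ae_ne_zero hn] with z hz
    exact (tendsto_density_mollify_supportFun h hχ hz).const_mul _

theorem isMongeAmpereMeasure_mongeAmpere (h : IsBoundedStronglyConvexDomain Ω) (hn : 1 ≤ n) :
    IsMongeAmpereMeasure (supportFun Ω) (mongeAmpere (supportFun Ω)) := by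
  have hex : ∃ M, IsMongeAmpereMeasure (supportFun Ω) M :=
    ⟨_, isMongeAmpereMeasure_supportMongeAmpere h hn⟩
  rw [mongeAmpere, dif_pos hex]
  exact hex.choose_spec

theorem mongeAmpere_supportFun (h : IsBoundedStronglyConvexDomain Ω) (hn : 1 ≤ n) :
    mongeAmpere (supportFun Ω) = supportMongeAmpere Ω :=
  (isMongeAmpereMeasure_mongeAmpere h hn).unique (isMongeAmpereMeasure_supportMongeAmpere h hn)

end MongeAmpere

end LaplaceBergman
end

noncomputable section

namespace LaplaceBergman

/-! ### Norms of exponentials on the boundary -/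

section ExpNorm

variable {n : ℕ} {Ω : Set (Cn n)}

theorem pairing_comm (z ζ : Cn n) : pairing z ζ = pairing ζ z :=
  Finset.sum_congr rfl fun _ _ => mul_comm _ _

theorem enorm_cexp_sq (w : ℂ) : ‖Complex.exp w‖ₑ ^ 2 = ENNReal.ofReal (Real.exp (2 * w.re)) := by
  rw [← ofReal_norm, Complex.norm_exp, ← ENNReal.ofReal_pow (Real.exp_nonneg _),
    ← Real.exp_nat_mul]
  norm_num

theorem expNormSq_surfaceMeasure (z : Cn n) : expNormSq (surfaceMeasure Ω) z =
    ∫⁻ ζ in frontier Ω, ENNReal.ofReal (Real.exp (2 * inner ℝ (conjCn n z) ζ))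
      ∂(Measure.euclideanHausdorffMeasure (2 * n - 1) : Measure (Cn n)) := by
  simp only [expNormSq, surfaceMeasure, enorm_cexp_sq, pairing_comm z, inner_conjCn]

theorem sqrt_inv_pow_eq_rpow (hn : 1 ≤ n) {x : ℝ} (hx : 0 ≤ x) :
    (Real.sqrt x)⁻¹ ^ (2 * n - 1) = x ^ (-((n : ℝ) - 1 / 2)) := by
  rw [Real.sqrt_eq_rpow, ← Real.rpow_neg hx, ← Real.rpow_natCast, ← Real.rpow_mul hx,
    Nat.cast_sub (by omega)]
  push_cast
  congr 1
  ring

namespace IsBoundedStronglyConvexDomain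

theorem finrank_eq (hn : 1 ≤ n) : Module.finrank ℝ (Cn n) = (2 * n - 1) + 1 := by
  rw [finrank_real_Cn]
  omega

/-- With p the support point of the conjugate of z, Re⟨z, ζ⟩ = H(z) + ‖z‖⟨u, ζ - p⟩. Writing ‖z‖ as
(√‖z‖)² matches the Laplace-type estimates with t = √‖z‖. -/
theorem expNormSq_surfaceMeasure_eq (h : IsBoundedStronglyConvexDomain Ω) {z : Cn n} (hz : z ≠ 0) :
    ∃ p u, IsUnitNormal Ω p u ∧ expNormSq (surfaceMeasure Ω) z =
      ENNReal.ofReal (Real.exp (2 * supportFun Ω z)) * ∫⁻ ζ in frontier Ω,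
        ENNReal.ofReal (Real.exp (2 * (Real.sqrt ‖z‖ ^ 2 * inner ℝ u (ζ - p))))
          ∂(Measure.euclideanHausdorffMeasure (2 * n - 1) : Measure (Cn n)) := by
  obtain ⟨U, ρ, hd⟩ := h.exists_definingData
  have hy : conjCn n z ≠ 0 := by simpa using hz
  have hz0 : ‖z‖ ≠ 0 := norm_ne_zero_iff.2 hz
  refine ⟨_, _, hd.isUnitNormal_supportPoint hy, ?_⟩
  rw [expNormSq_surfaceMeasure, ← lintegral_const_mul' _ _ ENNReal.ofReal_ne_top]
  have hH : supportFun Ω z = inner ℝ (conjCn n z) (supportPoint Ω (conjCn n z)) := by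
    rw [supportFun_eq]
    exact hd.innerSupport_eq hy
  refine lintegral_congr fun ζ => ?_
  rw [← ENNReal.ofReal_mul (Real.exp_nonneg _), ← Real.exp_add, Real.sq_sqrt (norm_nonneg _),
    inner_smul_left, inner_sub_right, hH,
    LinearIsometryEquiv.norm_map]
  congr 2
  simp only [conj_trivial]
  field_simp
  ring

theorem exists_expNormSq_surfaceMeasure_bounds (h : IsBoundedStronglyConvexDomain Ω) (hn : 1 ≤ n) :
    ∃ c C : ℝ, 0 < c ∧ 0 < C ∧ ∀ z : Cn n, 1 ≤ ‖z‖ →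
      ENNReal.ofReal (c * (Real.exp (2 * supportFun Ω z) * ‖z‖ ^ (-((n : ℝ) - 1 / 2)))) ≤
        expNormSq (surfaceMeasure Ω) z ∧
      expNormSq (surfaceMeasure Ω) z ≤
        ENNReal.ofReal (C * (Real.exp (2 * supportFun Ω z) * ‖z‖ ^ (-((n : ℝ) - 1 / 2)))) := by
  obtain ⟨U, ρ, hd⟩ := h.exists_definingData
  obtain ⟨c, hc, hlow⟩ := hd.exists_le_lintegral_exp (finrank_eq hn)
  obtain ⟨C, hC, hup⟩ := hd.exists_lintegral_exp_le (finrank_eq hn)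
  refine ⟨c, C, hc, hC, fun z hz => ?_⟩
  have hz0 : z ≠ 0 := norm_pos_iff.1 (by linarith)
  obtain ⟨p, u, hu, heq⟩ := h.expNormSq_surfaceMeasure_eq hz0
  have ht : 1 ≤ Real.sqrt ‖z‖ := Real.one_le_sqrt.2 hz
  have key : ∀ a : ℝ, ENNReal.ofReal (a * (Real.exp (2 * supportFun Ω z) *
      ‖z‖ ^ (-((n : ℝ) - 1 / 2)))) = ENNReal.ofReal (Real.exp (2 * supportFun Ω z)) *
        ENNReal.ofReal (a * (Real.sqrt ‖z‖)⁻¹ ^ (2 * n - 1)) := fun a => by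
    rw [sqrt_inv_pow_eq_rpow hn (norm_nonneg _), ← ENNReal.ofReal_mul (Real.exp_nonneg _)]
    congr 1
    ring
  rw [key, key, heq]
  exact ⟨mul_le_mul_right (hlow p u hu _ ht) _, mul_le_mul_right (hup p u hu _ ht) _⟩

theorem surfaceMeasure_univ_lt_top (h : IsBoundedStronglyConvexDomain Ω) (hn : 1 ≤ n) :
    surfaceMeasure Ω univ < ∞ := by
  obtain ⟨U, ρ, hd⟩ := h.exists_definingData
  rw [surfaceMeasure, Measure.restrict_apply_univ]
  exact hd.measure_frontier_lt_top (finrank_eq hn)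

theorem surfaceMeasure_univ_pos (h : IsBoundedStronglyConvexDomain Ω) (hn : 1 ≤ n) :
    0 < surfaceMeasure Ω univ := by
  obtain ⟨U, ρ, hd⟩ := h.exists_definingData
  have := nontrivial_Cn hn
  obtain ⟨y, hy⟩ := exists_ne (0 : Cn n)
  obtain ⟨c, hc, r, hr, hle⟩ := hd.exists_le_measure_frontier_inter_closedBall (finrank_eq hn)
  rw [surfaceMeasure, Measure.restrict_apply_univ]
  exact (ENNReal.ofReal_pos.2 (by positivity)).trans_le
    ((hle _ (hd.isUnitNormal_supportPoint hy).mem_frontier r hr le_rfl).trans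
      (measure_mono inter_subset_left))

theorem exists_expNormSq_surfaceMeasure_bounds_of_norm_le_one
    (h : IsBoundedStronglyConvexDomain Ω) (hn : 1 ≤ n) :
    ∃ c C : ℝ, 0 < c ∧ 0 < C ∧ ∀ z : Cn n, ‖z‖ ≤ 1 →
      ENNReal.ofReal c ≤ expNormSq (surfaceMeasure Ω) z ∧
      expNormSq (surfaceMeasure Ω) z ≤ ENNReal.ofReal C := by
  obtain ⟨U, ρ, hd⟩ := h.exists_definingData
  obtain ⟨M, hM⟩ := hd.isCompact_frontier.isBounded.exists_norm_le
  have hlt := h.surfaceMeasure_univ_lt_top hn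
  have hS0 : 0 < (surfaceMeasure Ω univ).toReal :=
    ENNReal.toReal_pos (h.surfaceMeasure_univ_pos hn).ne' hlt.ne
  have hS : ∀ a : ℝ, ENNReal.ofReal (Real.exp a * (surfaceMeasure Ω univ).toReal) =
      ∫⁻ ζ, ENNReal.ofReal (Real.exp a) ∂(surfaceMeasure Ω) := fun a => by
    rw [lintegral_const, ENNReal.ofReal_mul (Real.exp_nonneg _), ENNReal.ofReal_toReal hlt.ne]
  refine ⟨Real.exp (-(2 * M)) * (surfaceMeasure Ω univ).toReal,
    Real.exp (2 * M) * (surfaceMeasure Ω univ).toReal, by positivity, by positivity,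
    fun z hz => ?_⟩
  have hin : ∀ ζ ∈ frontier Ω, |2 * inner ℝ (conjCn n z) ζ| ≤ 2 * M := fun ζ hζ => by
    rw [abs_mul, abs_two]
    refine mul_le_mul_of_nonneg_left ((abs_real_inner_le_norm _ _).trans ?_) two_pos.le
    rw [LinearIsometryEquiv.norm_map]
    exact (mul_le_of_le_one_left (norm_nonneg _) hz).trans (hM ζ hζ)
  rw [hS, hS, expNormSq_surfaceMeasure, surfaceMeasure]
  constructor
  · refine setLIntegral_mono' isClosed_frontier.measurableSet fun ζ hζ => ?_
    exact ENNReal.ofReal_le_ofReal (Real.exp_le_exp.2 (abs_le.1 (hin ζ hζ)).1)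
  · refine setLIntegral_mono' isClosed_frontier.measurableSet fun ζ hζ => ?_
    exact ENNReal.ofReal_le_ofReal (Real.exp_le_exp.2 (abs_le.1 (hin ζ hζ)).2)

end IsBoundedStronglyConvexDomain

end ExpNorm

/-! ### Control of entire functions near the origin -/

section MeanValue

variable {n : ℕ}

/-- This is the mean value property of w ↦ F(wz)² at w = 1. On the circle of radius 3 about 1 one
has 2 ≤ |w| ≤ 4, so z is pushed outwards by a factor bounded on both sides. -/
theorem enorm_sq_le_lintegral_circle {F : Cn n → ℂ} (hF : Differentiable ℂ F) (z : Cn n) :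
    ‖F z‖ₑ ^ 2 ≤ ENNReal.ofReal (2 * Real.pi)⁻¹ *
      ∫⁻ θ in Ioc 0 (2 * Real.pi), ‖F (circleMap 1 3 θ • z)‖ₑ ^ 2 := by
  have hd : Differentiable ℂ fun w : ℂ => F (w • z) ^ 2 :=
    (hF.comp (differentiable_id.smul_const z)).pow 2
  have h1 := (hd.diffContOnCl (s := Metric.ball (1 : ℂ) |3|)).circleAverage
  rw [Real.circleAverage_def, one_smul, intervalIntegral.integral_of_le Real.two_pi_pos.le] at h1
  calc ‖F z‖ₑ ^ 2 = ‖F z ^ 2‖ₑ := (enorm_pow _ _).symm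
    _ ≤ _ := by
      rw [← h1, enorm_smul, Real.enorm_of_nonneg (by positivity)]
      refine mul_le_mul_right ((enorm_integral_le_lintegral_enorm _).trans_eq ?_) _
      simp only [enorm_pow]

/-- Multiplication by a is a rotation, which preserves volume, followed by a real dilation by ‖a‖ in
real dimension 2n. -/
theorem lintegral_comp_complex_smul {a : ℂ} (ha : a ≠ 0) {g : Cn n → ℝ≥0∞}
    (hg : Measurable g) :
    ∫⁻ z, g (a • z) = ENNReal.ofReal ((‖a‖ ^ (2 * n))⁻¹) * ∫⁻ z, g z := by
  have hna : ‖a‖ ≠ 0 := norm_ne_zero_iff.2 ha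
  have hu : ‖a / (‖a‖ : ℂ)‖ = 1 := by
    rw [norm_div, Complex.norm_real, norm_norm, div_self hna]
  let e : Cn n ≃ₗᵢ[ℝ] Cn n :=
    { toLinearEquiv := (LinearEquiv.smulOfNeZero ℂ (Cn n) (a / (‖a‖ : ℂ))
        (by rw [← norm_ne_zero_iff, hu]; exact one_ne_zero)).restrictScalars ℝ
      norm_map' := fun z => by
        change ‖(a / (‖a‖ : ℂ)) • z‖ = ‖z‖
        rw [norm_smul, hu, one_mul] }
  have he : ∀ z, a • z = ‖a‖ • e z := fun z => by
    change a • z = ‖a‖ • ((a / (‖a‖ : ℂ)) • z)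
    rw [← Complex.coe_smul, smul_smul, mul_div_cancel₀ _ (by exact_mod_cast hna)]
  calc ∫⁻ z, g (a • z) = ∫⁻ z, g (‖a‖ • e z) := by simp only [he]
    _ = ∫⁻ z : Cn n, g (‖a‖ • z) :=
      e.measurePreserving.lintegral_comp (f := fun z => g (‖a‖ • z))
        (hg.comp (measurable_const_smul _))
    _ = ∫⁻ z, g z ∂(Measure.map (fun z : Cn n => ‖a‖ • z) volume) :=
      (lintegral_map hg (measurable_const_smul _)).symm
    _ = _ := by
      rw [Measure.map_addHaar_smul volume hna, lintegral_smul_measure, finrank_real_Cn,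
        abs_of_nonneg (by positivity), smul_eq_mul]

/-- The mass of `|F|²` near the origin is controlled by the mass on an annulus. -/
theorem setLIntegral_ball_le_setLIntegral_annulus (hn : 1 ≤ n) {F : Cn n → ℂ}
    (hF : Differentiable ℂ F) :
    ∫⁻ z in Metric.ball 0 1, ‖F z‖ₑ ^ 2 * ENNReal.ofReal (‖z‖ ^ n)⁻¹ ≤
      ∫⁻ z in Metric.ball 0 4 \ Metric.ball 0 1, ‖F z‖ₑ ^ 2 * ENNReal.ofReal (‖z‖ ^ n)⁻¹ := by
  set G : Cn n → ℝ≥0∞ := fun z => ‖F z‖ₑ ^ 2 * ENNReal.ofReal (‖z‖ ^ n)⁻¹ with hG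
  have hFm : Measurable F := hF.continuous.measurable
  have hGm : Measurable G := by fun_prop
  set J := ∫⁻ z in Metric.ball 0 1, G z with hJ
  set I := ∫⁻ z in Metric.ball 0 4 \ Metric.ball 0 1, G z with hI
  have hJI : J + I = ∫⁻ z in Metric.ball 0 4, G z := by
    rw [hJ, hI, ← lintegral_inter_add_sdiff G (Metric.ball 0 4)
      (measurableSet_ball (x := (0 : Cn n)) (ε := 1)),
      inter_eq_right.2 (Metric.ball_subset_ball (by norm_num))]
  -- Finiteness is needed to cancel J at the end.
  have hJtop : J ≠ ∞ := by
    obtain ⟨M, hM⟩ := (isCompact_closedBall (0 : Cn n) 1).exists_bound_of_continuousOn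
      hF.continuous.continuousOn
    have hfin : ∫⁻ z in Metric.ball (0 : Cn n) 1,
        ENNReal.ofReal M ^ 2 * ENNReal.ofReal (‖z‖ ^ n)⁻¹ < ∞ := by
      rw [lintegral_const_mul' _ _ (by finiteness)]
      exact ENNReal.mul_lt_top (by finiteness) (integrableOn_inv_norm_pow hn 1).lintegral_lt_top
    refine ((setLIntegral_mono' measurableSet_ball fun z hz => ?_).trans_lt hfin).ne
    refine mul_le_mul_left (pow_le_pow_left₀ zero_le ?_ 2) _
    rw [← ofReal_norm]
    exact ENNReal.ofReal_le_ofReal (hM z (Metric.ball_subset_closedBall hz))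
  -- The Jacobian contributes ‖a‖^(-2n) and the weight ‖a‖^n. The net factor ‖a‖^(-n) is at most 1/2
  -- because ‖a‖ ≥ 2 and n ≥ 1, and any factor below one would allow J to be absorbed.
  have hscale : ∀ θ, ∫⁻ z in Metric.ball 0 1,
      ‖F (circleMap 1 3 θ • z)‖ₑ ^ 2 * ENNReal.ofReal (‖z‖ ^ n)⁻¹ ≤ 2⁻¹ * (J + I) := by
    intro θ
    set a := circleMap 1 3 θ with ha
    have hdist : ‖a - 1‖ = 3 := by
      rw [ha, circleMap_sub_center, norm_circleMap_zero]
      norm_num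
    have ha2 : 2 ≤ ‖a‖ := by
      have := norm_sub_le a 1
      rw [hdist, norm_one] at this
      linarith
    have ha4 : ‖a‖ ≤ 4 := by
      have := norm_add_le (a - 1) 1
      rw [hdist, norm_one, sub_add_cancel] at this
      linarith
    have ha0 : a ≠ 0 := norm_pos_iff.1 (by linarith)
    have hind : Measurable ((Metric.ball 0 4).indicator G) := hGm.indicator measurableSet_ball
    calc ∫⁻ z in Metric.ball 0 1, ‖F (a • z)‖ₑ ^ 2 * ENNReal.ofReal (‖z‖ ^ n)⁻¹
        ≤ ∫⁻ z in Metric.ball 0 1, ENNReal.ofReal (‖a‖ ^ n) *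
            (Metric.ball 0 4).indicator G (a • z) := by
          refine setLIntegral_mono' measurableSet_ball fun z hz => ?_
          have hmem : a • z ∈ Metric.ball (0 : Cn n) 4 := by
            rw [mem_ball_zero_iff] at hz ⊢
            rw [norm_smul]
            nlinarith [norm_nonneg z, norm_nonneg a]
          rw [indicator_of_mem hmem, hG, mul_left_comm, ← ENNReal.ofReal_mul (by positivity),
            norm_smul, mul_pow, mul_inv, mul_inv_cancel_left₀ (by positivity)]
      _ ≤ ∫⁻ z, ENNReal.ofReal (‖a‖ ^ n) * (Metric.ball 0 4).indicator G (a • z) :=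
          setLIntegral_le_lintegral _ _
      _ = ENNReal.ofReal (‖a‖ ^ n)⁻¹ * (J + I) := by
          rw [lintegral_const_mul' _ _ ENNReal.ofReal_ne_top,
            lintegral_comp_complex_smul ha0 hind, lintegral_indicator measurableSet_ball, hJI,
            ← mul_assoc, ← ENNReal.ofReal_mul (by positivity)]
          congr 2
          rw [two_mul, pow_add, mul_inv, mul_inv_cancel_left₀ (by positivity)]
      _ ≤ 2⁻¹ * (J + I) := by
          gcongr
          rw [ENNReal.ofReal_inv_of_pos (by positivity), ENNReal.inv_le_inv]
          refine (ENNReal.ofReal_ofNat 2).symm.le.trans (ENNReal.ofReal_le_ofReal ?_)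
          exact ha2.trans (le_self_pow₀ (by linarith) (by omega))
  have hmain : J ≤ 2⁻¹ * (J + I) := by
    have hcirc : Measurable fun q : Cn n × ℝ => circleMap 1 3 q.2 • q.1 :=
      (((continuous_circleMap 1 3).comp continuous_snd).smul continuous_fst).measurable
    calc J ≤ ∫⁻ z in Metric.ball 0 1, ENNReal.ofReal (2 * Real.pi)⁻¹ *
          ∫⁻ θ in Ioc 0 (2 * Real.pi),
            ‖F (circleMap 1 3 θ • z)‖ₑ ^ 2 * ENNReal.ofReal (‖z‖ ^ n)⁻¹ := by
          refine lintegral_mono fun z => ?_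
          rw [lintegral_mul_const' _ _ ENNReal.ofReal_ne_top, ← mul_assoc]
          exact mul_le_mul_left (enorm_sq_le_lintegral_circle hF z) _
      _ = ENNReal.ofReal (2 * Real.pi)⁻¹ * ∫⁻ θ in Ioc 0 (2 * Real.pi),
            ∫⁻ z in Metric.ball 0 1,
              ‖F (circleMap 1 3 θ • z)‖ₑ ^ 2 * ENNReal.ofReal (‖z‖ ^ n)⁻¹ := by
          rw [lintegral_const_mul' _ _ ENNReal.ofReal_ne_top, lintegral_lintegral_swap]
          refine Measurable.aemeasurable ?_
          exact (((hFm.comp hcirc).enorm).pow_const 2).mul (by fun_prop)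
      _ ≤ ENNReal.ofReal (2 * Real.pi)⁻¹ * ∫⁻ θ in Ioc 0 (2 * Real.pi), 2⁻¹ * (J + I) := by
          gcongr with θ
          exact hscale θ
      _ = 2⁻¹ * (J + I) := by
          rw [setLIntegral_const, Real.volume_Ioc, sub_zero, mul_comm (2⁻¹ * (J + I)), ← mul_assoc,
            ← ENNReal.ofReal_mul (by positivity), inv_mul_cancel₀ Real.two_pi_pos.ne',
            ENNReal.ofReal_one, one_mul]
  have h2 : J + J ≤ J + I := by
    rw [← two_mul]
    calc 2 * J ≤ 2 * (2⁻¹ * (J + I)) := by gcongr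
      _ = J + I := by
        rw [← mul_assoc, ENNReal.mul_inv_cancel (by norm_num) (by norm_num), one_mul]
  exact (ENNReal.add_le_add_iff_left hJtop).1 h2

end MeanValue

end LaplaceBergman
end

noncomputable section

namespace LaplaceBergman

/-! ### Comparison of the weighted Bergman spaces -/

section Bergman

variable {n : ℕ} {Ω : Set (Cn n)}

theorem eLpNorm_two_eq_rpow (μ : Measure (Cn n)) (F : Cn n → ℂ) :
    eLpNorm F 2 μ = (∫⁻ z, ‖F z‖ₑ ^ 2 ∂μ) ^ (1 / 2 : ℝ) := by
  rw [eLpNorm_eq_lintegral_rpow_enorm_toReal (by norm_num) (by norm_num)]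
  norm_num

theorem eLpNorm_two_le_of_lintegral_le {ω ν : Measure (Cn n)} {F : Cn n → ℂ} {C : ℝ} (hC : 0 ≤ C)
    (h : ∫⁻ z, ‖F z‖ₑ ^ 2 ∂ω ≤ ENNReal.ofReal C * ∫⁻ z, ‖F z‖ₑ ^ 2 ∂ν) :
    eLpNorm F 2 ω ≤ ENNReal.ofReal (Real.sqrt C) * eLpNorm F 2 ν := by
  rw [eLpNorm_two_eq_rpow, eLpNorm_two_eq_rpow, Real.sqrt_eq_rpow,
    ← ENNReal.ofReal_rpow_of_nonneg hC (by norm_num), ← ENNReal.mul_rpow_of_nonneg _ _ (by norm_num)]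
  exact ENNReal.rpow_le_rpow h (by norm_num)

/-- Two weighted Bergman spaces with comparable square norms are isomorphic. -/
theorem idIsNormedSpaceIso_of_lintegral_le {ω ν : Measure (Cn n)} {C₁ C₂ : ℝ} (hC₁ : 0 < C₁)
    (hC₂ : 0 < C₂)
    (h₁ : ∀ F : Cn n → ℂ, Differentiable ℂ F →
      ∫⁻ z, ‖F z‖ₑ ^ 2 ∂ω ≤ ENNReal.ofReal C₁ * ∫⁻ z, ‖F z‖ₑ ^ 2 ∂ν)
    (h₂ : ∀ F : Cn n → ℂ, Differentiable ℂ F →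
      ∫⁻ z, ‖F z‖ₑ ^ 2 ∂ν ≤ ENNReal.ofReal C₂ * ∫⁻ z, ‖F z‖ₑ ^ 2 ∂ω)
    (h₀ : ∀ F : Cn n → ℂ, Differentiable ℂ F → ∫⁻ z, ‖F z‖ₑ ^ 2 ∂ν = 0 → F = 0) :
    IdIsNormedSpaceIso ω ν := by
  have hzero : ∀ F : Cn n → ℂ, Differentiable ℂ F → eLpNorm F 2 ν = 0 → F = 0 := fun F hF h0 => by
    rw [eLpNorm_two_eq_rpow, ENNReal.rpow_eq_zero_iff_of_pos (by norm_num)] at h0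
    exact h₀ F hF h0
  have hle₁ := fun F hF => eLpNorm_two_le_of_lintegral_le hC₁.le (h₁ F hF)
  have hle₂ := fun F hF => eLpNorm_two_le_of_lintegral_le hC₂.le (h₂ F hF)
  have hmem : bergmanSpace ω = bergmanSpace ν := by
    ext F
    refine and_congr_right fun hF => ?_
    refine ⟨fun h => ⟨hF.continuous.aestronglyMeasurable, ?_⟩,
      fun h => ⟨hF.continuous.aestronglyMeasurable, ?_⟩⟩
    · exact (hle₂ F hF).trans_lt (ENNReal.mul_lt_top ENNReal.ofReal_lt_top h.2)
    · exact (hle₁ F hF).trans_lt (ENNReal.mul_lt_top ENNReal.ofReal_lt_top h.2)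
  have htop : ∀ (μ : Measure (Cn n)), ∀ F ∈ bergmanSpace μ, eLpNorm F 2 μ ≠ ∞ :=
    fun μ F hF => hF.2.2.ne
  have hnorm : ∀ (μ : Measure (Cn n)), ∀ F ∈ bergmanSpace μ, bergmanNorm μ F = 0 →
      eLpNorm F 2 μ = 0 := fun μ F hF h0 =>
    ((ENNReal.toReal_eq_zero_iff _).1 h0).resolve_right (htop μ F hF)
  refine ⟨fun F hF h0 => hzero F hF.1 ?_, fun F hF h0 => hzero F hF.1 (hnorm ν F hF h0), hmem,
    (Real.sqrt C₂)⁻¹, Real.sqrt C₁, by positivity, by positivity, fun F hF => ⟨?_, ?_⟩⟩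
  · refine le_antisymm ((hle₂ F hF.1).trans_eq ?_) zero_le
    rw [hnorm ω F hF h0, mul_zero]
  · rw [inv_mul_le_iff₀ (by positivity), bergmanNorm, bergmanNorm,
      ← ENNReal.toReal_ofReal (Real.sqrt_nonneg C₂), ← ENNReal.toReal_mul]
    exact ENNReal.toReal_mono (ENNReal.mul_ne_top ENNReal.ofReal_ne_top (htop ω F hF))
      (hle₂ F hF.1)
  · rw [bergmanNorm, bergmanNorm, ← ENNReal.toReal_ofReal (Real.sqrt_nonneg C₁),
      ← ENNReal.toReal_mul]
    exact ENNReal.toReal_mono (ENNReal.mul_ne_top ENNReal.ofReal_ne_top (htop ν F (hmem ▸ hF)))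
      (hle₁ F hF.1)

namespace IsBoundedStronglyConvexDomain

theorem setLIntegral_supportMongeAmpere (h : IsBoundedStronglyConvexDomain Ω) (hn : 1 ≤ n)
    {s : Set (Cn n)} (hs : MeasurableSet s) {f : Cn n → ℝ≥0∞} (hf : Measurable f) :
    ∫⁻ z in s, f z ∂(supportMongeAmpere Ω) =
      ∫⁻ z in s, ENNReal.ofReal (smoothMongeAmpereDensity (supportFun Ω) z) * f z := by
  rw [supportMongeAmpere, restrict_withDensity hs, lintegral_withDensity_eq_lintegral_mul₀
    (h.aemeasurable_density hn).ennreal_ofReal.restrict hf.aemeasurable]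
  rfl

/-- The density is comparable to ‖z‖^(-n), so the annulus estimate carries over at the cost of the
factor C/c. -/
theorem exists_setLIntegral_ball_le (h : IsBoundedStronglyConvexDomain Ω) (hn : 1 ≤ n) :
    ∃ K : ℝ, 0 < K ∧ ∀ F : Cn n → ℂ, Differentiable ℂ F →
      ∫⁻ z in Metric.ball 0 1, ‖F z‖ₑ ^ 2 ∂(supportMongeAmpere Ω) ≤ ENNReal.ofReal K *
        ∫⁻ z in Metric.ball 0 4 \ Metric.ball 0 1, ‖F z‖ₑ ^ 2 ∂(supportMongeAmpere Ω) := by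
  obtain ⟨c, C, hc, hC, hbd⟩ := h.exists_smoothMongeAmpereDensity_supportFun_bounds
  refine ⟨C * c⁻¹, by positivity, fun F hF => ?_⟩
  have hFm : Measurable F := hF.continuous.measurable
  have hm : Measurable fun z => ‖F z‖ₑ ^ 2 := by fun_prop
  rw [h.setLIntegral_supportMongeAmpere hn measurableSet_ball hm,
    h.setLIntegral_supportMongeAmpere hn (measurableSet_ball.diff measurableSet_ball) hm,
    ENNReal.ofReal_mul hC.le, mul_assoc]
  calc ∫⁻ z in Metric.ball 0 1,
        ENNReal.ofReal (smoothMongeAmpereDensity (supportFun Ω) z) * ‖F z‖ₑ ^ 2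
      ≤ ∫⁻ z in Metric.ball 0 1,
          ENNReal.ofReal C * (‖F z‖ₑ ^ 2 * ENNReal.ofReal (‖z‖ ^ n)⁻¹) := by
        refine lintegral_mono_ae ?_
        filter_upwards [ae_restrict_of_ae (ae_ne_zero hn)] with z hz
        rw [mul_left_comm, ← ENNReal.ofReal_mul hC.le, mul_comm]
        exact mul_le_mul_right (ENNReal.ofReal_le_ofReal (hbd z hz).2) _
    _ = ENNReal.ofReal C * ∫⁻ z in Metric.ball 0 1,
          ‖F z‖ₑ ^ 2 * ENNReal.ofReal (‖z‖ ^ n)⁻¹ :=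
        lintegral_const_mul' _ _ ENNReal.ofReal_ne_top
    _ ≤ ENNReal.ofReal C * ∫⁻ z in Metric.ball 0 4 \ Metric.ball 0 1,
          ‖F z‖ₑ ^ 2 * ENNReal.ofReal (‖z‖ ^ n)⁻¹ :=
        mul_le_mul_right (setLIntegral_ball_le_setLIntegral_annulus hn hF) _
    _ ≤ ENNReal.ofReal C * (ENNReal.ofReal c⁻¹ * ∫⁻ z in Metric.ball 0 4 \ Metric.ball 0 1,
          ENNReal.ofReal (smoothMongeAmpereDensity (supportFun Ω) z) * ‖F z‖ₑ ^ 2) := by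
        refine mul_le_mul_right ?_ _
        rw [← lintegral_const_mul' _ _ ENNReal.ofReal_ne_top]
        refine lintegral_mono_ae ?_
        filter_upwards [ae_restrict_of_ae (ae_ne_zero hn)] with z hz
        rw [← mul_assoc, ← ENNReal.ofReal_mul (inv_nonneg.2 hc.le), mul_comm]
        refine mul_le_mul_left (ENNReal.ofReal_le_ofReal ?_) _
        rw [le_inv_mul_iff₀ hc]
        exact (hbd z hz).1

/-- Stated for any measure comparable to surface area, so that the surface measure and the boundary
Monge–Ampère measure are treated together. -/
theorem exists_expNormSq_bounds (h : IsBoundedStronglyConvexDomain Ω) (hn : 1 ≤ n)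
    {τ : Measure (Cn n)} {a b : ℝ} (ha : 0 < a) (hb : 0 < b)
    (h₁ : ENNReal.ofReal a • surfaceMeasure Ω ≤ τ) (h₂ : τ ≤ ENNReal.ofReal b • surfaceMeasure Ω) :
    ∃ c C : ℝ, 0 < c ∧ 0 < C ∧
      (∀ z : Cn n, 1 ≤ ‖z‖ →
        ENNReal.ofReal (c * (Real.exp (2 * supportFun Ω z) * ‖z‖ ^ (-((n : ℝ) - 1 / 2)))) ≤
          expNormSq τ z ∧
        expNormSq τ z ≤
          ENNReal.ofReal (C * (Real.exp (2 * supportFun Ω z) * ‖z‖ ^ (-((n : ℝ) - 1 / 2))))) ∧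
      ∀ z : Cn n, ‖z‖ ≤ 1 →
        ENNReal.ofReal c ≤ expNormSq τ z ∧ expNormSq τ z ≤ ENNReal.ofReal C := by
  obtain ⟨c, C, hc, hC, hbd⟩ := h.exists_expNormSq_surfaceMeasure_bounds hn
  obtain ⟨c', C', hc', hC', hbd'⟩ := h.exists_expNormSq_surfaceMeasure_bounds_of_norm_le_one hn
  have hlow : ∀ z, ENNReal.ofReal a * expNormSq (surfaceMeasure Ω) z ≤ expNormSq τ z := fun z => by
    rw [expNormSq, ← smul_eq_mul, ← lintegral_smul_measure]
    exact lintegral_mono' h₁ le_rfl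
  have hup : ∀ z, expNormSq τ z ≤ ENNReal.ofReal b * expNormSq (surfaceMeasure Ω) z := fun z => by
    rw [expNormSq, expNormSq, ← smul_eq_mul, ← lintegral_smul_measure]
    exact lintegral_mono' h₂ le_rfl
  refine ⟨a * min c c', b * max C C', by positivity, by positivity, fun z hz => ⟨?_, ?_⟩,
    fun z hz => ⟨?_, ?_⟩⟩
  · refine le_trans ?_ (hlow z)
    rw [mul_assoc, ENNReal.ofReal_mul ha.le]
    refine mul_le_mul_right (le_trans (ENNReal.ofReal_le_ofReal ?_) (hbd z hz).1) _
    exact mul_le_mul_of_nonneg_right (min_le_left _ _) (by positivity)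
  · refine (hup z).trans ?_
    rw [mul_assoc, ENNReal.ofReal_mul hb.le]
    refine mul_le_mul_right ((hbd z hz).2.trans (ENNReal.ofReal_le_ofReal ?_)) _
    exact mul_le_mul_of_nonneg_right (le_max_left _ _) (by positivity)
  · refine le_trans ?_ (hlow z)
    rw [ENNReal.ofReal_mul ha.le]
    exact mul_le_mul_right ((ENNReal.ofReal_le_ofReal (min_le_right _ _)).trans (hbd' z hz).1) _
  · refine (hup z).trans ?_
    rw [ENNReal.ofReal_mul hb.le]
    exact mul_le_mul_right ((hbd' z hz).2.trans (ENNReal.ofReal_le_ofReal (le_max_right _ _))) _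

/-- The weight of `nuMeasure` with respect to the Monge–Ampère measure. -/
def _root_.LaplaceBergman.nuWeight (Ω : Set (Cn n)) (z : Cn n) : ℝ :=
  Real.exp (-2 * supportFun Ω z) * ‖z‖ ^ ((n : ℝ) - 1 / 2)

theorem measurable_nuWeight (h : IsBoundedStronglyConvexDomain Ω) : Measurable (nuWeight Ω) := by
  have := h.continuous_supportFun.measurable
  unfold nuWeight
  fun_prop

theorem nuWeight_pos {z : Cn n} (hz : z ≠ 0) : 0 < nuWeight Ω z :=
  mul_pos (Real.exp_pos _) (Real.rpow_pos_of_pos (norm_pos_iff.2 hz) _)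

theorem nuWeight_eq_inv (z : Cn n) :
    nuWeight Ω z = (Real.exp (2 * supportFun Ω z) * ‖z‖ ^ (-((n : ℝ) - 1 / 2)))⁻¹ := by
  rw [nuWeight, mul_inv, ← Real.exp_neg, Real.rpow_neg (norm_nonneg _), inv_inv, neg_mul]

theorem exists_nuWeight_le (h : IsBoundedStronglyConvexDomain Ω) (hn : 1 ≤ n) :
    ∃ V : ℝ, 0 < V ∧ ∀ z : Cn n, ‖z‖ ≤ 1 → nuWeight Ω z ≤ V := by
  obtain ⟨M, hM⟩ := (isCompact_closedBall (0 : Cn n) 1).exists_bound_of_continuousOn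
    h.continuous_supportFun.continuousOn
  refine ⟨Real.exp (2 * M), Real.exp_pos _, fun z hz => ?_⟩
  have h1 := (abs_le.1 (hM z (mem_closedBall_zero_iff.2 hz))).1
  have hn' : (1 : ℝ) ≤ n := by exact_mod_cast hn
  refine (mul_le_of_le_one_right (Real.exp_nonneg _)
    (Real.rpow_le_one (norm_nonneg _) hz (by linarith))).trans (Real.exp_le_exp.2 (by linarith))

theorem exists_le_nuWeight (h : IsBoundedStronglyConvexDomain Ω) (hn : 1 ≤ n) (r : ℝ) :
    ∃ m : ℝ, 0 < m ∧ ∀ z : Cn n, 1 ≤ ‖z‖ → ‖z‖ ≤ r → m ≤ nuWeight Ω z := by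
  obtain ⟨M, hM⟩ := (isCompact_closedBall (0 : Cn n) r).exists_bound_of_continuousOn
    h.continuous_supportFun.continuousOn
  refine ⟨Real.exp (-(2 * M)), Real.exp_pos _, fun z hz hzr => ?_⟩
  have h1 := (abs_le.1 (hM z (mem_closedBall_zero_iff.2 hzr))).2
  have hn' : (1 : ℝ) ≤ n := by exact_mod_cast hn
  exact (Real.exp_le_exp.2 (by linarith)).trans (le_mul_of_one_le_right (Real.exp_nonneg _)
    (Real.one_le_rpow hz (by linarith)))

/-- Outside the unit ball the weights are comparable. Inside, the weight of ν vanishes at the origin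
while that of ω stays between positive constants, so only one pointwise inequality survives there,
and the weight of ω is merely bounded. -/
theorem exists_nuWeight_le_mul_expNormSq_inv (h : IsBoundedStronglyConvexDomain Ω) (hn : 1 ≤ n)
    {τ : Measure (Cn n)} {a b : ℝ} (ha : 0 < a) (hb : 0 < b)
    (h₁ : ENNReal.ofReal a • surfaceMeasure Ω ≤ τ) (h₂ : τ ≤ ENNReal.ofReal b • surfaceMeasure Ω) :
    ∃ K : ℝ, 0 < K ∧
      (∀ z, ENNReal.ofReal (nuWeight Ω z) ≤ ENNReal.ofReal K * (expNormSq τ z)⁻¹) ∧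
      (∀ z, 1 ≤ ‖z‖ → (expNormSq τ z)⁻¹ ≤ ENNReal.ofReal K * ENNReal.ofReal (nuWeight Ω z)) ∧
      ∀ z, ‖z‖ ≤ 1 → (expNormSq τ z)⁻¹ ≤ ENNReal.ofReal K := by
  obtain ⟨c, C, hc, hC, hout, hin⟩ := h.exists_expNormSq_bounds hn ha hb h₁ h₂
  obtain ⟨V, hV, hVle⟩ := h.exists_nuWeight_le hn
  have hw : ∀ z : Cn n, 1 ≤ ‖z‖ →
      0 < Real.exp (2 * supportFun Ω z) * ‖z‖ ^ (-((n : ℝ) - 1 / 2)) := fun z hz =>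
    mul_pos (Real.exp_pos _) (Real.rpow_pos_of_pos (by linarith) _)
  -- The first inequality needs C outside the unit ball and V * C inside; the two upper bounds need
  -- c⁻¹.
  refine ⟨max (max C (V * C)) c⁻¹, by positivity, fun z => ?_, fun z hz => ?_, fun z hz => ?_⟩
  · rcases le_total 1 ‖z‖ with hz | hz
    · refine le_trans ?_ (mul_le_mul_right (ENNReal.inv_le_inv.2 (hout z hz).2) _)
      have := hw z hz
      rw [← ENNReal.ofReal_inv_of_pos (by positivity), mul_inv, ← nuWeight_eq_inv,
        ← ENNReal.ofReal_mul (by positivity), ← mul_assoc]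
      refine ENNReal.ofReal_le_ofReal (le_mul_of_one_le_left ?_ ?_)
      · exact (nuWeight_pos (norm_pos_iff.1 (by linarith))).le
      · rw [← div_eq_mul_inv, one_le_div₀ hC]
        exact (le_max_left _ _).trans (le_max_left _ _)
    · refine le_trans ?_ (mul_le_mul_right (ENNReal.inv_le_inv.2 (hin z hz).2) _)
      rw [← ENNReal.ofReal_inv_of_pos hC, ← ENNReal.ofReal_mul (by positivity)]
      refine ENNReal.ofReal_le_ofReal ((hVle z hz).trans ?_)
      rw [← div_eq_mul_inv, le_div_iff₀ hC]
      exact (le_max_right _ _).trans (le_max_left _ _)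
  · refine (ENNReal.inv_le_inv.2 (hout z hz).1).trans ?_
    have := hw z hz
    rw [← ENNReal.ofReal_inv_of_pos (by positivity), mul_inv, ← nuWeight_eq_inv,
      ← ENNReal.ofReal_mul (by positivity)]
    refine ENNReal.ofReal_le_ofReal (mul_le_mul_of_nonneg_right (le_max_right _ _) ?_)
    exact (nuWeight_pos (norm_pos_iff.1 (by linarith))).le
  · refine (ENNReal.inv_le_inv.2 (hin z hz).1).trans ?_
    rw [← ENNReal.ofReal_inv_of_pos hc]
    exact ENNReal.ofReal_le_ofReal (le_max_right _ _)

theorem lintegral_nuMeasure (h : IsBoundedStronglyConvexDomain Ω) (hn : 1 ≤ n)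
    {f : Cn n → ℝ≥0∞} (hf : Measurable f) : ∫⁻ z, f z ∂(nuMeasure Ω) =
      ∫⁻ z, ENNReal.ofReal (nuWeight Ω z) * f z ∂(supportMongeAmpere Ω) := by
  rw [nuMeasure, mongeAmpere_supportFun h hn]
  exact lintegral_withDensity_eq_lintegral_mul _ h.measurable_nuWeight.ennreal_ofReal hf

/-- Density and weight are positive off the origin, so F vanishes almost everywhere, hence
everywhere by continuity. -/
theorem eq_zero_of_lintegral_nuMeasure (h : IsBoundedStronglyConvexDomain Ω) (hn : 1 ≤ n)
    {F : Cn n → ℂ} (hF : Continuous F) (h0 : ∫⁻ z, ‖F z‖ₑ ^ 2 ∂(nuMeasure Ω) = 0) : F = 0 := by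
  have hFm : Measurable F := hF.measurable
  have hm : Measurable fun z => ‖F z‖ₑ ^ 2 := by fun_prop
  have hw := h.measurable_nuWeight.ennreal_ofReal
  have hD := (h.aemeasurable_density hn).ennreal_ofReal
  rw [h.lintegral_nuMeasure hn hm, ← setLIntegral_univ,
    h.setLIntegral_supportMongeAmpere hn MeasurableSet.univ
      (f := fun z => ENNReal.ofReal (nuWeight Ω z) * ‖F z‖ₑ ^ 2) (hw.mul hm), setLIntegral_univ] at h0
  replace h0 := (lintegral_eq_zero_iff' (hD.mul (hw.mul hm).aemeasurable)).1 h0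
  refine (Continuous.ae_eq_iff_eq volume hF continuous_const).1 ?_
  filter_upwards [h0, ae_ne_zero hn] with z hz hz0
  have h1 : ENNReal.ofReal (smoothMongeAmpereDensity (supportFun Ω) z) ≠ 0 :=
    (ENNReal.ofReal_pos.2 (h.smoothMongeAmpereDensity_supportFun_pos hz0)).ne'
  have h2 : ENNReal.ofReal (nuWeight Ω z) ≠ 0 := (ENNReal.ofReal_pos.2 (nuWeight_pos hz0)).ne'
  have h3 := ((mul_eq_zero.1 hz).resolve_left h1)
  exact enorm_eq_zero.1 (pow_eq_zero_iff two_ne_zero |>.1 ((mul_eq_zero.1 h3).resolve_left h2))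

/-- The bound of ν by ω is pointwise. For the converse, the mass of |F|² in the unit ball is moved
to the annulus 1 ≤ ‖z‖ < 4, where the weight of ν is bounded below. -/
theorem idIsNormedSpaceIso (h : IsBoundedStronglyConvexDomain Ω) (hn : 1 ≤ n)
    {τ : Measure (Cn n)} {a b : ℝ} (ha : 0 < a) (hb : 0 < b)
    (h₁ : ENNReal.ofReal a • surfaceMeasure Ω ≤ τ) (h₂ : τ ≤ ENNReal.ofReal b • surfaceMeasure Ω) :
    IdIsNormedSpaceIso (omegaMeasure Ω τ) (nuMeasure Ω) := by
  obtain ⟨K, hK, hlow, hout, hin⟩ := h.exists_nuWeight_le_mul_expNormSq_inv hn ha hb h₁ h₂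
  obtain ⟨L, hL, hball⟩ := h.exists_setLIntegral_ball_le hn
  obtain ⟨m, hm, hmle⟩ := h.exists_le_nuWeight hn 4
  have hw := h.measurable_nuWeight.ennreal_ofReal
  refine idIsNormedSpaceIso_of_lintegral_le (C₁ := K * (L * m⁻¹ + 1)) (C₂ := K) (by positivity) hK
    (fun F hF => ?_) (fun F _ => ?_) fun F hF => h.eq_zero_of_lintegral_nuMeasure hn hF.continuous
  · set M := supportMongeAmpere Ω with hM
    have hFm : Measurable F := hF.continuous.measurable
    have hfm : Measurable fun z => ‖F z‖ₑ ^ 2 := by fun_prop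
    set B := Metric.ball (0 : Cn n) 1 with hB
    have hBm : MeasurableSet B := measurableSet_ball
    set A := Metric.ball (0 : Cn n) 4 \ B with hA
    have hAm : MeasurableSet A := measurableSet_ball.diff hBm
    classical
    -- Up to the factor K this dominates the weight of ω everywhere: by the constant 1 in the unit
    -- ball, by the weight of ν outside.
    set g : Cn n → ℝ≥0∞ := B.piecewise (fun _ => 1) fun z => ENNReal.ofReal (nuWeight Ω z) with hg
    have hgm : Measurable g := measurable_const.piecewise hBm hw
    have hle : omegaMeasure Ω τ ≤ ENNReal.ofReal K • M.withDensity g := by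
      rw [omegaMeasure, mongeAmpere_supportFun h hn, ← withDensity_smul _ hgm]
      refine withDensity_mono (Eventually.of_forall fun z => ?_)
      rw [Pi.smul_apply, smul_eq_mul, hg]
      by_cases hz : z ∈ B
      · rw [piecewise_eq_of_mem _ _ _ hz, mul_one]
        exact hin z (mem_ball_zero_iff.1 hz).le
      · rw [piecewise_eq_of_notMem _ _ _ hz]
        exact hout z (not_lt.1 fun hlt => hz (mem_ball_zero_iff.2 hlt))
    have hin' : ∫⁻ z in B, g z * ‖F z‖ₑ ^ 2 ∂M = ∫⁻ z in B, ‖F z‖ₑ ^ 2 ∂M :=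
      setLIntegral_congr_fun hBm fun z hz => by
        simp only [hg, piecewise_eq_of_mem _ _ _ hz, one_mul]
    have hout' : ∫⁻ z in Bᶜ, g z * ‖F z‖ₑ ^ 2 ∂M =
        ∫⁻ z in Bᶜ, ENNReal.ofReal (nuWeight Ω z) * ‖F z‖ₑ ^ 2 ∂M :=
      setLIntegral_congr_fun hBm.compl fun z hz => by
        simp only [hg, piecewise_eq_of_notMem _ _ _ hz]
    have hA' : ∫⁻ z in A, ‖F z‖ₑ ^ 2 ∂M ≤ ENNReal.ofReal m⁻¹ *
        ∫⁻ z in A, ENNReal.ofReal (nuWeight Ω z) * ‖F z‖ₑ ^ 2 ∂M := by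
      rw [← lintegral_const_mul' _ _ ENNReal.ofReal_ne_top]
      refine setLIntegral_mono' hAm fun z hz => ?_
      rw [← mul_assoc, ← ENNReal.ofReal_mul (by positivity)]
      refine le_mul_of_one_le_left zero_le (ENNReal.one_le_ofReal.2 ?_)
      rw [le_inv_mul_iff₀ hm, mul_one]
      exact hmle z (not_lt.1 fun hlt => hz.2 (mem_ball_zero_iff.2 hlt))
        (mem_ball_zero_iff.1 hz.1).le
    set N := ∫⁻ z, ENNReal.ofReal (nuWeight Ω z) * ‖F z‖ₑ ^ 2 ∂M with hN
    rw [h.lintegral_nuMeasure hn hfm]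
    calc ∫⁻ z, ‖F z‖ₑ ^ 2 ∂(omegaMeasure Ω τ)
        ≤ ∫⁻ z, ‖F z‖ₑ ^ 2 ∂(ENNReal.ofReal K • M.withDensity g) := lintegral_mono' hle le_rfl
      _ = ENNReal.ofReal K * (∫⁻ z in B, ‖F z‖ₑ ^ 2 ∂M +
            ∫⁻ z in Bᶜ, ENNReal.ofReal (nuWeight Ω z) * ‖F z‖ₑ ^ 2 ∂M) := by
          rw [lintegral_smul_measure, smul_eq_mul,
            lintegral_withDensity_eq_lintegral_mul _ hgm hfm, ← hin', ← hout',
            lintegral_add_compl _ hBm]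
          rfl
      _ ≤ ENNReal.ofReal K * (ENNReal.ofReal L * (ENNReal.ofReal m⁻¹ * N) + N) := by
          refine mul_le_mul_right (add_le_add ((hball F hF).trans ?_) ?_) _
          · exact mul_le_mul_right (hA'.trans
              (mul_le_mul_right (setLIntegral_le_lintegral _ _) _)) _
          · exact setLIntegral_le_lintegral _ _
      _ = ENNReal.ofReal (K * (L * m⁻¹ + 1)) * N := by
          rw [ENNReal.ofReal_mul hK.le, ENNReal.ofReal_add (by positivity) zero_le_one,
            ENNReal.ofReal_mul hL.le, ENNReal.ofReal_one]
          ring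
  · rw [← smul_eq_mul, ← lintegral_smul_measure]
    refine lintegral_mono' ?_ le_rfl
    rw [omegaMeasure, nuMeasure, ← withDensity_smul' _ _ ENNReal.ofReal_ne_top]
    exact withDensity_mono (Eventually.of_forall hlow)

end IsBoundedStronglyConvexDomain

end Bergman

end LaplaceBergman
end

noncomputable section

namespace LaplaceBergman

open scoped ComplexOrder

/-! ### Regularity and convexity of the Minkowski functional -/

section Gauge

variable {E : Type*} [NormedAddCommGroup E] [InnerProductSpace ℝ E] {Ω U : Set E} {ρ : E → ℝ} {p u : E}

namespace DefiningData

theorem gauge_eq_one_iff (h : DefiningData Ω U ρ) (h0 : (0 : E) ∈ Ω) {x : E} :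
    gauge Ω x = 1 ↔ x ∈ frontier Ω :=
  gauge_eq_one_iff_mem_frontier h.convex (h.isOpen.mem_nhds h0)

theorem continuous_gauge (h : DefiningData Ω U ρ) (h0 : (0 : E) ∈ Ω) : Continuous (gauge Ω) :=
  _root_.continuous_gauge h.convex (h.isOpen.mem_nhds h0)

theorem eventually_gauge_pos (h : DefiningData Ω U ρ) (h0 : (0 : E) ∈ Ω) (hp : p ∈ frontier Ω) :
    ∀ᶠ x in 𝓝 p, 0 < gauge Ω x :=
  (h.continuous_gauge h0).continuousAt.eventually
    (lt_mem_nhds (by rw [(h.gauge_eq_one_iff h0).2 hp]; exact one_pos))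

theorem inv_gauge_smul_mem_frontier (h : DefiningData Ω U ρ) (h0 : (0 : E) ∈ Ω) {x : E}
    (hx : 0 < gauge Ω x) : (gauge Ω x)⁻¹ • x ∈ frontier Ω := by
  rw [← h.gauge_eq_one_iff h0, gauge_smul_of_nonneg (inv_nonneg.2 hx.le), smul_eq_mul,
    inv_mul_cancel₀ hx.ne']

theorem inner_pos_of_zero_mem (h : DefiningData Ω U ρ) (h0 : (0 : E) ∈ Ω)
    (hu : IsUnitNormal Ω p u) : 0 < inner ℝ u p := by
  have := hu.inner_lt h.isOpen h0
  rwa [zero_sub, inner_neg_right, neg_lt_zero] at this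

variable [FiniteDimensional ℝ E]

/-- The radial projection q of x and the gauge m solve mq = x, ρ(q) = 0. Since 0 lies in Ω the
radial direction is transversal to the boundary, and the inverse function theorem applies. -/
theorem contDiffAt_gauge (h : DefiningData Ω U ρ) (h0 : (0 : E) ∈ Ω) (hp : p ∈ frontier Ω) :
    ContDiffAt ℝ 2 (gauge Ω) p := by
  obtain ⟨u, hu⟩ := exists_isUnitNormal h.isOpen h.convex h.nonempty hp
  have hpU := h.frontier_subset hp
  let Ψ : E × ℝ → E × ℝ := fun z => (z.2 • z.1, ρ z.1)
  let s : E → E × ℝ := fun x => ((gauge Ω x)⁻¹ • x, gauge Ω x)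
  have h1 : gauge Ω p = 1 := (h.gauge_eq_one_iff h0).2 hp
  have hsp : s p = (p, 1) := by simp only [s, h1, inv_one, one_smul]
  have hfst : HasFDerivAt (Prod.fst : E × ℝ → E) (ContinuousLinearMap.fst ℝ E ℝ) (p, (1 : ℝ)) :=
    hasFDerivAt_fst
  have hd1 : HasFDerivAt (fun z : E × ℝ => ρ z.1)
      ((fderiv ℝ ρ p).comp (ContinuousLinearMap.fst ℝ E ℝ)) (p, (1 : ℝ)) :=
    HasFDerivAt.comp (p, (1 : ℝ)) (h.hasFDerivAt hpU) hfst
  have hΨ' := (hasFDerivAt_snd (𝕜 := ℝ) (E := E) (F := ℝ) (p := (p, (1 : ℝ)))).smul hfst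
    |>.prodMk hd1
  have hΨ : ContDiffAt ℝ 2 Ψ (p, (1 : ℝ)) :=
    (contDiffAt_snd.smul contDiffAt_fst).prodMk
      (ContDiffAt.comp (p, (1 : ℝ)) (h.contDiffAt hpU) contDiffAt_fst)
  have hcont : ContinuousAt s p := by
    have hg := (h.continuous_gauge h0).continuousAt (x := p)
    exact ((hg.inv₀ (by rw [h1]; exact one_ne_zero)).smul continuousAt_id).prodMk hg
  have hs : ContDiffAt ℝ 2 s p := by
    refine contDiffAt_of_comp_eq two_ne_zero (by rw [hsp]; exact hΨ) (by rw [hsp]; exact hΨ') ?_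
      (ι := fun x => (x, (0 : ℝ))) (contDiffAt_id.prodMk contDiffAt_const) hcont ?_
    · rintro ⟨w, τ⟩ hw
      have e1 : w + τ • p = 0 := by simpa using congrArg Prod.fst hw
      have e2 : fderiv ℝ ρ p w = 0 := by simpa using congrArg Prod.snd hw
      have hw' : w = -(τ • p) := eq_neg_of_add_eq_zero_left e1
      have hpos := mul_pos (norm_pos_iff.2 (h.fderiv_ne_zero p hp)) (h.inner_pos_of_zero_mem h0 hu)
      rw [← h.fderiv_apply_eq_norm_mul_inner hu] at hpos
      rw [hw', map_neg, map_smul, neg_eq_zero, smul_eq_mul] at e2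
      have hτ := (mul_eq_zero.1 e2).resolve_right hpos.ne'
      rw [hτ, zero_smul, neg_zero] at hw'
      rw [hw', hτ]
      rfl
    · filter_upwards [h.eventually_gauge_pos h0 hp] with x hx
      refine Prod.ext ?_ (h.eq_zero_of_mem_frontier (h.inv_gauge_smul_mem_frontier h0 hx))
      exact smul_inv_smul₀ hx.ne' x
  exact contDiffAt_snd.comp p hs

/-- The linear function equal to 1 on the supporting hyperplane at p lies below the gauge near p and
touches it at p, so the two derivatives agree. -/
theorem fderiv_gauge_apply (h : DefiningData Ω U ρ) (h0 : (0 : E) ∈ Ω) (hu : IsUnitNormal Ω p u)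
    (v : E) : fderiv ℝ (gauge Ω) p v = inner ℝ u v / inner ℝ u p := by
  have hp := hu.mem_frontier
  have hpos := h.inner_pos_of_zero_mem h0 hu
  have h1 : gauge Ω p = 1 := (h.gauge_eq_one_iff h0).2 hp
  set ℓ : E →L[ℝ] ℝ := (inner ℝ u p)⁻¹ • innerSL ℝ u with hℓ
  have hmin : IsLocalMin (fun x => gauge Ω x - ℓ x) p := by
    filter_upwards [h.eventually_gauge_pos h0 hp] with x hx
    have h2 := hu.inner_le_of_mem_closure
      (frontier_subset_closure (h.inv_gauge_smul_mem_frontier h0 hx))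
    rw [inner_sub_right, inner_smul_right, sub_nonpos, inv_mul_le_iff₀ hx] at h2
    simp only [h1, hℓ, _root_.smul_apply, innerSL_apply_apply, smul_eq_mul]
    rw [inv_mul_cancel₀ hpos.ne', sub_self, sub_nonneg, inv_mul_le_iff₀ hpos]
    linarith
  have hd := ((h.contDiffAt_gauge h0 hp).differentiableAt two_ne_zero).hasFDerivAt.sub
    ℓ.hasFDerivAt
  rw [sub_eq_zero.1 (hmin.hasFDerivAt_eq_zero hd), hℓ, _root_.smul_apply,
    innerSL_apply_apply, smul_eq_mul, inv_mul_eq_div]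

/-- Quadratic separation is applied to the radial projection of p + tv onto the boundary. If v is
not radial, this projection moves at a rate bounded below, and the gauge grows quadratically over
its tangent plane. -/
theorem hessian_gauge_pos (h : DefiningData Ω U ρ) (h0 : (0 : E) ∈ Ω) (hp : p ∈ frontier Ω)
    {v : E} (hv : ∀ a : ℝ, v ≠ a • p) : 0 < fderiv ℝ (fderiv ℝ (gauge Ω)) p v v := by
  obtain ⟨u, hu⟩ := exists_isUnitNormal h.isOpen h.convex h.nonempty hp
  obtain ⟨c, hc, hsep⟩ := h.exists_quadratic_separation
  have hpos := h.inner_pos_of_zero_mem h0 hu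
  have h1 : gauge Ω p = 1 := (h.gauge_eq_one_iff h0).2 hp
  set δ := Metric.infDist v (Submodule.span ℝ {p} : Set E) with hδ
  have hδpos : 0 < δ := by
    refine ((Submodule.closed_of_finiteDimensional (Submodule.span ℝ {p})).notMem_iff_infDist_pos
      ⟨0, Submodule.zero_mem _⟩).1 fun hmem => ?_
    obtain ⟨a, ha⟩ := Submodule.mem_span_singleton.1 hmem
    exact hv a ha.symm
  have hδle : ∀ a : ℝ, δ ≤ ‖v - a • p‖ := fun a => by
    rw [← dist_eq_norm]
    exact Metric.infDist_le_dist_of_mem (Submodule.mem_span_singleton.2 ⟨a, rfl⟩)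
  have hline : Tendsto (fun t : ℝ => p + t • v) (𝓝[>] 0) (𝓝 p) := by
    have : Continuous fun t : ℝ => p + t • v := by fun_prop
    exact (this.tendsto' 0 p (by simp)).mono_left nhdsWithin_le_nhds
  have hlt2 : ∀ᶠ x in 𝓝 p, gauge Ω x < 2 :=
    (h.continuous_gauge h0).continuousAt.eventually (gt_mem_nhds (by rw [h1]; exact one_lt_two))
  refine hessian_pos_of_quadratic_growth (κ := c * δ ^ 2 / (2 * inner ℝ u p))
    (h.contDiffAt_gauge h0 hp) (by positivity) ?_
  filter_upwards [self_mem_nhdsWithin, hline.eventually (h.eventually_gauge_pos h0 hp),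
    hline.eventually hlt2] with t ht hm hm2
  have ht : 0 < t := ht
  set m := gauge Ω (p + t • v) with hmdef
  have h2 := hsep p u hu _ (frontier_subset_closure (h.inv_gauge_smul_mem_frontier h0 hm))
  rw [← hmdef] at h2
  -- Multiplied by m, the displacement is tv minus a multiple of p, so its norm is at least t times
  -- the distance from v to the line ℝp.
  have h3 : t * δ ≤ m * ‖m⁻¹ • (p + t • v) - p‖ := by
    have e : t • (v - (t⁻¹ * (m - 1)) • p) = m • (m⁻¹ • (p + t • v) - p) := by
      rw [smul_sub, smul_sub, smul_inv_smul₀ hm.ne', smul_smul, mul_inv_cancel_left₀ ht.ne',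
        sub_smul, one_smul]
      abel
    calc t * δ ≤ t * ‖v - (t⁻¹ * (m - 1)) • p‖ :=
          mul_le_mul_of_nonneg_left (hδle _) ht.le
      _ = ‖t • (v - (t⁻¹ * (m - 1)) • p)‖ := by
          rw [norm_smul, Real.norm_eq_abs, abs_of_pos ht]
      _ = _ := by rw [e, norm_smul, Real.norm_eq_abs, abs_of_pos hm]
  set N := ‖m⁻¹ • (p + t • v) - p‖ with hN
  have h4 : (t * δ) ^ 2 ≤ (m * N) ^ 2 := pow_le_pow_left₀ (by positivity) h3 2
  rw [h1, h.fderiv_gauge_apply h0 hu]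
  rw [inner_sub_right, inner_smul_right, inner_add_right, inner_smul_right] at h2
  set b := inner ℝ u p with hb
  set d := inner ℝ u v with hd
  have h5 : m * (c * N ^ 2) ≤ m * b - (b + t * d) := by
    have := mul_le_mul_of_nonneg_left h2 hm.le
    refine this.trans_eq ?_
    field_simp
    ring
  have h6 : c * (t * δ) ^ 2 ≤ 2 * (m * b - (b + t * d)) := by
    have e1 : c * (t * δ) ^ 2 ≤ c * (m * N) ^ 2 := mul_le_mul_of_nonneg_left h4 hc.le
    have e2 : c * (m * N) ^ 2 = m * (m * (c * N ^ 2)) := by ring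
    have e3 : 0 ≤ m * (c * N ^ 2) := by positivity
    have e4 : m * (m * (c * N ^ 2)) ≤ 2 * (m * (c * N ^ 2)) :=
      mul_le_mul_of_nonneg_right hm2.le e3
    linarith
  rw [div_mul_eq_mul_div, div_le_iff₀ (by positivity)]
  have e : (m - 1 - t * (d / b)) * (2 * b) = 2 * (m * b - (b + t * d)) := by
    field_simp
    ring
  rw [e]
  calc c * δ ^ 2 * t ^ 2 = c * (t * δ) ^ 2 := by ring
    _ ≤ _ := h6

end DefiningData

end Gauge

/-! ### Sign of the bordered determinant -/

section BorderedDeterminant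

/-- The determinant of a positive definite matrix bordered by a nonzero vector is negative. -/
theorem re_det_bordered_neg {n : ℕ} {A : Matrix (Fin n) (Fin n) ℂ} (hA : A.PosDef)
    {b : Fin n → ℂ} (hb : b ≠ 0) :
    (Matrix.fromBlocks (0 : Matrix Unit Unit ℂ) (Matrix.replicateRow Unit (star b))
      (Matrix.replicateCol Unit b) A).det.re < 0 := by
  have hu : IsUnit A.det := (Matrix.isUnit_iff_isUnit_det A).1 hA.isUnit
  let := A.invertibleOfIsUnitDet hu
  have hq : 0 < star b ⬝ᵥ (A⁻¹.mulVec b) := hA.inv.dotProduct_mulVec_pos hb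
  -- The Schur complement of A is the scalar -b*A⁻¹b, which is negative because A⁻¹ is positive
  -- definite.
  have hdet : ((0 : Matrix Unit Unit ℂ) - Matrix.replicateRow Unit (star b) * ⅟A *
      Matrix.replicateCol Unit b).det = -(star b ⬝ᵥ (A⁻¹.mulVec b)) := by
    rw [Matrix.det_unique, Matrix.invOf_eq_nonsing_inv, Matrix.mul_assoc, zero_sub,
      Matrix.neg_apply]
    rfl
  rw [Matrix.det_fromBlocks₂₂, hdet, mul_neg, Complex.neg_re, neg_neg_iff_pos]
  exact (Complex.pos_iff.1 (mul_pos hA.det_pos hq)).1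

end BorderedDeterminant

/-! ### Comparison of the boundary Monge–Ampère measure with surface area -/

section BoundaryMongeAmpere

variable {n : ℕ} {Ω : Set (Cn n)}

theorem dzbar_eq_star (f : Cn n → ℝ) (p : Cn n) : dzbar f p = star (dz f p) := by
  funext j
  simp [dzbar, dz]

theorem fderiv_eq_zero_of_dz_eq_zero {f : Cn n → ℝ} {p : Cn n} (h : dz f p = 0) :
    fderiv ℝ f p = 0 := by
  have hj : ∀ j, fderiv ℝ f p (ex j) = 0 ∧ fderiv ℝ f p (ey j) = 0 := fun j => by
    have h1 := congrFun h j
    have hre := congrArg Complex.re h1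
    have him := congrArg Complex.im h1
    simp [dz] at hre him
    exact ⟨hre, him⟩
  ext v
  rw [← sum_smul_ex v, map_sum, map_sum]
  refine Finset.sum_congr rfl fun j _ => ?_
  rw [complex_smul_eq, I_smul_ex, map_add, map_smul, map_smul, (hj j).1, (hj j).2]
  simp

theorem continuous_re_det_bordered (n : ℕ) :
    Continuous fun q : (Fin n → ℂ) × (Fin n → ℂ) × Matrix (Fin n) (Fin n) ℂ =>
      (Matrix.fromBlocks (0 : Matrix Unit Unit ℂ) (Matrix.replicateRow Unit q.1)
        (Matrix.replicateCol Unit q.2.1) q.2.2).det.re := by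
  refine Complex.continuous_re.comp (Continuous.matrix_det (Continuous.matrix_fromBlocks
    continuous_const ?_ ?_ (by fun_prop)))
  · exact continuous_pi fun _ => continuous_fst
  · exact continuous_pi fun j => continuous_pi fun _ =>
      (continuous_apply j).comp (continuous_fst.comp continuous_snd)

theorem continuousAt_lerayLeviDensity {f : Cn n → ℝ} {p : Cn n} (hf : ContDiffAt ℝ 2 f p)
    (h0 : fderiv ℝ f p ≠ 0) : ContinuousAt (lerayLeviDensity f) p := by
  have h1 : ContinuousAt (fderiv ℝ f) p := (hf.fderiv_right (m := 0) (by norm_num)).continuousAt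
  have h2 : ∀ v : Cn n, ContinuousAt (fun q => ((fderiv ℝ f q v : ℝ) : ℂ)) p := fun v =>
    Complex.continuous_ofReal.continuousAt.comp (h1.clm_apply continuousAt_const)
  have hdz : ContinuousAt (dz f) p := continuousAt_pi.2 fun j =>
    ((h2 _).sub (continuousAt_const.mul (h2 _))).div_const _
  have hdzbar : ContinuousAt (dzbar f) p := continuousAt_pi.2 fun j =>
    ((h2 _).add (continuousAt_const.mul (h2 _))).div_const _
  have hH := continuousAt_complexHessian hf
  have hdet := (continuous_re_det_bordered n).continuousAt.comp (hdzbar.prodMk (hdz.prodMk hH))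
  refine ContinuousAt.div (continuousAt_const.mul hdet) (continuousAt_const.mul h1.norm) ?_
  have := norm_pos_iff.2 h0
  positivity

namespace IsBoundedStronglyConvexDomain

theorem contDiffAt_gauge (h : IsBoundedStronglyConvexDomain Ω) (h0 : (0 : Cn n) ∈ Ω) {p : Cn n}
    (hp : p ∈ frontier Ω) : ContDiffAt ℝ 2 (gauge Ω) p := by
  obtain ⟨U, ρ, hd⟩ := h.exists_definingData
  exact hd.contDiffAt_gauge h0 hp

theorem fderiv_gauge_ne_zero (h : IsBoundedStronglyConvexDomain Ω) (h0 : (0 : Cn n) ∈ Ω)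
    {p : Cn n} (hp : p ∈ frontier Ω) : fderiv ℝ (gauge Ω) p ≠ 0 := by
  obtain ⟨U, ρ, hd⟩ := h.exists_definingData
  obtain ⟨u, hu⟩ := exists_isUnitNormal h.isOpen h.convex h.nonempty hp
  intro hz
  have h1 := hd.fderiv_gauge_apply h0 hu p
  rw [hz, div_self (hd.inner_pos_of_zero_mem h0 hu).ne'] at h1
  exact zero_ne_one h1

/-- The complex Hessian of the gauge is positive definite although the real one is only known to be
positive off the radial direction. The minus sign in the density then cancels that of the bordered
determinant. -/
theorem lerayLeviDensity_gauge_pos (h : IsBoundedStronglyConvexDomain Ω) (h0 : (0 : Cn n) ∈ Ω)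
    {p : Cn n} (hp : p ∈ frontier Ω) : 0 < lerayLeviDensity (gauge Ω) p := by
  obtain ⟨U, ρ, hd⟩ := h.exists_definingData
  have hp0 : p ≠ 0 := fun he => hd.notMem_of_mem_frontier hp (he ▸ h0)
  have hne := h.fderiv_gauge_ne_zero h0 hp
  have hpos := posDef_complexHessian (h.contDiffAt_gauge h0 hp) hp0 fun v hv =>
    hd.hessian_gauge_pos h0 hp hv
  have hdet := re_det_bordered_neg hpos fun hz => hne (fderiv_eq_zero_of_dz_eq_zero hz)
  have hnorm := norm_pos_iff.2 hne
  rw [lerayLeviDensity, dzbar_eq_star]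
  refine div_pos (mul_pos_of_neg_of_neg ?_ hdet) (by positivity)
  exact neg_lt_zero.2 (by exact_mod_cast Nat.factorial_pos _)

theorem exists_boundaryMongeAmpere_comparable (h : IsBoundedStronglyConvexDomain Ω)
    (h0 : (0 : Cn n) ∈ Ω) : ∃ a b : ℝ, 0 < a ∧ 0 < b ∧
      ENNReal.ofReal a • surfaceMeasure Ω ≤ boundaryMongeAmpere Ω ∧
      boundaryMongeAmpere Ω ≤ ENNReal.ofReal b • surfaceMeasure Ω := by
  obtain ⟨U, ρ, hd⟩ := h.exists_definingData
  have hcont : ContinuousOn (lerayLeviDensity (gauge Ω)) (frontier Ω) := fun p hp =>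
    (continuousAt_lerayLeviDensity (h.contDiffAt_gauge h0 hp)
      (h.fderiv_gauge_ne_zero h0 hp)).continuousWithinAt
  have hbounds : ∃ a b : ℝ, 0 < a ∧ 0 < b ∧ ∀ p ∈ frontier Ω,
      a ≤ lerayLeviDensity (gauge Ω) p ∧ lerayLeviDensity (gauge Ω) p ≤ b := by
    rcases (frontier Ω).eq_empty_or_nonempty with he | hne
    · exact ⟨1, 1, one_pos, one_pos, by simp [he]⟩
    obtain ⟨q, hq, hmin⟩ := hd.isCompact_frontier.exists_isMinOn hne hcont
    obtain ⟨r, hr, hmax⟩ := hd.isCompact_frontier.exists_isMaxOn hne hcont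
    exact ⟨_, _, h.lerayLeviDensity_gauge_pos h0 hq, h.lerayLeviDensity_gauge_pos h0 hr,
      fun p hp => ⟨hmin hp, hmax hp⟩⟩
  obtain ⟨a, b, ha, hb, hab⟩ := hbounds
  have hae : ∀ᵐ p ∂(surfaceMeasure Ω), p ∈ frontier Ω :=
    ae_restrict_mem isClosed_frontier.measurableSet
  refine ⟨a, b, ha, hb, ?_, ?_⟩
  · rw [boundaryMongeAmpere, ← MeasureTheory.withDensity_const]
    exact withDensity_mono (hae.mono fun p hp => ENNReal.ofReal_le_ofReal (hab p hp).1)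
  · rw [boundaryMongeAmpere, ← MeasureTheory.withDensity_const]
    exact withDensity_mono (hae.mono fun p hp => ENNReal.ofReal_le_ofReal (hab p hp).2)

end IsBoundedStronglyConvexDomain

end BoundaryMongeAmpere

end LaplaceBergman
end

theorem mainTheorem5 (n : ℕ) (hn : 1 ≤ n) (Ω : Set (LaplaceBergman.Cn n))
    (hΩ : LaplaceBergman.IsBoundedStronglyConvexDomain Ω) :
    (∃ c C : ℝ, 0 < c ∧ 0 < C ∧ ∀ z : LaplaceBergman.Cn n, 1 ≤ ‖z‖ →
      ENNReal.ofReal (c * (Real.exp (2 * LaplaceBergman.supportFun Ω z) *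
          ‖z‖ ^ (-((n : ℝ) - 1 / 2)))) ≤
        LaplaceBergman.expNormSq (LaplaceBergman.surfaceMeasure Ω) z ∧
      LaplaceBergman.expNormSq (LaplaceBergman.surfaceMeasure Ω) z ≤
        ENNReal.ofReal (C * (Real.exp (2 * LaplaceBergman.supportFun Ω z) *
          ‖z‖ ^ (-((n : ℝ) - 1 / 2))))) ∧
    LaplaceBergman.IsMongeAmpereMeasure (LaplaceBergman.supportFun Ω)
      (LaplaceBergman.mongeAmpere (LaplaceBergman.supportFun Ω)) ∧
    LaplaceBergman.IdIsNormedSpaceIso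
      (LaplaceBergman.omegaMeasure Ω (LaplaceBergman.surfaceMeasure Ω))
      (LaplaceBergman.nuMeasure Ω) ∧
    ((0 : LaplaceBergman.Cn n) ∈ Ω →
      LaplaceBergman.IdIsNormedSpaceIso
        (LaplaceBergman.omegaMeasure Ω (LaplaceBergman.boundaryMongeAmpere Ω))
        (LaplaceBergman.nuMeasure Ω)) := by
  refine ⟨hΩ.exists_expNormSq_surfaceMeasure_bounds hn,
    LaplaceBergman.isMongeAmpereMeasure_mongeAmpere hΩ hn, ?_, fun h0 => ?_⟩
  -- The surface measure is comparable to itself with both constants equal to one.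
  · exact hΩ.idIsNormedSpaceIso hn one_pos one_pos (by simp) (by simp)
  · obtain ⟨a, b, ha, hb, h₁, h₂⟩ := hΩ.exists_boundaryMongeAmpere_comparable h0
    exact hΩ.idIsNormedSpaceIso hn ha hb h₁ h₂
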